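/- Let $m\ge 3$ and $\mathbb F=\mathbb Z/2$. Let $Q$ be the quiver with vertices $[1],\dots,[m-1]$ and arrows $L_i\colon[i]\to[i-1]$, $R_i\colon[i-1]\to[i]$ for $2\le i\le m-1$, together with loops $U_1$ at $[1]$ and $U_m$ at $[m-1]$. Let $\mathcal C=\mathcal C(m,1)$ be the path algebra of $Q$ over $\mathbb F$ (products are concatenations read from left to right) modulo the two-sided ideal generated by $L_iL_{i-1}$ and $R_{i-1}R_i$ for $3\le i\le m-1$, and $L_2U_1$, $U_1R_2$, $R_{m-1}U_m$, $U_mL_{m-1}$. Let $I_x$ be the idempotent of the vertex $[x]$, let $\mathcal I\subset\mathcal C$ be the subring generated by the $I_x$, and call the nonzero classes of non-constant paths pure elements. Grade $\mathcal C[t]$ by $\operatorname{gr}(\mathcal C)=0$ and $\operatorname{gr}(t)=2m-4$. A tiling tree is a planar rooted tree $\Gamma$ embedded in the disk (up to isotopy), meeting the boundary circle exactly in its leaves, one of which is the root, all of whose internal vertices have degree $2m-2$, and whose edges are oriented and labeled by integers in $\{1,\dots,m-1\}$ such that, counterclockwise around every internal vertex, the edges are: incoming $1,2,\dots,m-1$,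 then outgoing $m-1,\dots,2,1$. The sectors at an internal vertex carry letters: $R_i$ between incoming $i-1$ and incoming $i$; $U_m$ between incoming $m-1$ and outgoing $m-1$; $L_i$ between outgoing $i$ and outgoing $i-1$; $U_1$ between outgoing $1$ and incoming $1$. The leaves and the root cut the boundary circle into intervals, ordered counterclockwise from the root; the algebra sequence $\vec a(\Gamma)=(a_1,\dots,a_n)$ consists, for each interval, of the product in $\mathcal C$ of the letters of the sectors in the adjacent component of the complement of $\Gamma$, in the order of the boundary walk. Let $\iota(\Gamma)=I_k$, where $k$ is the label of the root edge, and let $d(\Gamma)$ be the number of internal vertices. For pure $a_1,\dots,a_n$ set \[c_n(a_1,\dots,a_n)=\sum_{\Gamma:\ \vec a(\Gamma)=(a_1,\dots,a_n)}\iota(\Gamma)\,t^{d(\Gamma)}.\] For $n\ne2$ define $\mu^0_n$ on pure elements by \[\mu^0_n(a_1,\dots,a_n)=c_n(a_1,\dots,a_n)+\sum_{a_1=a\,a_1'}a\,c_n(a_1',a_2,\dots,a_n)+\sum_{a_n=a_n'a}c_n(a_1,\dots,a_{n-1},a_n')\,a,\] with sums over factorizations into pure elements, and extend it to $\mathcal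 C[t]$ so that it is multilinear over $\mathbb F[t]$ and vanishes whenever some entry is one of the idempotents $I_x$. (In particular $\mu^0_0=0$ and $\mu^0_1=0$.) Let $\mu^0_2$ be the multiplication of $\mathcal C[t]$. Theorem. The operations $\{\mu^0_n\}_{n\ge0}$ give $\mathcal C[t]$ the structure of a unital $A_\infty$-algebra over the ground ring $\mathcal I$ (of characteristic $2$), with unit $1=I_1+\dots+I_{m-1}$. That is: $\mathcal C[t]$ is a graded $\mathcal I$-bimodule; every $\mu^0_n$ is a map of $\mathcal I$-bimodules $\mathcal C[t]^{\otimes_{\mathcal I}n}\to\mathcal C[t]$ of degree $n-2$; $\mu^0_0=0$; for all $n$ and $a_1,\dots,a_n\in\mathcal C[t]$, \[\sum_{1\le i\le j\le n+1}\mu^0_{n-j+i+1}\bigl(a_1,\dots,a_{i-1},\mu^0_{j-i}(a_i,\dots,a_{j-1}),a_j,\dots,a_n\bigr)=0;\] $\mu^0_2(a,1)=\mu^0_2(1,a)=a$ for all $a$; and $\mu^0_n(a_1,\dots,a_n)=0$ whenever $n\neq2$ and some $a_i=1$. -/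

import Mathlib

open Polynomial

noncomputable section

namespace BorderedKnot

/-! ### Ordinary unital `A∞`-algebras in characteristic two

A family of operations `μ_n : A ⊗ ⋯ ⊗ A → A` is recorded as one function `μ : List A → A`, where
`μ [a₁, …, aₙ]` is `μ_n (a₁, …, aₙ)`.  A linear map of `k`-bimodules out of the `n`-fold tensor
product over `k` is the same thing as a map that is additive in every entry, balanced over `k`
between neighbouring entries, left `k`-linear in the first and right `k`-linear in the last. -/

/-- `μ` makes the `k`-bimodule `A`, graded by the subgroups `gr d`, into an `A∞`-algebra over the
ground ring `k` of characteristic two. -/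
structure IsAInfinityAlgebra (k : Type*) {A : Type*} [Ring k] [AddCommGroup A]
    [Module k A] [Module kᵐᵒᵖ A] [SMulCommClass k kᵐᵒᵖ A]
    (gr : ℤ → AddSubgroup A) (μ : List A → A) : Prop where
  /-- the ground ring has characteristic two -/
  char_two : CharP k 2
  /-- `A` is the direct sum of its graded pieces ... -/
  internal : DirectSum.IsInternal gr
  /-- ... which are sub-bimodules -/
  smul_mem_gr : ∀ (d : ℤ) (κ : k) (a : A), a ∈ gr d → κ • a ∈ gr d
  op_smul_mem_gr : ∀ (d : ℤ) (κ : k) (a : A), a ∈ gr d → MulOpposite.op κ • a ∈ gr d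
  /-- the operations are additive in every entry -/
  map_add : ∀ (x z : List A) (a b : A),
    μ (x ++ (a + b) :: z) = μ (x ++ a :: z) + μ (x ++ b :: z)
  /-- the operations are balanced: `μ (…, a κ, b, …) = μ (…, a, κ b, …)` -/
  balanced : ∀ (x z : List A) (a b : A) (κ : k),
    μ (x ++ (MulOpposite.op κ • a) :: b :: z) = μ (x ++ a :: (κ • b) :: z)
  /-- the operations are maps of left modules -/
  map_smul : ∀ (z : List A) (a : A) (κ : k), μ ((κ • a) :: z) = κ • μ (a :: z)
  /-- the operations are maps of right modules -/
  map_op_smul : ∀ (x : List A) (a : A) (κ : k),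
    μ (x ++ [MulOpposite.op κ • a]) = MulOpposite.op κ • μ (x ++ [a])
  /-- `μ_n` has degree `n - 2` -/
  degree : ∀ (l : List A) (ds : List ℤ), List.Forall₂ (fun a d => a ∈ gr d) l ds →
    μ l ∈ gr (ds.sum + (l.length : ℤ) - 2)
  /-- there is no curvature -/
  map_nil : μ [] = 0
  /-- the `A∞`-relation
  `∑_{i ≤ j} μ (a₁, …, aᵢ, μ (aᵢ₊₁, …, aⱼ), aⱼ₊₁, …, aₙ) = 0` -/
  relation : ∀ l : List A,
    ∑ i ∈ Finset.range (l.length + 1), ∑ j ∈ Finset.Icc i l.length,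
      μ (l.take i ++ μ ((l.take j).drop i) :: l.drop j) = 0

/-- A (strictly) unital `A∞`-algebra with unit `e`. -/
structure IsUnitalAInfinityAlgebra (k : Type*) {A : Type*} [Ring k] [AddCommGroup A]
    [Module k A] [Module kᵐᵒᵖ A] [SMulCommClass k kᵐᵒᵖ A]
    (gr : ℤ → AddSubgroup A) (μ : List A → A) (e : A) : Prop
    extends IsAInfinityAlgebra k gr μ where
  mul_unit : ∀ a : A, μ [a, e] = a
  unit_mul : ∀ a : A, μ [e, a] = a
  unit_vanish : ∀ l : List A, e ∈ l → l.length ≠ 2 → μ l = 0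

/-! ### The quiver and its path algebra

`m` is the number of gradings; all of this is meant for `m ≥ 3`, and then `m - 2 + 1 = m - 1`. -/

/-- The vertices `[1], …, [m-1]`; the vertex `[x]` is the element `x - 1` of `Fin (m - 2 + 1)`. -/
abbrev Vertex (m : ℕ) : Type := Fin (m - 2 + 1)

/-- The arrows of the quiver.  For `i : Fin (m - 2)`, `L i` and `R i` are the arrows usually
called `L_{i+2}` and `R_{i+2}` (so that the usual index runs from `2` to `m - 1`). -/
inductive Arrow (m : ℕ) : Type
  | U₁ : Arrow m
  | Uₘ : Arrow m
  | L (i : Fin (m - 2)) : Arrow m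
  | R (i : Fin (m - 2)) : Arrow m

variable {m : ℕ}

/-- `U₁ : [1] → [1]`, `Uₘ : [m-1] → [m-1]`, `L_i : [i] → [i-1]`, `R_i : [i-1] → [i]`. -/
def Arrow.src : Arrow m → Vertex m
  | .U₁ => 0
  | .Uₘ => Fin.last (m - 2)
  | .L i => i.succ
  | .R i => i.castSucc

def Arrow.tgt : Arrow m → Vertex m
  | .U₁ => 0
  | .Uₘ => Fin.last (m - 2)
  | .L i => i.castSucc
  | .R i => i.succ

/-- The list of arrows can be traversed one after the other, starting at the given vertex. -/
def IsPathFrom : Vertex m → List (Arrow m) → Prop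
  | _, [] => True
  | x, a :: l => a.src = x ∧ IsPathFrom a.tgt l

/-- The vertex at which such a list of arrows ends. -/
def endOf : Vertex m → List (Arrow m) → Vertex m
  | x, [] => x
  | _, a :: l => endOf a.tgt l

/-- A path in the quiver: a starting vertex and a (possibly empty) list of arrows. -/
@[ext] structure Path (m : ℕ) : Type where
  src : Vertex m
  arrows : List (Arrow m)
  isPath : IsPathFrom src arrows

def Path.tgt (p : Path m) : Vertex m := endOf p.src p.arrows

/-- The constant path. -/
def Path.const (x : Vertex m) : Path m := ⟨x, [], trivial⟩

/-- The path of length one. -/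
def Path.ofArrow (a : Arrow m) : Path m := ⟨a.src, [a], rfl, trivial⟩

lemma IsPathFrom.append : ∀ {x : Vertex m} {l l' : List (Arrow m)}, IsPathFrom x l →
    IsPathFrom (endOf x l) l' → IsPathFrom x (l ++ l')
  | _, [], _, _, h' => h'
  | _, _ :: _, _, h, h' => ⟨h.1, IsPathFrom.append h.2 h'⟩

lemma endOf_append : ∀ (x : Vertex m) (l l' : List (Arrow m)),
    endOf x (l ++ l') = endOf (endOf x l) l'
  | _, [], _ => rfl
  | _, a :: l, l' => endOf_append a.tgt l l'

/-- Concatenation: first `p`, then `q`. -/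
def Path.comp (p q : Path m) (h : p.tgt = q.src) : Path m :=
  ⟨p.src, p.arrows ++ q.arrows, p.isPath.append (by
    have hq := q.isPath
    rw [← h] at hq
    exact hq)⟩

lemma Path.tgt_comp (p q : Path m) (h : p.tgt = q.src) : (p.comp q h).tgt = q.tgt := by
  unfold Path.tgt Path.comp at *
  simp only [endOf_append, h]

/-- The path algebra over the field with two elements: formal linear combinations of paths. -/
def PathAlg (m : ℕ) : Type := Path m →₀ ZMod 2

instance : AddCommGroup (PathAlg m) := inferInstanceAs (AddCommGroup (Path m →₀ ZMod 2))
instance : Module (ZMod 2) (PathAlg m) := inferInstanceAs (Module (ZMod 2) (Path m →₀ ZMod 2))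

/-- The basis element of the path algebra given by a path. -/
def PathAlg.single (p : Path m) : PathAlg m := Finsupp.single p 1

open Classical in
/-- The product of two paths is their concatenation, or zero if they cannot be concatenated. -/
def PathAlg.mulPath (p q : Path m) : PathAlg m :=
  if h : p.tgt = q.src then PathAlg.single (p.comp q h) else 0

/-- The bilinear extension of the product of paths. -/
def PathAlg.mulHom (m : ℕ) : PathAlg m →ₗ[ZMod 2] PathAlg m →ₗ[ZMod 2] PathAlg m :=
  Finsupp.linearCombination (ZMod 2) fun p : Path m =>
    (Finsupp.linearCombination (ZMod 2) (PathAlg.mulPath p) : PathAlg m →ₗ[ZMod 2] PathAlg m)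

instance : Mul (PathAlg m) := ⟨fun x y => PathAlg.mulHom m x y⟩

/-- The unit is the sum of all constant paths. -/
instance : One (PathAlg m) := ⟨∑ x : Vertex m, PathAlg.single (Path.const x)⟩

lemma PathAlg.mul_def (x y : PathAlg m) : x * y = PathAlg.mulHom m x y := rfl

lemma PathAlg.one_def : (1 : PathAlg m) = ∑ x : Vertex m, PathAlg.single (Path.const x) := rfl

lemma PathAlg.single_mul_single (p q : Path m) :
    PathAlg.single p * PathAlg.single q = PathAlg.mulPath p q := by
  rw [PathAlg.mul_def]
  simp only [PathAlg.mulHom, PathAlg.single]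
  erw [Finsupp.linearCombination_single, one_smul, Finsupp.linearCombination_single, one_smul]

lemma PathAlg.induction {P : PathAlg m → Prop} (x : PathAlg m) (h0 : P 0)
    (hadd : ∀ x y, P x → P y → P (x + y)) (hs : ∀ p, P (PathAlg.single p)) : P x := by
  refine Finsupp.induction_linear x h0 hadd ?_
  intro p c
  have hc : c = 0 ∨ c = 1 := by
    revert c
    decide
  rcases hc with rfl | rfl
  · rw [Finsupp.single_zero]
    exact h0
  · exact hs p

lemma PathAlg.add_mul' (x y z : PathAlg m) : (x + y) * z = x * z + y * z := by
  simp only [PathAlg.mul_def, map_add, LinearMap.add_apply]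

lemma PathAlg.mul_add' (x y z : PathAlg m) : x * (y + z) = x * y + x * z := by
  simp only [PathAlg.mul_def, map_add]

lemma PathAlg.zero_mul' (x : PathAlg m) : 0 * x = 0 := by
  simp only [PathAlg.mul_def, map_zero, LinearMap.zero_apply]

lemma PathAlg.mul_zero' (x : PathAlg m) : x * 0 = 0 := by
  simp only [PathAlg.mul_def, map_zero]

lemma PathAlg.one_mul' (x : PathAlg m) : 1 * x = x := by
  induction x using PathAlg.induction with
  | h0 => exact PathAlg.mul_zero' _
  | hadd x y hx hy => rw [PathAlg.mul_add', hx, hy]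
  | hs p =>
    rw [PathAlg.one_def, PathAlg.mul_def, map_sum, LinearMap.sum_apply,
      Finset.sum_eq_single p.src]
    · rw [← PathAlg.mul_def, PathAlg.single_mul_single, PathAlg.mulPath,
        dif_pos (show (Path.const p.src).tgt = p.src from rfl)]
      rfl
    · intro x _ hx
      rw [← PathAlg.mul_def, PathAlg.single_mul_single, PathAlg.mulPath, dif_neg]
      exact hx
    · intro h
      exact absurd (Finset.mem_univ _) h

lemma PathAlg.mul_one' (x : PathAlg m) : x * 1 = x := by
  induction x using PathAlg.induction with
  | h0 => exact PathAlg.zero_mul' _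
  | hadd x y hx hy => rw [PathAlg.add_mul', hx, hy]
  | hs p =>
    rw [PathAlg.one_def, PathAlg.mul_def, map_sum, Finset.sum_eq_single p.tgt]
    · rw [← PathAlg.mul_def, PathAlg.single_mul_single, PathAlg.mulPath,
        dif_pos (show p.tgt = (Path.const p.tgt).src from rfl)]
      congr 1
      ext1
      · rfl
      · exact List.append_nil _
    · intro x _ hx
      rw [← PathAlg.mul_def, PathAlg.single_mul_single, PathAlg.mulPath, dif_neg]
      exact fun h => hx h.symm
    · intro h
      exact absurd (Finset.mem_univ _) h

lemma PathAlg.mul_assoc' (x y z : PathAlg m) : x * y * z = x * (y * z) := by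
  induction x using PathAlg.induction with
  | h0 => simp only [PathAlg.zero_mul']
  | hadd x x' hx hx' => simp only [PathAlg.add_mul', hx, hx']
  | hs p =>
    induction y using PathAlg.induction with
    | h0 => simp only [PathAlg.zero_mul', PathAlg.mul_zero']
    | hadd y y' hy hy' => simp only [PathAlg.add_mul', PathAlg.mul_add', hy, hy']
    | hs q =>
      induction z using PathAlg.induction with
      | h0 => simp only [PathAlg.mul_zero']
      | hadd z z' hz hz' => simp only [PathAlg.mul_add', hz, hz']
      | hs r =>
        simp only [PathAlg.single_mul_single]
        by_cases h : p.tgt = q.src <;> by_cases h' : q.tgt = r.src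
        · have h1 : (p.comp q h).tgt = r.src := by rw [Path.tgt_comp, h']
          have h2 : p.tgt = (q.comp r h').src := h
          simp only [PathAlg.mulPath, dif_pos h, dif_pos h', PathAlg.single_mul_single,
            dif_pos h1, dif_pos h2]
          congr 1
          ext1
          · rfl
          · exact List.append_assoc _ _ _
        · have h1 : ¬ (p.comp q h).tgt = r.src := by rw [Path.tgt_comp]; exact h'
          simp only [PathAlg.mulPath, dif_pos h, dif_neg h', PathAlg.single_mul_single,
            dif_neg h1, PathAlg.mul_zero']
        · have h2 : ¬ p.tgt = (q.comp r h').src := h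
          simp only [PathAlg.mulPath, dif_neg h, dif_pos h', PathAlg.single_mul_single,
            dif_neg h2, PathAlg.zero_mul']
        · simp only [PathAlg.mulPath, dif_neg h, dif_neg h', PathAlg.zero_mul',
            PathAlg.mul_zero']

instance : Ring (PathAlg m) :=
  { (inferInstance : AddCommGroup (PathAlg m)) with
    mul := (· * ·)
    one := 1
    left_distrib := PathAlg.mul_add'
    right_distrib := PathAlg.add_mul'
    zero_mul := PathAlg.zero_mul'
    mul_zero := PathAlg.mul_zero'
    mul_assoc := PathAlg.mul_assoc'
    one_mul := PathAlg.one_mul'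
    mul_one := PathAlg.mul_one' }

/-! ### The bordered algebra -/

/-- The pairs of consecutive arrows whose product is declared to be zero:
`L_i L_{i-1}`, `R_{i-1} R_i`, `L₂ U₁`, `U₁ R₂`, `R_{m-1} U_m`, `U_m L_{m-1}`. -/
inductive ZeroPair : Arrow m → Arrow m → Prop
  | LL (i j : Fin (m - 2)) (h : (i : ℕ) = j + 1) : ZeroPair (.L i) (.L j)
  | RR (i j : Fin (m - 2)) (h : (i : ℕ) = j + 1) : ZeroPair (.R j) (.R i)
  | LU (i : Fin (m - 2)) (h : (i : ℕ) = 0) : ZeroPair (.L i) .U₁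
  | UR (i : Fin (m - 2)) (h : (i : ℕ) = 0) : ZeroPair .U₁ (.R i)
  | RU (i : Fin (m - 2)) (h : (i : ℕ) + 1 = m - 2) : ZeroPair (.R i) .Uₘ
  | UL (i : Fin (m - 2)) (h : (i : ℕ) + 1 = m - 2) : ZeroPair .Uₘ (.L i)

/-- The two-sided ideal of the path algebra generated by these products. -/
def relIdeal (m : ℕ) : TwoSidedIdeal (PathAlg m) :=
  TwoSidedIdeal.span {x | ∃ a b : Arrow m, ZeroPair a b ∧
    x = PathAlg.single (Path.ofArrow a) * PathAlg.single (Path.ofArrow b)}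

/-- The bordered algebra `C(m,1)`: the path algebra modulo the relations. -/
def BordAlg (m : ℕ) : Type := (relIdeal m).ringCon.Quotient

instance : Ring (BordAlg m) := inferInstanceAs (Ring (relIdeal m).ringCon.Quotient)

/-- The class of a path in the bordered algebra. -/
def pathElt (p : Path m) : BordAlg m := (relIdeal m).ringCon.mk' (PathAlg.single p)

/-- The idempotent of a vertex. -/
def idem (x : Vertex m) : BordAlg m := pathElt (Path.const x)

/-- The class of an arrow. -/
def arrowElt (a : Arrow m) : BordAlg m := pathElt (Path.ofArrow a)

/-- The subring of idempotents, which is the ground ring. -/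
def idempRing (m : ℕ) : Subring (BordAlg m) := Subring.closure (Set.range idem)

/-- The right action of the ground ring on `C(m,1)[t]` by right multiplication. -/
instance : Module (idempRing m)ᵐᵒᵖ (BordAlg m)[X] :=
  Module.compHom _ (RingHom.op ((Polynomial.C : BordAlg m →+* (BordAlg m)[X]).comp
    (idempRing m).subtype))

lemma op_smul_def (κ : idempRing m) (f : (BordAlg m)[X]) :
    MulOpposite.op κ • f = f * Polynomial.C (κ : BordAlg m) := rfl

lemma smul_def (κ : idempRing m) (f : (BordAlg m)[X]) :
    κ • f = Polynomial.C (κ : BordAlg m) * f := by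
  ext n
  rw [Polynomial.coeff_smul, Polynomial.coeff_C_mul]
  rfl

instance : SMulCommClass (idempRing m) (idempRing m)ᵐᵒᵖ (BordAlg m)[X] where
  smul_comm κ κ' f := by
    induction κ' using MulOpposite.rec'
    rw [op_smul_def, op_smul_def, smul_def, smul_def, mul_assoc]

/-- The grading of `C(m,1)[t]` for which `C(m,1)` has degree `0` and `t` has degree `2m - 4`. -/
def gr (m : ℕ) (d : ℤ) : AddSubgroup (BordAlg m)[X] where
  carrier := {f | ∀ e : ℕ, f.coeff e ≠ 0 → (e : ℤ) * (2 * m - 4) = d}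
  zero_mem' := fun e h => absurd (Polynomial.coeff_zero e) h
  add_mem' := by
    intro f g hf hg e h
    by_cases h1 : f.coeff e = 0
    · refine hg e fun h2 => h ?_
      rw [Polynomial.coeff_add, h1, h2, add_zero]
    · exact hf e h1
  neg_mem' := by
    intro f hf e h
    refine hf e fun h1 => h ?_
    rw [Polynomial.coeff_neg, h1, neg_zero]

/-! ### Pure elements and coordinates

Since all the relations are monomial, the paths that contain no zero pair give a basis of
`C(m,1)` over the field with two elements. -/

/-- The path contains no zero pair of consecutive arrows. -/
def Path.Reduced (p : Path m) : Prop := p.arrows.IsChain fun a b => ¬ ZeroPair a b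

/-- The non-constant paths which are not zero in `C(m,1)`: they index the pure algebra elements. -/
def PurePath (m : ℕ) : Type := {p : Path m // p.arrows ≠ [] ∧ p.Reduced}

/-- The pure algebra element of such a path. -/
def PurePath.elt (p : PurePath m) : BordAlg m := pathElt p.1

/-- The linear combinations of paths that do contain a zero pair. -/
def PathAlg.zeroIdeal (m : ℕ) : AddSubgroup (PathAlg m) :=
  AddSubgroup.closure {x | ∃ p : Path m, ¬ p.Reduced ∧ x = PathAlg.single p}

lemma PathAlg.apply_of_mem_zeroIdeal {x : PathAlg m} (hx : x ∈ PathAlg.zeroIdeal m)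
    {r : Path m} (hr : r.Reduced) : (show Path m →₀ ZMod 2 from x) r = 0 := by
  induction hx using AddSubgroup.closure_induction with
  | mem x h =>
    obtain ⟨p, hp, rfl⟩ := h
    refine Finsupp.single_eq_of_ne ?_
    rintro rfl
    exact hp hr
  | zero => rfl
  | add x y _ _ hx hy =>
    refine (Finsupp.add_apply (show Path m →₀ ZMod 2 from x) y r).trans ?_
    rw [hx, hy, add_zero]
  | neg x _ hx =>
    refine (Finsupp.neg_apply (show Path m →₀ ZMod 2 from x) r).trans ?_
    rw [hx, neg_zero]

lemma PathAlg.mulPath_mem_zeroIdeal {p q : Path m} (h : p.Reduced → ¬ q.Reduced) :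
    PathAlg.mulPath p q ∈ PathAlg.zeroIdeal m := by
  by_cases hpq : p.tgt = q.src
  · rw [PathAlg.mulPath, dif_pos hpq]
    refine AddSubgroup.subset_closure ⟨_, fun hr => ?_, rfl⟩
    have h1 := List.isChain_append.1 hr
    exact h h1.1 h1.2.1
  · rw [PathAlg.mulPath, dif_neg hpq]
    exact zero_mem _

lemma PathAlg.mul_mem_zeroIdeal_left (x : PathAlg m) {y : PathAlg m}
    (hy : y ∈ PathAlg.zeroIdeal m) : x * y ∈ PathAlg.zeroIdeal m := by
  induction hy using AddSubgroup.closure_induction with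
  | mem y h =>
    obtain ⟨q, hq, rfl⟩ := h
    induction x using PathAlg.induction with
    | h0 => rw [zero_mul]; exact zero_mem _
    | hadd x x' hx hx' => rw [add_mul]; exact add_mem hx hx'
    | hs p =>
      rw [PathAlg.single_mul_single]
      exact PathAlg.mulPath_mem_zeroIdeal fun _ => hq
  | zero => rw [mul_zero]; exact zero_mem _
  | add y y' _ _ h h' => rw [mul_add]; exact add_mem h h'
  | neg y _ h => rw [mul_neg]; exact neg_mem h

lemma PathAlg.mul_mem_zeroIdeal_right {x : PathAlg m} (y : PathAlg m)
    (hx : x ∈ PathAlg.zeroIdeal m) : x * y ∈ PathAlg.zeroIdeal m := by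
  induction hx using AddSubgroup.closure_induction with
  | mem x h =>
    obtain ⟨p, hp, rfl⟩ := h
    induction y using PathAlg.induction with
    | h0 => rw [mul_zero]; exact zero_mem _
    | hadd y y' hy hy' => rw [mul_add]; exact add_mem hy hy'
    | hs q =>
      rw [PathAlg.single_mul_single]
      exact PathAlg.mulPath_mem_zeroIdeal fun h => absurd h hp
  | zero => rw [zero_mul]; exact zero_mem _
  | add y y' _ _ h h' => rw [add_mul]; exact add_mem h h'
  | neg y _ h => rw [neg_mul]; exact neg_mem h

lemma mem_zeroIdeal_of_mem_relIdeal {x : PathAlg m} (hx : x ∈ relIdeal m) :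
    x ∈ PathAlg.zeroIdeal m := by
  let J : TwoSidedIdeal (PathAlg m) := TwoSidedIdeal.mk' (PathAlg.zeroIdeal m : Set (PathAlg m))
    (zero_mem _) (fun hx hy => add_mem hx hy) (fun hx => neg_mem hx)
    (fun {x _} hy => PathAlg.mul_mem_zeroIdeal_left x hy)
    (fun {_ y} hx => PathAlg.mul_mem_zeroIdeal_right y hx)
  have hJ : ∀ y, y ∈ J ↔ y ∈ PathAlg.zeroIdeal m := fun y =>
    TwoSidedIdeal.mem_mk' _ _ _ _ _ _ _
  rw [← hJ]
  refine TwoSidedIdeal.mem_span_iff.1 hx J ?_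
  rintro _ ⟨a, b, hab, rfl⟩
  refine (hJ _).2 ?_
  rw [PathAlg.single_mul_single]
  by_cases h : (Path.ofArrow a).tgt = (Path.ofArrow b).src
  · rw [PathAlg.mulPath, dif_pos h]
    refine AddSubgroup.subset_closure ⟨_, fun hr => ?_, rfl⟩
    have h1 : List.IsChain (fun a b : Arrow m => ¬ ZeroPair a b) [a, b] := hr
    simp only [List.isChain_cons_cons] at h1
    exact h1.1 hab
  · rw [PathAlg.mulPath, dif_neg h]
    exact zero_mem _

/-- The coordinates of an element of `C(m,1)` along the pure algebra elements (the coordinates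
along the idempotents are dropped). -/
def pureCoord (c : BordAlg m) : PurePath m →₀ ZMod 2 :=
  Quotient.liftOn c
    (fun x => Finsupp.subtypeDomain (fun p : Path m => p.arrows ≠ [] ∧ p.Reduced)
      (show Path m →₀ ZMod 2 from x))
    (by
      intro x y hxy
      have h1 : x - y ∈ relIdeal m := (TwoSidedIdeal.rel_iff _ _ _).1 hxy
      ext ⟨p, hp⟩
      have h2 := PathAlg.apply_of_mem_zeroIdeal (mem_zeroIdeal_of_mem_relIdeal h1) hp.2
      have h3 := (Finsupp.sub_apply (show Path m →₀ ZMod 2 from x) y p).symm.trans h2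
      exact sub_eq_zero.1 h3)

/-! ### Tiling trees -/

/-- A half-edge at an internal vertex: an edge directed into (`inc`) or out of (`out`) the vertex,
with its label.  The label `k ∈ {1, …, m-1}` is the element `k - 1` of `Fin (m - 2 + 1)`. -/
inductive HalfEdge (m : ℕ) : Type
  | inc (k : Fin (m - 2 + 1)) : HalfEdge m
  | out (k : Fin (m - 2 + 1)) : HalfEdge m

/-- The next half-edge around an internal vertex, counterclockwise: the cyclic order is
`inc 1, inc 2, …, inc (m-1), out (m-1), …, out 2, out 1`. -/
def HalfEdge.next : HalfEdge m → HalfEdge m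
  | .inc k => Fin.lastCases (.out (Fin.last _)) (fun i => .inc i.succ) k
  | .out k => Fin.cases (.inc 0) (fun i => .out i.castSucc) k

/-- The letter of the sector between a half-edge and the next one counterclockwise:
`R_i` between `inc (i-1)` and `inc i`, `U_m` between `inc (m-1)` and `out (m-1)`,
`L_i` between `out i` and `out (i-1)`, and `U₁` between `out 1` and `inc 1`. -/
def HalfEdge.sector : HalfEdge m → Arrow m
  | .inc k => Fin.lastCases .Uₘ .R k
  | .out k => Fin.cases .U₁ .L k

/-- The decoration of an edge of a rooted tree: its orientation (away from the root or towards it)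
and its label. -/
structure EdgeDec (m : ℕ) : Type where
  awayFromRoot : Bool
  label : Fin (m - 2 + 1)

/-- The edge seen from its end that is farther from the root. -/
def EdgeDec.atFarEnd (e : EdgeDec m) : HalfEdge m :=
  if e.awayFromRoot then .inc e.label else .out e.label

/-- The edge seen from its end that is nearer to the root. -/
def EdgeDec.atNearEnd (e : EdgeDec m) : HalfEdge m :=
  if e.awayFromRoot then .out e.label else .inc e.label

/-- Planar rooted trees with decorated edges, up to isotopy, all of whose internal vertices have
degree `2m - 2`.  A tree is given by the edge at its root and by what is at the far end of that
edge: a leaf, or an internal vertex, whose remaining `2m - 3` edges, listed counterclockwise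
starting from the edge that comes from the root, carry further trees. -/
inductive DecTree (m : ℕ) : Type
  | leaf (e : EdgeDec m) : DecTree m
  | node (e : EdgeDec m) (child : Fin (2 * m - 3) → DecTree m) : DecTree m

/-- The decoration of the root edge. -/
def DecTree.edge : DecTree m → EdgeDec m
  | .leaf e => e
  | .node e _ => e

/-- The decorations agree with the local convention around every internal vertex. -/
def DecTree.Compatible : DecTree m → Prop
  | .leaf _ => True
  | .node e child => ∀ j : Fin (2 * m - 3),
      (child j).edge.atNearEnd = HalfEdge.next^[(j : ℕ) + 1] e.atFarEnd ∧ (child j).Compatible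

/-- The number `d` of internal vertices. -/
def DecTree.numVertices : DecTree m → ℕ
  | .leaf _ => 0
  | .node _ child => 1 + ∑ j, (child j).numVertices

/-- What one meets when walking around the tree, counterclockwise along the boundary of the disk
from the root back to the root: `none` for a leaf, `some s` for a sector with letter `s`. -/
def DecTree.contour : DecTree m → List (Option (Arrow m))
  | .leaf _ => [none]
  | .node e child => some e.atFarEnd.sector ::
      (List.ofFn fun j => (child j).contour ++ [some (child j).edge.atNearEnd.sector]).flatten

/-- Cut a list at the occurrences of `none`. -/
def cutAtNone {α : Type*} : List (Option α) → List (List α)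
  | [] => [[]]
  | none :: l => [] :: cutAtNone l
  | some a :: l => (cutAtNone l).modifyHead (a :: ·)

/-- The algebra sequence of a tree: the leaves and the root cut the boundary circle into intervals
`I₁, …, Iₙ`, ordered counterclockwise from the root, and the element of an interval is the product
in `C(m,1)` of the letters of the sectors in the region adjacent to it. -/
def DecTree.algSeq (Γ : DecTree m) : List (BordAlg m) :=
  (cutAtNone Γ.contour).map fun s => (s.map arrowElt).prod

/-! ### The operations -/

/-- The centered contribution `c_n(a₁, …, aₙ) = ∑ ι(Γ) t^{d(Γ)}`, the sum over all compatibly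
decorated trees `Γ` with algebra sequence `(a₁, …, aₙ)`.  (For `m ≥ 3` the number of internal
vertices of `Γ` is determined by `n`, so the sum is finite.  The tree without internal vertices
has the algebra sequence `(1, 1)` of empty products; it never contributes below, where all `aᵢ`
are pure.) -/
def centered (l : List (BordAlg m)) : (BordAlg m)[X] :=
  ∑ᶠ Γ : {Γ : DecTree m // Γ.Compatible ∧ Γ.algSeq = l},
    Polynomial.C (idem Γ.1.edge.label) * X ^ Γ.1.numVertices

/-- The left-extended terms `∑_{a₁ = a a₁'} a c_n(a₁', a₂, …, aₙ)`. -/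
def leftExtended : List (PurePath m) → (BordAlg m)[X]
  | [] => 0
  | p :: l => ∑ᶠ q : {q : PurePath m × PurePath m // q.1.elt * q.2.elt = p.elt},
      Polynomial.C q.1.1.elt * centered (q.1.2.elt :: l.map PurePath.elt)

/-- The right-extended terms `∑_{aₙ = aₙ' a} c_n(a₁, …, aₙ₋₁, aₙ') a`. -/
def rightExtended (l : List (PurePath m)) : (BordAlg m)[X] :=
  match l.getLast? with
  | none => 0
  | some p => ∑ᶠ q : {q : PurePath m × PurePath m // q.1.elt * q.2.elt = p.elt},
      centered (l.dropLast.map PurePath.elt ++ [q.1.1.elt]) * Polynomial.C q.1.2.elt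

/-- The tree-counting operations on pure algebra elements. -/
def pureOp (l : List (PurePath m)) : (BordAlg m)[X] :=
  centered (l.map PurePath.elt) + leftExtended l + rightExtended l

/-- The extension of operations on pure algebra elements to `C(m,1)[t]` which is multilinear over
the polynomials in `t` and which vanishes whenever some entry is an idempotent. -/
def extend : (List (PurePath m) → (BordAlg m)[X]) → List (BordAlg m)[X] → (BordAlg m)[X]
  | f, [] => f []
  | f, a :: l => a.sum fun e c => (pureCoord c).sum fun p z =>
      z.val • (extend (fun ps => f (p :: ps)) l * X ^ e)

/-- The operations `μ⁰_n` of weight zero on `C(m,1)[t]`: `μ⁰_2` is the product of the algebra,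
and all other operations count centered and extended tiling trees. -/
def mu : List (BordAlg m)[X] → (BordAlg m)[X]
  | [a, b] => a * b
  | l => extend pureOp l

end BorderedKnot

end

/-!
# The weight zero `A∞`-structure on the bordered algebra

The relations of `C(m,1)` are monomial and kill exactly the pairs `a, rot a`, where `rot a` is the
letter of the next sector around an internal vertex (`zeroPair_iff`).  A letter `a` can be followed
in the quiver only by `rot a` or by the letter `cont a` met at the other end of an edge.  So the
pure elements are the alternating words `a, cont a, a, …` (`Alt`), and the two operations on letters
satisfy the dihedral relation `rot ∘ cont ∘ rot = cont`, which says that an edge looks the same from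
its two ends.

Walking around a tiling tree one passes from a sector to the next one either by running along an edge
(`true`, apply `cont`) or by meeting a leaf (`false`, apply `rot`).  A tiling tree is thereby
encoded by its first letter and by a word of booleans in the language `Parses` of planar trees.
Hence a sequence of pure elements is the algebra sequence of at most one tiling tree
(`centered_map_elt`), and whether it is one (`Cent`) is invariant under cyclic rotation, since the
root may be moved to any leaf (`Cent.rotate`).

The relation on pure elements, `treeOp_relation`, is then a cancellation in pairs.
* A product `a b` of neighbouring entries inside a tree marks an edge at the boundary of one region.
  Cutting the tree there gives two trees, and the other end of the cut lies inside some other entry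
  `u = u' u''`.  This is `cbar_cut`, and it cancels centered trees with a product inside against
  compositions of a centered tree with an extended one (`mulTerms_cent`).
* The same cancellation takes place inside the extended operations (`mulTerms_extL`,
  `mulTerms_extR`), up to terms at the two ends of the sequence.
* All that remains involves only the first entry `a`, the last entry `b`, and a tree whose algebra
  sequence begins with an alternating word made from `a` and `b` and continues with the remaining
  entries.  The remaining terms on the left and on the right are two ways to sort one set of pairs
  of alternating words (`exchange`).

The operations are multilinear, so the relation has to be checked only on sequences of pure elements
and idempotents (`Multi.eq_zero`).  A sequence of length at least two with an idempotent entry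
satisfies it because the operations are balanced over the idempotents (`muTree_balanced`).  The
degree is `n - 2` because a tree with `d` internal vertices has `d (2m - 4) + 2` regions.
-/

noncomputable section

namespace BorderedKnot

variable {m : ℕ}

/-! ### The language of contour words -/

/-- The words read off while walking around a sequence of `k` planar trees all of whose internal
vertices have `K + 1` edges.  The letter `false` is a leaf; an internal vertex contributes the
letter `true` when the edge leading to it is traversed, the words of its `K` further subtrees, and
`true` again when that edge is traversed back. -/
inductive Parses (K : ℕ) : ℕ → List Bool → Prop
  | nil : Parses K 0 []
  | leaf {k : ℕ} {w : List Bool} : Parses K k w → Parses K (k + 1) (false :: w)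
  | node {k : ℕ} {v w : List Bool} : Parses K K v → Parses K k w →
      Parses K (k + 1) (true :: (v ++ true :: w))

namespace Parses

variable {K : ℕ}

lemma append {i j : ℕ} {u v : List Bool} (hu : Parses K i u) (hv : Parses K j v) :
    Parses K (i + j) (u ++ v) := by
  induction hu with
  | nil => simpa using hv
  | leaf _ ih =>
    rw [Nat.add_right_comm]
    exact ih.leaf
  | node h _ _ ih =>
    rw [Nat.add_right_comm, List.cons_append, List.append_assoc, List.cons_append]
    exact h.node ih

/-- The words of `k` trees form a prefix code: the parser is deterministic. -/
lemma prefix_unique {k : ℕ} {w : List Bool} (h : Parses K k w) :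
    ∀ {w' x x' : List Bool}, Parses K k w' → w ++ x = w' ++ x' → w = w' := by
  induction h with
  | nil =>
    intro w' x x' h' _
    cases h'
    rfl
  | leaf h ih =>
    intro w' x x' h' e
    cases h' with
    | leaf h' =>
      simp only [List.cons_append, List.cons.injEq, true_and] at e
      rw [ih h' e]
    | node h1 h2 => simp at e
  | node h1 h2 ih1 ih2 =>
    intro w' x x' h' e
    cases h' with
    | leaf h' => simp at e
    | node h1' h2' =>
      simp only [List.cons_append, List.append_assoc, List.cons.injEq, true_and] at e
      obtain rfl := ih1 h1' e
      simp only [List.append_cancel_left_eq, List.cons.injEq, true_and] at e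
      rw [ih2 h2' e]

lemma exists_count {k : ℕ} {w : List Bool} (hK : 1 ≤ K) (h : Parses K k w) :
    ∃ d, w.count false = d * (K - 1) + k := by
  induction h with
  | nil => exact ⟨0, by simp⟩
  | leaf _ ih =>
    obtain ⟨d, hd⟩ := ih
    exact ⟨d, by simp [hd, add_assoc]⟩
  | node _ _ ih1 ih2 =>
    obtain ⟨d, hd⟩ := ih1
    obtain ⟨e, he⟩ := ih2
    refine ⟨d + e + 1, ?_⟩
    obtain ⟨K, rfl⟩ := Nat.exists_eq_add_of_le' hK
    simp [hd, he]
    ring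

/-- A leaf may be replaced by an internal vertex. -/
lemma graft {v : List Bool} (hv : Parses K K v) {k : ℕ} {s : List Bool} (h : Parses K k s) :
    ∀ {u w : List Bool}, s = u ++ false :: w → Parses K k (u ++ true :: (v ++ true :: w)) := by
  induction h with
  | nil => intro u w e; simp at e
  | leaf h ih =>
    intro u w e
    rcases u with _ | ⟨b, u⟩
    · simp only [List.nil_append, List.cons.injEq, true_and] at e
      subst e
      exact hv.node h
    · simp only [List.cons_append, List.cons.injEq] at e
      obtain ⟨rfl, e⟩ := e
      exact (ih e).leaf
  | node h1 h2 ih1 ih2 =>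
    intro u w e
    rcases u with _ | ⟨b, u⟩
    · simp at e
    · simp only [List.cons_append, List.cons.injEq] at e
      obtain ⟨rfl, e⟩ := e
      rcases List.append_eq_append_iff.1 e with ⟨a, rfl, e'⟩ | ⟨a, rfl, e'⟩
      · rcases a with _ | ⟨b, a⟩
        · simp at e'
        · simp only [List.cons_append, List.cons.injEq] at e'
          obtain ⟨rfl, e'⟩ := e'
          have := h1.node (ih2 e')
          simpa using this
      · rcases a with _ | ⟨b, a⟩
        · simp at e'
        · simp only [List.cons_append, List.cons.injEq] at e'
          obtain ⟨rfl, rfl⟩ := e'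
          have := (ih1 rfl).node h2
          simpa using this

/-- Every inner edge is traversed twice, and the part of the tree beyond it can be cut off, which
leaves a leaf in its place.  A given traversal is the first or the second one of its edge. -/
lemma cut {k : ℕ} {s : List Bool} (h : Parses K k s) :
    ∀ {u w : List Bool}, s = u ++ true :: w →
      (∃ w₁ w₂, w = w₁ ++ true :: w₂ ∧ Parses K K w₁ ∧ Parses K k (u ++ false :: w₂)) ∨
      (∃ u₁ u₂, u = u₁ ++ true :: u₂ ∧ Parses K K u₂ ∧ Parses K k (u₁ ++ false :: w)) := by
  induction h with
  | nil => intro u w e; simp at e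
  | leaf h ih =>
    intro u w e
    rcases u with _ | ⟨b, u⟩
    · simp at e
    · simp only [List.cons_append, List.cons.injEq] at e
      obtain ⟨rfl, e⟩ := e
      rcases ih e with ⟨w₁, w₂, rfl, h1, h2⟩ | ⟨u₁, u₂, rfl, h1, h2⟩
      · exact .inl ⟨w₁, w₂, rfl, h1, h2.leaf⟩
      · exact .inr ⟨false :: u₁, u₂, rfl, h1, h2.leaf⟩
  | node h1 h2 ih1 ih2 =>
    rename_i v₀ w₀
    intro u w e
    rcases u with _ | ⟨b, u⟩
    · simp only [List.nil_append, List.cons.injEq, true_and] at e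
      exact .inl ⟨_, _, e.symm, h1, h2.leaf⟩
    · simp only [List.cons_append, List.cons.injEq] at e
      obtain ⟨rfl, e⟩ := e
      rcases List.append_eq_append_iff.1 e with ⟨a, rfl, e'⟩ | ⟨a, rfl, e'⟩
      · rcases a with _ | ⟨b, a⟩
        · simp only [List.nil_append, List.cons.injEq, true_and] at e'
          subst e'
          exact .inr ⟨[], v₀, by simp, h1, h2.leaf⟩
        · simp only [List.cons_append, List.cons.injEq] at e'
          obtain ⟨rfl, e'⟩ := e'
          rcases ih2 e' with ⟨w₁, w₂, rfl, h3, h4⟩ | ⟨u₁, u₂, rfl, h3, h4⟩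
          · refine .inl ⟨w₁, w₂, rfl, h3, ?_⟩
            simpa using h1.node h4
          · refine .inr ⟨true :: (v₀ ++ true :: u₁), u₂, by simp, h3, ?_⟩
            simpa using h1.node h4
      · rcases a with _ | ⟨b, a⟩
        · simp only [List.nil_append, List.cons.injEq, true_and] at e'
          subst e'
          exact .inr ⟨[], u, by simp, by simpa using h1, h2.leaf⟩
        · simp only [List.cons_append, List.cons.injEq] at e'
          obtain ⟨rfl, rfl⟩ := e'
          rcases ih1 rfl with ⟨w₁, w₂, rfl, h3, h4⟩ | ⟨u₁, u₂, rfl, h3, h4⟩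
          · refine .inl ⟨w₁, w₂ ++ true :: w₀, by simp, h3, ?_⟩
            simpa using h4.node h2
          · refine .inr ⟨true :: u₁, u₂, by simp, h3, ?_⟩
            simpa using h4.node h2

/-- The position of a leaf: it is one of the `k` trees, or lies deeper in one of them. -/
lemma leaf_cases {k : ℕ} {s : List Bool} (h : Parses K k s) :
    ∀ {u w : List Bool}, s = u ++ false :: w →
      (∃ i j, i + j + 1 = k ∧ Parses K i u ∧ Parses K j w) ∨
      (∃ i j u₀ u₁ w₁ w₀, i + j + 1 = k ∧ u = u₀ ++ true :: u₁ ∧ w = w₁ ++ true :: w₀ ∧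
        Parses K i u₀ ∧ Parses K j w₀ ∧ Parses K K (u₁ ++ false :: w₁)) := by
  induction h with
  | nil => intro u w e; simp at e
  | leaf h ih =>
    rename_i k s
    intro u w e
    rcases u with _ | ⟨b, u⟩
    · simp only [List.nil_append, List.cons.injEq, true_and] at e
      subst e
      exact .inl ⟨0, k, by omega, .nil, h⟩
    · simp only [List.cons_append, List.cons.injEq] at e
      obtain ⟨rfl, e⟩ := e
      rcases ih e with ⟨i, j, hk, h1, h2⟩ | ⟨i, j, u₀, u₁, w₁, w₀, hk, rfl, rfl, h1, h2, h3⟩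
      · exact .inl ⟨i + 1, j, by omega, h1.leaf, h2⟩
      · exact .inr ⟨i + 1, j, false :: u₀, u₁, w₁, w₀, by omega, rfl, rfl, h1.leaf, h2, h3⟩
  | node h1 h2 ih1 ih2 =>
    rename_i k v₀ w₀'
    intro u w e
    rcases u with _ | ⟨b, u⟩
    · simp at e
    · simp only [List.cons_append, List.cons.injEq] at e
      obtain ⟨rfl, e⟩ := e
      rcases List.append_eq_append_iff.1 e with ⟨a, rfl, e'⟩ | ⟨a, rfl, e'⟩
      · rcases a with _ | ⟨b, a⟩
        · simp at e'
        · simp only [List.cons_append, List.cons.injEq] at e'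
          obtain ⟨rfl, e'⟩ := e'
          rcases ih2 e' with ⟨i, j, hk, h3, h4⟩ | ⟨i, j, u₀, u₁, w₁, w₀, hk, rfl, rfl, h3, h4, h5⟩
          · exact .inl ⟨i + 1, j, by omega, by simpa using h1.node h3, h4⟩
          · exact .inr ⟨i + 1, j, true :: (v₀ ++ true :: u₀), u₁, w₁, w₀, by omega, by simp, rfl,
              h1.node h3, h4, h5⟩
      · rcases a with _ | ⟨b, a⟩
        · simp at e'
        · simp only [List.cons_append, List.cons.injEq] at e'
          obtain ⟨rfl, rfl⟩ := e'
          exact .inr ⟨0, k, [], u, a, w₀', by omega, rfl, rfl, .nil, h2, h1⟩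

/-- The root may be moved to any leaf: a tree whose word is `u`, leaf, `w` has the word
`w`, leaf, `u` when seen from that leaf. -/
lemma rotate : ∀ {u w : List Bool}, Parses K K (u ++ false :: w) → Parses K K (w ++ false :: u) := by
  suffices H : ∀ n, ∀ u w : List Bool, u.length + w.length = n →
      Parses K K (u ++ false :: w) → Parses K K (w ++ false :: u) from
    fun {u w} h => H _ u w rfl h
  intro n
  induction n using Nat.strong_induction_on with
  | _ n ih =>
    intro u w hn h
    rcases h.leaf_cases rfl with ⟨i, j, hk, h1, h2⟩ | ⟨i, j, u₀, u₁, w₁, w₀, hk, rfl, rfl, h1, h2, h3⟩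
    · have := h2.append h1.leaf
      rwa [show j + (i + 1) = K by omega] at this
    · have h4 := h2.append h1.leaf
      rw [show j + (i + 1) = K by omega] at h4
      have h5 := ih (u₁.length + w₁.length) (by simp at hn; omega) _ _ rfl h3
      simpa using graft h4 h5 rfl

end Parses

/-! ### The dihedral symmetry of the letters -/

/-- The letter that continues a given letter inside a region: the nonzero non-constant paths of
`C(m,1)` are the alternating words `a, cont a, a, …`. -/
def Arrow.cont : Arrow m → Arrow m
  | .U₁ => .U₁
  | .Uₘ => .Uₘ
  | .L i => .R i
  | .R i => .L i

/-- The half-edge whose sector carries a given letter. -/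
def HalfEdge.ofArrow : Arrow m → HalfEdge m
  | .U₁ => .out 0
  | .Uₘ => .inc (Fin.last _)
  | .L i => .out i.succ
  | .R i => .inc i.castSucc

/-- The letter of the next sector, counterclockwise around an internal vertex. -/
def Arrow.rot (a : Arrow m) : Arrow m := (HalfEdge.ofArrow a).next.sector

/-- The same edge seen from its other end. -/
def HalfEdge.flip : HalfEdge m → HalfEdge m
  | .inc k => .out k
  | .out k => .inc k

/-- The label of the edge to which a half-edge belongs. -/
def HalfEdge.label : HalfEdge m → Fin (m - 2 + 1)
  | .inc k => k
  | .out k => k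

@[simp] lemma HalfEdge.next_inc_last : (HalfEdge.inc (Fin.last _) : HalfEdge m).next =
    .out (Fin.last _) := by simp [HalfEdge.next]
@[simp] lemma HalfEdge.next_inc_castSucc (i : Fin (m - 2)) :
    (HalfEdge.inc i.castSucc : HalfEdge m).next = .inc i.succ := by simp [HalfEdge.next]
@[simp] lemma HalfEdge.next_out_zero : (HalfEdge.out 0 : HalfEdge m).next = .inc 0 := by
  simp [HalfEdge.next]
@[simp] lemma HalfEdge.next_out_succ (i : Fin (m - 2)) :
    (HalfEdge.out i.succ : HalfEdge m).next = .out i.castSucc := by simp [HalfEdge.next]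
@[simp] lemma HalfEdge.sector_inc_last : (HalfEdge.inc (Fin.last _) : HalfEdge m).sector =
    .Uₘ := by simp [HalfEdge.sector]
@[simp] lemma HalfEdge.sector_inc_castSucc (i : Fin (m - 2)) :
    (HalfEdge.inc i.castSucc : HalfEdge m).sector = .R i := by simp [HalfEdge.sector]
@[simp] lemma HalfEdge.sector_out_zero : (HalfEdge.out 0 : HalfEdge m).sector = .U₁ := by
  simp [HalfEdge.sector]
@[simp] lemma HalfEdge.sector_out_succ (i : Fin (m - 2)) :
    (HalfEdge.out i.succ : HalfEdge m).sector = .L i := by simp [HalfEdge.sector]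

@[simp] lemma HalfEdge.sector_ofArrow (a : Arrow m) : (HalfEdge.ofArrow a).sector = a := by
  cases a <;> simp [HalfEdge.ofArrow]

@[simp] lemma HalfEdge.ofArrow_sector (h : HalfEdge m) : HalfEdge.ofArrow h.sector = h := by
  rcases h with k | k
  · induction k using Fin.lastCases <;> simp [HalfEdge.ofArrow]
  · induction k using Fin.cases <;> simp [HalfEdge.ofArrow]

lemma HalfEdge.sector_injective : Function.Injective (HalfEdge.sector : HalfEdge m → Arrow m) :=
  Function.LeftInverse.injective HalfEdge.ofArrow_sector

lemma HalfEdge.rot_sector (h : HalfEdge m) : h.sector.rot = h.next.sector := by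
  simp [Arrow.rot]

lemma HalfEdge.ofArrow_rot (a : Arrow m) : ofArrow a.rot = (ofArrow a).next := by
  simp [Arrow.rot]

lemma HalfEdge.rot_iterate_sector (h : HalfEdge m) (j : ℕ) :
    Arrow.rot^[j] h.sector = (HalfEdge.next^[j] h).sector := by
  induction j generalizing h with
  | zero => rfl
  | succ j ih => rw [Function.iterate_succ_apply, rot_sector, ih, Function.iterate_succ_apply]

lemma HalfEdge.src_sector (h : HalfEdge m) : h.sector.src = h.label := by
  rcases h with k | k
  · induction k using Fin.lastCases <;> simp [Arrow.src, HalfEdge.label]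
  · induction k using Fin.cases <;> simp [Arrow.src, HalfEdge.label]

@[simp] lemma HalfEdge.flip_flip (h : HalfEdge m) : h.flip.flip = h := by
  cases h <;> rfl

lemma EdgeDec.atFarEnd_eq (e : EdgeDec m) : e.atFarEnd = e.atNearEnd.flip := by
  rcases e with ⟨b, k⟩
  cases b <;> rfl

lemma EdgeDec.label_atFarEnd (e : EdgeDec m) : e.atFarEnd.label = e.label := by
  rcases e with ⟨b, k⟩
  cases b <;> rfl

/-- The edge with a given half-edge at its near end. -/
def EdgeDec.ofNearEnd : HalfEdge m → EdgeDec m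
  | .inc k => ⟨false, k⟩
  | .out k => ⟨true, k⟩

@[simp] lemma EdgeDec.atNearEnd_ofNearEnd (h : HalfEdge m) : (ofNearEnd h).atNearEnd = h := by
  cases h <;> rfl

lemma EdgeDec.atNearEnd_injective :
    Function.Injective (EdgeDec.atNearEnd : EdgeDec m → HalfEdge m) := by
  rintro ⟨b, k⟩ ⟨b', k'⟩ h
  cases b <;> cases b' <;> simp_all [atNearEnd]

@[simp] lemma Arrow.cont_cont (a : Arrow m) : a.cont.cont = a := by
  cases a <;> rfl

lemma Arrow.src_cont (a : Arrow m) : a.cont.src = a.tgt := by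
  cases a <;> rfl

/-- Running along an edge: the half-edge behind the sector of `a`, seen from its other end, is the
one whose sector carries the letter that continues `a`. -/
lemma HalfEdge.flip_next_ofArrow (a : Arrow m) : (ofArrow a).next.flip = ofArrow a.cont := by
  cases a <;> simp [ofArrow, Arrow.cont, flip]

lemma HalfEdge.next_flip_ofArrow (a : Arrow m) : (ofArrow a).flip.sector.cont.rot = a := by
  have h := flip_next_ofArrow (ofArrow a).flip.sector.cont
  rw [Arrow.cont_cont, ofArrow_sector] at h
  have h' := congrArg flip h
  rw [flip_flip, flip_flip] at h'
  rw [Arrow.rot, h', sector_ofArrow]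

/-- The dihedral relation between the two symmetries of the letters. -/
lemma Arrow.rot_cont_rot (a : Arrow m) : a.rot.cont.rot = a.cont := by
  have h := HalfEdge.next_flip_ofArrow a.cont
  rwa [← HalfEdge.flip_next_ofArrow, HalfEdge.flip_flip, ← Arrow.rot] at h

lemma Arrow.rot_injective : Function.Injective (Arrow.rot : Arrow m → Arrow m) := by
  intro a b h
  have := Arrow.rot_cont_rot a
  rw [h, Arrow.rot_cont_rot] at this
  rw [← Arrow.cont_cont a, ← this, Arrow.cont_cont]

lemma Arrow.src_rot (a : Arrow m) : a.rot.src = a.tgt := by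
  rw [← Arrow.src_cont, Arrow.rot, HalfEdge.src_sector, ← HalfEdge.sector_ofArrow a.cont,
    ← HalfEdge.flip_next_ofArrow, HalfEdge.src_sector]
  cases (HalfEdge.ofArrow a).next <;> rfl

/-- There are `2m - 2` half-edges around an internal vertex. -/
lemma HalfEdge.next_iterate (h : HalfEdge m) : next^[2 * (m - 2 + 1)] h = h := by
  have h1 : ∀ (j : ℕ) (hj : j < m - 2 + 1), next^[j] (inc 0 : HalfEdge m) = inc ⟨j, hj⟩ := by
    intro j
    induction j with
    | zero => intro _; rfl
    | succ j ih =>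
      intro hj
      rw [Function.iterate_succ_apply', ih (by omega)]
      exact next_inc_castSucc ⟨j, by omega⟩
  have h2 : ∀ (j : ℕ) (hj : j < m - 2 + 1), next^[j] (out (Fin.last _) : HalfEdge m) =
      out ⟨m - 2 - j, by omega⟩ := by
    intro j
    induction j with
    | zero => intro _; rfl
    | succ j ih =>
      intro hj
      rw [Function.iterate_succ_apply', ih (by omega)]
      have := next_out_succ (m := m) ⟨m - 2 - (j + 1), by omega⟩
      rw [show (⟨m - 2 - j, by omega⟩ : Fin (m - 2 + 1)) =
        Fin.succ ⟨m - 2 - (j + 1), by omega⟩ from Fin.ext (by simp; omega), this]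
      rfl
  have h3 : next^[m - 2 + 1] (inc 0 : HalfEdge m) = out (Fin.last _) := by
    rw [Function.iterate_succ_apply', h1 (m - 2) (by omega)]
    exact next_inc_last
  have h4 : next^[m - 2 + 1] (out (Fin.last _) : HalfEdge m) = inc 0 := by
    rw [Function.iterate_succ_apply', h2 (m - 2) (by omega)]
    rw [show (⟨m - 2 - (m - 2), by omega⟩ : Fin (m - 2 + 1)) = 0 from Fin.ext (by simp)]
    exact next_out_zero
  have h5 : ∃ j, next^[j] (inc 0) = h := by
    rcases h with k | k
    · exact ⟨k, h1 k k.2⟩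
    · refine ⟨(m - 2 - k) + (m - 2 + 1), ?_⟩
      rw [Function.iterate_add_apply, h3, h2 _ (by omega)]
      congr 1
      ext
      simp
      omega
  obtain ⟨j, rfl⟩ := h5
  rw [← Function.iterate_add_apply, Nat.add_comm, Function.iterate_add_apply, two_mul,
    Function.iterate_add_apply, h3, h4]

lemma Arrow.rot_iterate (hm : 3 ≤ m) (a : Arrow m) : (Arrow.rot^[2 * m - 3] a).rot = a := by
  rw [← Function.iterate_succ_apply' Arrow.rot, ← HalfEdge.sector_ofArrow a,
    HalfEdge.rot_iterate_sector, show (2 * m - 3).succ = 2 * (m - 2 + 1) by omega,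
    HalfEdge.next_iterate]

/-- The relations of the bordered algebra kill exactly the pairs of letters that are neighbours
around a vertex. -/
lemma zeroPair_iff (hm : 3 ≤ m) (a b : Arrow m) : ZeroPair a b ↔ b = a.rot := by
  constructor
  · rintro (⟨i, j, h⟩ | ⟨i, j, h⟩ | ⟨i, h⟩ | ⟨i, h⟩ | ⟨i, h⟩ | ⟨i, h⟩)
    · have : i.castSucc = j.succ := Fin.ext (by simpa using h)
      simp [Arrow.rot, HalfEdge.ofArrow, this]
    · have : j.succ = i.castSucc := Fin.ext (by simpa using h.symm)
      simp [Arrow.rot, HalfEdge.ofArrow, this]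
    · have : i.castSucc = 0 := Fin.ext (by simpa using h)
      simp [Arrow.rot, HalfEdge.ofArrow, this]
    · have : 0 = i.castSucc := Fin.ext (by simpa using h.symm)
      simp only [Arrow.rot, HalfEdge.ofArrow, HalfEdge.next_out_zero]
      rw [this, HalfEdge.sector_inc_castSucc]
    · have : i.succ = Fin.last _ := Fin.ext (by simpa using h)
      simp [Arrow.rot, HalfEdge.ofArrow, this]
    · have : Fin.last _ = i.succ := Fin.ext (by simpa using h.symm)
      simp only [Arrow.rot, HalfEdge.ofArrow, HalfEdge.next_inc_last]
      rw [this, HalfEdge.sector_out_succ]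
  · rintro rfl
    rcases a with _ | _ | i | i
    · have : (0 : Fin (m - 2 + 1)) = (⟨0, by omega⟩ : Fin (m - 2)).castSucc := rfl
      simp only [Arrow.rot, HalfEdge.ofArrow, HalfEdge.next_out_zero]
      rw [this, HalfEdge.sector_inc_castSucc]
      exact .UR _ rfl
    · have : (Fin.last (m - 2)) = (⟨m - 3, by omega⟩ : Fin (m - 2)).succ :=
        Fin.ext (by simp; omega)
      simp only [Arrow.rot, HalfEdge.ofArrow, HalfEdge.next_inc_last]
      rw [this, HalfEdge.sector_out_succ]
      exact .UL _ (by simp; omega)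
    · simp only [Arrow.rot, HalfEdge.ofArrow, HalfEdge.next_out_succ]
      rcases Nat.eq_zero_or_pos (i : ℕ) with h | h
      · rw [show i.castSucc = 0 from Fin.ext (by simpa using h), HalfEdge.sector_out_zero]
        exact .LU _ h
      · rw [show i.castSucc = (⟨i - 1, by omega⟩ : Fin (m - 2)).succ from
          Fin.ext (by simp; omega), HalfEdge.sector_out_succ]
        exact .LL _ _ (by simp; omega)
    · simp only [Arrow.rot, HalfEdge.ofArrow, HalfEdge.next_inc_castSucc]
      by_cases h : (i : ℕ) + 1 = m - 2
      · rw [show i.succ = Fin.last _ from Fin.ext (by simpa using h), HalfEdge.sector_inc_last]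
        exact .RU _ h
      · rw [show i.succ = (⟨i + 1, by omega⟩ : Fin (m - 2)).castSucc from
          Fin.ext (by simp), HalfEdge.sector_inc_castSucc]
        exact .RR _ _ (by simp)

lemma Arrow.cont_ne_rot (hm : 3 ≤ m) (a : Arrow m) : a.cont ≠ a.rot := by
  intro h
  rw [eq_comm, eq_comm, ← zeroPair_iff hm] at h
  revert h
  cases a <;> exact fun h => by cases h

/-- A letter can only be followed by its continuation or by the next letter around a vertex. -/
lemma Arrow.eq_cont_or_rot {a b : Arrow m} (h : a.tgt = b.src) :
    b = a.cont ∨ b = a.rot := by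
  rw [← Arrow.src_cont, ← HalfEdge.sector_ofArrow b, HalfEdge.src_sector,
    ← HalfEdge.sector_ofArrow a.cont, HalfEdge.src_sector, ← HalfEdge.flip_next_ofArrow] at h
  rw [← HalfEdge.sector_ofArrow b, ← HalfEdge.sector_ofArrow a.cont,
    ← HalfEdge.flip_next_ofArrow, Arrow.rot]
  generalize (HalfEdge.ofArrow a).next = x at *
  generalize HalfEdge.ofArrow b = y at *
  rcases x with k | k <;> rcases y with l | l <;> simp [HalfEdge.flip, HalfEdge.label] at * <;>
    simp [h]

/-! ### A basis of the bordered algebra -/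

lemma BordAlg.add_self (x : BordAlg m) : x + x = 0 := by
  induction x using Quotient.inductionOn with
  | _ x =>
    have h : x + x = 0 := by
      have := two_smul (ZMod 2) x
      rw [← this, show (2 : ZMod 2) = 0 from rfl, zero_smul]
    have := congrArg (relIdeal m).ringCon.mk' h
    rw [map_add, map_zero] at this
    exact this

lemma poly_add_self (f : (BordAlg m)[X]) : f + f = 0 := by
  ext n
  rw [coeff_add, BordAlg.add_self, coeff_zero]

lemma pathElt_mul_of_eq {p q : Path m} (h : p.tgt = q.src) :
    pathElt p * pathElt q = pathElt (p.comp q h) := by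
  unfold pathElt
  refine (map_mul (relIdeal m).ringCon.mk' _ _).symm.trans ?_
  rw [PathAlg.single_mul_single, PathAlg.mulPath, dif_pos h]

lemma pathElt_mul_of_ne {p q : Path m} (h : p.tgt ≠ q.src) : pathElt p * pathElt q = 0 := by
  unfold pathElt
  refine (map_mul (relIdeal m).ringCon.mk' _ _).symm.trans ?_
  rw [PathAlg.single_mul_single, PathAlg.mulPath, dif_neg h, map_zero]
  rfl

lemma idem_mul_pathElt (x : Vertex m) (p : Path m) :
    idem x * pathElt p = if x = p.src then pathElt p else 0 := by
  split_ifs with h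
  · exact pathElt_mul_of_eq (p := Path.const x) h |>.trans
      (congrArg pathElt (Path.ext h rfl))
  · exact pathElt_mul_of_ne (p := Path.const x) h

lemma pathElt_mul_idem (x : Vertex m) (p : Path m) :
    pathElt p * idem x = if p.tgt = x then pathElt p else 0 := by
  split_ifs with h
  · exact (pathElt_mul_of_eq (q := Path.const x) h).trans
      (congrArg pathElt (Path.ext rfl (List.append_nil _)))
  · exact pathElt_mul_of_ne (q := Path.const x) h

lemma arrowElt_mul_arrowElt_of_zeroPair {a b : Arrow m} (h : ZeroPair a b) :
    arrowElt a * arrowElt b = 0 := by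
  unfold arrowElt pathElt
  refine (map_mul (relIdeal m).ringCon.mk' _ _).symm.trans ?_
  refine (RingCon.eq (relIdeal m).ringCon).2 ?_
  rw [TwoSidedIdeal.rel_iff, sub_zero]
  exact TwoSidedIdeal.subset_span ⟨a, b, h, rfl⟩

lemma pathElt_eq_prod (p : Path m) :
    pathElt p = idem p.src * (p.arrows.map arrowElt).prod := by
  obtain ⟨x, l, h⟩ := p
  induction l generalizing x with
  | nil =>
    simp only [List.map_nil, List.prod_nil, mul_one]
    rfl
  | cons a l ih =>
    have h1 : arrowElt a * pathElt ⟨a.tgt, l, h.2⟩ = pathElt ⟨x, a :: l, h⟩ :=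
      (pathElt_mul_of_eq (p := Path.ofArrow a) (q := ⟨a.tgt, l, h.2⟩) rfl).trans
        (congrArg pathElt (Path.ext h.1 rfl))
    have h2 : arrowElt a * idem a.tgt = arrowElt a := by
      rw [arrowElt, pathElt_mul_idem]
      exact if_pos rfl
    have h3 : idem x * arrowElt a = arrowElt a := by
      rw [arrowElt, idem_mul_pathElt]
      exact if_pos h.1.symm
    rw [← h1, ih, ← mul_assoc, h2, List.map_cons, List.prod_cons, ← mul_assoc, h3]

lemma exists_of_not_isChain {α : Type*} {r : α → α → Prop} {l : List α} (h : ¬ l.IsChain r) :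
    ∃ u a b v, l = u ++ a :: b :: v ∧ ¬ r a b := by
  induction l with
  | nil => exact absurd List.isChain_nil h
  | cons a l ih =>
    rcases l with _ | ⟨b, l⟩
    · exact absurd (List.isChain_singleton a) h
    · rw [List.isChain_cons_cons, not_and_or] at h
      rcases h with h | h
      · exact ⟨[], a, b, l, rfl, h⟩
      · obtain ⟨u, c, d, v, e, hr⟩ := ih h
        exact ⟨a :: u, c, d, v, by rw [e, List.cons_append], hr⟩

lemma pathElt_of_not_reduced {p : Path m} (h : ¬ p.Reduced) : pathElt p = 0 := by
  obtain ⟨u, a, b, v, e, hab⟩ := exists_of_not_isChain h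
  rw [pathElt_eq_prod, e, List.map_append, List.prod_append, List.map_cons, List.map_cons,
    List.prod_cons, List.prod_cons, ← mul_assoc (arrowElt a),
    arrowElt_mul_arrowElt_of_zeroPair (not_not.1 hab), zero_mul, mul_zero, mul_zero]

/-! ### Alternating words -/

/-- The alternating word `a, cont a, a, …` with first letter `a = first` and `extra + 1` letters.
These words are the non-constant nonzero paths of the bordered algebra. -/
@[ext] structure Alt (m : ℕ) : Type where
  first : Arrow m
  extra : ℕ

/-- The letters of an alternating word. -/
def Arrow.alt : Arrow m → ℕ → List (Arrow m)
  | a, 0 => [a]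
  | a, k + 1 => a :: Arrow.alt a.cont k

lemma Arrow.alt_ne_nil (a : Arrow m) (k : ℕ) : a.alt k ≠ [] := by
  cases k <;> simp [Arrow.alt]

lemma Arrow.head_alt (a : Arrow m) (k : ℕ) : (a.alt k).head? = some a := by
  cases k <;> rfl

lemma Arrow.length_alt (a : Arrow m) (k : ℕ) : (a.alt k).length = k + 1 := by
  induction k generalizing a with
  | zero => rfl
  | succ k ih => rw [Arrow.alt, List.length_cons, ih]

lemma Arrow.alt_append (a : Arrow m) (k l : ℕ) :
    a.alt k ++ (cont^[k + 1] a).alt l = a.alt (k + l + 1) := by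
  induction k generalizing a with
  | zero => rw [Nat.zero_add, Nat.zero_add, Arrow.alt, Arrow.alt]; rfl
  | succ k ih =>
    rw [show k + 1 + l + 1 = (k + l + 1) + 1 by omega, Arrow.alt.eq_2 a (k + l + 1), ← ih,
      Arrow.alt, List.cons_append, Function.iterate_succ_apply]

lemma Arrow.isPathFrom_alt (a : Arrow m) (k : ℕ) : IsPathFrom a.src (a.alt k) := by
  induction k generalizing a with
  | zero => exact ⟨rfl, trivial⟩
  | succ k ih => exact ⟨rfl, a.src_cont ▸ ih a.cont⟩

lemma Arrow.endOf_alt (a : Arrow m) (k : ℕ) (x : Vertex m) :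
    endOf x (a.alt k) = (cont^[k] a).tgt := by
  induction k generalizing a x with
  | zero => rfl
  | succ k ih => exact ih _ _

lemma not_zeroPair_cont (a : Arrow m) : ¬ ZeroPair a a.cont := by
  cases a <;> exact fun h => by cases h

lemma Arrow.isChain_alt (a : Arrow m) (k : ℕ) :
    (a.alt k).IsChain fun a b => ¬ ZeroPair a b := by
  induction k generalizing a with
  | zero => exact List.isChain_singleton a
  | succ k ih =>
    rw [Arrow.alt, List.isChain_cons]
    refine ⟨fun b hb => ?_, ih _⟩
    rw [Arrow.head_alt] at hb
    obtain rfl : a.cont = b := by simpa using hb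
    exact not_zeroPair_cont a

namespace Alt

/-- The last letter. -/
def last (a : Alt m) : Arrow m := Arrow.cont^[a.extra] a.first

/-- The path in the quiver that is spelled by an alternating word. -/
def path (a : Alt m) : Path m := ⟨a.first.src, a.first.alt a.extra, a.first.isPathFrom_alt _⟩

lemma tgt_path (a : Alt m) : a.path.tgt = a.last.tgt := Arrow.endOf_alt _ _ _

/-- An alternating word contains no zero pair. -/
def toPure (a : Alt m) : PurePath m := ⟨a.path, a.first.alt_ne_nil _, a.first.isChain_alt _⟩

/-- The element of the bordered algebra. -/
def elt (a : Alt m) : BordAlg m := a.toPure.elt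

lemma elt_eq (a : Alt m) : a.elt = pathElt a.path := rfl

/-- The two words can be joined to one alternating word. -/
def Comp (a b : Alt m) : Prop := b.first = a.last.cont

instance (a b : Alt m) : Decidable (a.Comp b) := Classical.dec _

/-- The word obtained by joining two words. -/
def mul (a b : Alt m) : Alt m := ⟨a.first, a.extra + b.extra + 1⟩

lemma last_mul {a b : Alt m} (h : a.Comp b) : (a.mul b).last = b.last := by
  unfold last
  rw [h]
  unfold mul last
  rw [← Function.iterate_succ_apply' Arrow.cont, ← Function.iterate_add_apply]
  exact congrArg (fun k => Arrow.cont^[k] a.first) (by simp only; omega)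

lemma toPure_injective : Function.Injective (toPure : Alt m → PurePath m) := by
  intro a b h
  have h1 : a.first.alt a.extra = b.first.alt b.extra := congrArg (fun p => p.1.arrows) h
  have h2 := congrArg List.head? h1
  have h3 := congrArg List.length h1
  simp only [Arrow.head_alt, Arrow.length_alt, Option.some.injEq] at h2 h3
  exact Alt.ext h2 (by omega)

lemma eq_alt_of_isPath {x : Vertex m} {a : Arrow m} {l : List (Arrow m)} (hm : 3 ≤ m)
    (h : IsPathFrom x (a :: l)) (hl : (a :: l).IsChain fun a b => ¬ ZeroPair a b) :
    a :: l = a.alt l.length := by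
  induction l generalizing x a with
  | nil => rfl
  | cons b l ih =>
    rw [List.isChain_cons_cons] at hl
    have hb : b = a.cont := by
      rcases Arrow.eq_cont_or_rot h.2.1.symm with hb | hb
      · exact hb
      · exact absurd ((zeroPair_iff hm a b).2 hb) hl.1
    rw [List.length_cons, Arrow.alt, ← hb, ← ih h.2 hl.2]

lemma toPure_surjective (hm : 3 ≤ m) : Function.Surjective (toPure : Alt m → PurePath m) := by
  rintro ⟨⟨x, l, h⟩, hl, hr⟩
  rcases l with _ | ⟨a, l⟩
  · exact absurd rfl hl
  · exact ⟨⟨a, l.length⟩, Subtype.ext (Path.ext h.1 (eq_alt_of_isPath hm h hr).symm)⟩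

lemma elt_mul_elt_of_comp {a b : Alt m} (h : a.Comp b) : a.elt * b.elt = (a.mul b).elt := by
  have h1 : a.path.tgt = b.path.src := by
    rw [tgt_path, ← Arrow.src_cont, ← h]
    rfl
  rw [elt_eq, elt_eq, pathElt_mul_of_eq h1, elt_eq]
  refine congrArg pathElt (Path.ext rfl ?_)
  refine Eq.trans ?_ (Arrow.alt_append _ _ _)
  rw [Function.iterate_succ_apply']
  exact congrArg (fun c => _ ++ Arrow.alt c _) h

lemma elt_mul_elt_of_not_comp {a b : Alt m} (hm : 3 ≤ m) (h : ¬ a.Comp b) :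
    a.elt * b.elt = 0 := by
  by_cases h1 : a.path.tgt = b.path.src
  · have h2 : b.first = a.last.rot := by
      rcases Arrow.eq_cont_or_rot (a := a.last) (b := b.first) (by rw [← tgt_path, h1]; rfl)
        with h2 | h2
      · exact absurd h2 h
      · exact h2
    rw [elt_eq, elt_eq, pathElt_mul_of_eq h1, pathElt_of_not_reduced]
    intro hr
    have h3 := (List.isChain_append.1 hr).2.2 a.last ?_ b.first ?_
    · exact h3 ((zeroPair_iff hm _ _).2 h2)
    · change _ ∈ (a.first.alt a.extra).getLast?
      have : ∀ (c : Arrow m) (k : ℕ), (c.alt k).getLast? = some (Arrow.cont^[k] c) := by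
        intro c k
        induction k generalizing c with
        | zero => rfl
        | succ k ih => rw [Arrow.alt, List.getLast?_cons, ih, Function.iterate_succ_apply]; rfl
      rw [this]
      rfl
    · change _ ∈ (b.first.alt b.extra).head?
      rw [Arrow.head_alt]
      rfl
  · exact pathElt_mul_of_ne h1

lemma idem_mul_elt (x : Vertex m) (a : Alt m) :
    idem x * a.elt = if x = a.first.src then a.elt else 0 := idem_mul_pathElt x a.path

lemma elt_mul_idem (x : Vertex m) (a : Alt m) :
    a.elt * idem x = if a.last.tgt = x then a.elt else 0 := by
  rw [← tgt_path]
  exact pathElt_mul_idem x a.path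

end Alt

lemma idem_mul_idem (x y : Vertex m) : idem x * idem y = if x = y then idem x else 0 := by
  rw [idem, pathElt_mul_idem]
  rfl

/-- Every element is a sum of idempotents and alternating words. -/
lemma BordAlg.induction (hm : 3 ≤ m) {P : BordAlg m → Prop} (c : BordAlg m) (h0 : P 0)
    (hadd : ∀ x y, P x → P y → P (x + y)) (hidem : ∀ x, P (idem x))
    (helt : ∀ a : Alt m, P a.elt) : P c := by
  induction c using Quotient.inductionOn with
  | _ c =>
    change P ((relIdeal m).ringCon.mk' c)
    induction c using PathAlg.induction with
    | h0 => rw [map_zero]; exact h0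
    | hadd x y hx hy => rw [map_add]; exact hadd _ _ hx hy
    | hs p =>
      change P (pathElt p)
      by_cases hr : p.Reduced
      · by_cases hn : p.arrows = []
        · rw [show p = Path.const p.src from Path.ext rfl hn]
          exact hidem _
        · obtain ⟨a, ha⟩ := Alt.toPure_surjective hm ⟨p, hn, hr⟩
          have := helt a
          rwa [Alt.elt, ha] at this
      · rw [pathElt_of_not_reduced hr]
        exact h0

lemma pureCoord_add (c d : BordAlg m) : pureCoord (c + d) = pureCoord c + pureCoord d := by
  induction c using Quotient.inductionOn with
  | _ c =>
    induction d using Quotient.inductionOn with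
    | _ d => exact Finsupp.subtypeDomain_add

lemma pureCoord_zero : pureCoord (0 : BordAlg m) = 0 := by
  have := pureCoord_add (0 : BordAlg m) 0
  rw [add_zero] at this
  exact left_eq_add.1 this

lemma pureCoord_elt (p : PurePath m) : pureCoord p.elt = Finsupp.single p 1 := by
  ext q
  change (Finsupp.single p.1 (1 : ZMod 2)) q.1 = _
  classical
  rw [Finsupp.single_apply, Finsupp.single_apply]
  exact if_congr Subtype.ext_iff.symm rfl rfl

lemma pureCoord_idem (x : Vertex m) : pureCoord (idem x) = 0 := by
  ext q
  change (Finsupp.single (Path.const x) (1 : ZMod 2)) q.1 = 0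
  refine Finsupp.single_eq_of_ne ?_
  intro h
  exact q.2.1 (by rw [h]; rfl)

lemma PurePath.elt_injective : Function.Injective (PurePath.elt : PurePath m → BordAlg m) := by
  intro p q h
  have := congrArg pureCoord h
  rw [pureCoord_elt, pureCoord_elt] at this
  exact Finsupp.single_left_injective one_ne_zero this

lemma Alt.elt_injective : Function.Injective (Alt.elt : Alt m → BordAlg m) :=
  PurePath.elt_injective.comp Alt.toPure_injective

lemma one_eq_sum_idem : (1 : BordAlg m) = ∑ x, idem x := by
  refine (map_one (relIdeal m).ringCon.mk').symm.trans ?_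
  rw [PathAlg.one_def, map_sum]
  rfl

lemma pureCoord_one : pureCoord (1 : BordAlg m) = 0 := by
  rw [one_eq_sum_idem]
  let f : BordAlg m →+ (PurePath m →₀ ZMod 2) :=
    { toFun := pureCoord, map_zero' := pureCoord_zero, map_add' := pureCoord_add }
  change f _ = 0
  rw [map_sum]
  exact Finset.sum_eq_zero fun x _ => pureCoord_idem x

lemma Alt.elt_ne_one (a : Alt m) : a.elt ≠ 1 := by
  intro h
  have := congrArg pureCoord h
  rw [pureCoord_one, Alt.elt, pureCoord_elt] at this
  exact one_ne_zero (Finsupp.single_eq_zero.1 this)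

/-- The ideal of relations contains no constant path. -/
lemma idem_ne_zero (x : Vertex m) : idem x ≠ 0 := by
  intro h
  have h1 : PathAlg.single (Path.const x) ∈ relIdeal m := by
    have := (RingCon.eq (relIdeal m).ringCon).1 h
    rwa [TwoSidedIdeal.rel_iff, sub_zero] at this
  have h2 := PathAlg.apply_of_mem_zeroIdeal (mem_zeroIdeal_of_mem_relIdeal h1)
    (r := Path.const x) List.isChain_nil
  have h3 : (Finsupp.single (Path.const x) (1 : ZMod 2)) (Path.const x) = 0 := h2
  simp at h3

/-! ### Words of sequences of algebra elements -/

/-- The word of a sequence of pure elements, with `true` between neighbouring letters of one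
element and `false` between neighbouring elements. -/
def word : List (Alt m) → List Bool
  | [] => []
  | [a] => List.replicate a.extra true
  | a :: b :: l => List.replicate a.extra true ++ false :: word (b :: l)

lemma word_append {x y : List (Alt m)} (hx : x ≠ []) (hy : y ≠ []) :
    word (x ++ y) = word x ++ false :: word y := by
  induction x with
  | nil => exact absurd rfl hx
  | cons a x ih =>
    rcases x with _ | ⟨b, x⟩
    · obtain ⟨c, y, rfl⟩ := List.exists_cons_of_ne_nil hy
      rfl
    · have := ih (by simp)
      simp only [List.cons_append] at this
      simp only [List.cons_append, word, this, List.append_assoc]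

lemma word_mul_cons (a b : Alt m) (z : List (Alt m)) :
    word (a.mul b :: z) = List.replicate a.extra true ++ true :: word (b :: z) := by
  have h : List.replicate (a.mul b).extra true =
      List.replicate a.extra true ++ true :: List.replicate b.extra true := by
    rw [← List.replicate_succ, ← List.replicate_add]
    rfl
  rcases z with _ | ⟨c, z⟩
  · exact h
  · simp only [word, h, List.append_assoc, List.cons_append]

lemma word_mul (x : List (Alt m)) (a b : Alt m) (z : List (Alt m)) :
    word (x ++ a.mul b :: z) = word (x ++ [a]) ++ true :: word (b :: z) := by
  rcases eq_or_ne x [] with rfl | hx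
  · exact word_mul_cons a b z
  · rw [word_append hx (by simp), word_append hx (by simp), word_mul_cons]
    simp [word]

lemma count_word (l : List (Alt m)) : (word l).count false = l.length - 1 := by
  induction l with
  | nil => rfl
  | cons a l ih =>
    rcases l with _ | ⟨b, l⟩
    · simp [word, List.count_replicate]
    · simp only [word, List.count_append, List.count_cons, ih]
      simp [List.count_replicate]

/-- The letter of the sector reached from a given sector along a word. -/
def endLetter : Arrow m → List Bool → Arrow m
  | p, [] => p
  | p, true :: w => endLetter p.cont w
  | p, false :: w => endLetter p.rot w

lemma endLetter_append (p : Arrow m) (v w : List Bool) :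
    endLetter p (v ++ w) = endLetter (endLetter p v) w := by
  induction v generalizing p with
  | nil => rfl
  | cons b v ih => cases b <;> exact ih _

lemma Arrow.cont_rot_iterate_cont (hm : 3 ≤ m) (p : Arrow m) :
    (Arrow.rot^[2 * m - 3] p.cont).cont = p.rot := by
  have h1 := Arrow.rot_iterate hm p.cont
  have h2 := Arrow.rot_injective (h1.trans (Arrow.rot_cont_rot p).symm)
  rw [h2, Arrow.cont_cont]

/-- Walking around `k` trees at consecutive edges of a vertex advances by `k` sectors. -/
lemma Parses.endLetter_eq (hm : 3 ≤ m) {k : ℕ} {w : List Bool} (h : Parses (2 * m - 3) k w) :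
    ∀ p : Arrow m, endLetter p w = Arrow.rot^[k] p := by
  induction h with
  | nil => intro p; rfl
  | leaf _ ih => intro p; exact ih _
  | node h1 h2 ih1 ih2 =>
    intro p
    rw [endLetter, endLetter_append, ih1, endLetter, Arrow.cont_rot_iterate_cont hm, ih2,
      Function.iterate_succ_apply]

/-- The letter after the last one of `a`, around a vertex, is the first letter of `b`. -/
def Alt.Follows (a b : Alt m) : Prop := b.first = a.last.rot

lemma endLetter_replicate (p : Arrow m) (k : ℕ) (w : List Bool) :
    endLetter p (List.replicate k true ++ w) = endLetter (Arrow.cont^[k] p) w := by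
  induction k generalizing p with
  | zero => rfl
  | succ k ih => exact ih _

lemma endLetter_word {a b : Alt m} : ∀ {l : List (Alt m)}, (a :: l).IsChain Alt.Follows →
    (a :: l).getLast? = some b → endLetter a.first (word (a :: l)) = b.last
  | [], _, hb => by
    obtain rfl : a = b := by simpa using hb
    have := endLetter_replicate a.first a.extra []
    rw [List.append_nil] at this
    exact this
  | c :: l, h, hb => by
    rw [List.isChain_cons_cons] at h
    rw [List.getLast?_cons_cons] at hb
    have hc : (Arrow.cont^[a.extra] a.first).rot = c.first := h.1.symm
    rw [word, endLetter_replicate, endLetter, hc]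
    exact endLetter_word h.2 hb

/-- The sequence of pure elements is the algebra sequence of a tiling tree: at the leaf between two
neighbouring entries one passes to the next sector around a vertex, and the word is that of the
`2m - 3` subtrees at the vertex next to the root. -/
def Cent (l : List (Alt m)) : Prop :=
  l.IsChain Alt.Follows ∧ Parses (2 * m - 3) (2 * m - 3) (word l)

lemma Cent.exists_length (hm : 3 ≤ m) {l : List (Alt m)} (h : Cent l) :
    ∃ d, l.length = (d + 1) * (2 * m - 4) + 2 := by
  obtain ⟨d, hd⟩ := h.2.exists_count (by omega)
  rw [count_word] at hd
  refine ⟨d, ?_⟩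
  rw [show 2 * m - 3 - 1 = 2 * m - 4 by omega] at hd
  rw [add_mul]
  omega

lemma Cent.four_le_length (hm : 3 ≤ m) {l : List (Alt m)} (h : Cent l) : 4 ≤ l.length := by
  obtain ⟨d, hd⟩ := h.exists_length hm
  rw [hd, add_mul]
  omega

/-- The first and the last sector are separated by the root edge. -/
lemma Cent.closed (hm : 3 ≤ m) {a b : Alt m} {l : List (Alt m)} (h : Cent (a :: l))
    (hb : (a :: l).getLast? = some b) : b.Follows a := by
  have h1 := endLetter_word h.1 hb
  rw [h.2.endLetter_eq hm] at h1
  have h2 := Arrow.rot_iterate hm a.first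
  rw [h1] at h2
  exact h2.symm

lemma Cent.closed_concat (hm : 3 ≤ m) {a b : Alt m} {l : List (Alt m)}
    (h : Cent (a :: l ++ [b])) : b.Follows a :=
  h.closed (a := a) (l := l ++ [b]) hm (by
    rw [← List.cons_append]
    exact List.getLast?_concat)

/-- The algebra sequences of tiling trees are invariant under cyclic rotation. -/
lemma Cent.rotate (hm : 3 ≤ m) {x y : List (Alt m)} (h : Cent (x ++ y)) : Cent (y ++ x) := by
  rcases x with _ | ⟨a, x⟩
  · simpa using h
  rcases List.eq_nil_or_concat y with rfl | ⟨y, b, rfl⟩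
  · simpa using h
  rw [List.concat_eq_append] at h ⊢
  have hc : b.Follows a := by
    refine h.closed (l := x ++ (y ++ [b])) hm ?_
    rw [← List.cons_append, ← List.append_assoc]
    exact List.getLast?_concat
  refine ⟨List.isChain_append.2 ⟨?_, ?_, ?_⟩, ?_⟩
  · exact (List.isChain_append.1 h.1).2.1
  · exact (List.isChain_append.1 h.1).1
  · intro c hc' d hd
    obtain rfl : b = c := by simpa using hc'
    obtain rfl : a = d := by simpa using hd
    exact hc
  · have h2 := h.2
    rw [word_append (by simp) (by simp)] at h2 ⊢
    exact h2.rotate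

lemma cent_append_comm (hm : 3 ≤ m) {x y : List (Alt m)} : Cent (x ++ y) ↔ Cent (y ++ x) :=
  ⟨Cent.rotate hm, Cent.rotate hm⟩

/-! ### Contours of tiling trees -/

/-- The letters met along a word, with `none` at the leaves. -/
def run : Arrow m → List Bool → List (Option (Arrow m))
  | p, [] => [some p]
  | p, true :: w => some p :: run p.cont w
  | p, false :: w => some p :: none :: run p.rot w

lemma run_append_true (p : Arrow m) (v w : List Bool) :
    run p (v ++ true :: w) = run p v ++ run (endLetter p v).cont w := by
  induction v generalizing p with
  | nil => rfl
  | cons b v ih => cases b <;> simp [run, endLetter, ih]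

/-- The contour of a sequence of pure elements. -/
def spell : List (Alt m) → List (Option (Arrow m))
  | [] => []
  | [a] => (a.first.alt a.extra).map some
  | a :: b :: l => (a.first.alt a.extra).map some ++ none :: spell (b :: l)

lemma run_replicate_false (p : Arrow m) (k : ℕ) (w : List Bool) :
    run p (List.replicate k true ++ false :: w) =
      (p.alt k).map some ++ none :: run (Arrow.cont^[k] p).rot w := by
  induction k generalizing p with
  | zero => rfl
  | succ k ih => simp [List.replicate_succ, run, ih, Arrow.alt]

lemma run_replicate (p : Arrow m) (k : ℕ) :
    run p (List.replicate k true) = (p.alt k).map some := by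
  induction k generalizing p with
  | zero => rfl
  | succ k ih => simp [List.replicate_succ, run, ih, Arrow.alt]

lemma run_word {a : Alt m} : ∀ {l : List (Alt m)}, (a :: l).IsChain Alt.Follows →
    run a.first (word (a :: l)) = spell (a :: l)
  | [], _ => run_replicate _ _
  | c :: l, h => by
    rw [List.isChain_cons_cons] at h
    have hc : (Arrow.cont^[a.extra] a.first).rot = c.first := h.1.symm
    rw [word, run_replicate_false, hc, run_word h.2, spell]

lemma exists_word_eq (w : List Bool) : ∀ p : Arrow m, ∃ (a : Alt m) (l : List (Alt m)),
    a.first = p ∧ (a :: l).IsChain Alt.Follows ∧ word (a :: l) = w := by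
  induction w with
  | nil => exact fun p => ⟨⟨p, 0⟩, [], rfl, List.isChain_singleton _, rfl⟩
  | cons b w ih =>
    intro p
    cases b with
    | false =>
      obtain ⟨a, l, ha, hl, rfl⟩ := ih p.rot
      exact ⟨⟨p, 0⟩, a :: l, rfl, List.isChain_cons_cons.2 ⟨ha, hl⟩, rfl⟩
    | true =>
      obtain ⟨a, l, ha, hl, rfl⟩ := ih p.cont
      refine ⟨⟨p, a.extra + 1⟩, l, rfl, ?_, ?_⟩
      · rw [List.isChain_cons] at hl ⊢
        refine ⟨fun c hc => ?_, hl.2⟩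
        have := hl.1 c hc
        unfold Alt.Follows Alt.last at this ⊢
        rw [this, ha]
        rfl
      · rcases l with _ | ⟨c, l⟩ <;> rfl

lemma cutAtNone_map_some_append {α : Type*} (s : List α) (l : List (Option α)) :
    cutAtNone (s.map some ++ none :: l) = s :: cutAtNone l := by
  induction s with
  | nil => rfl
  | cons a s ih => simp [cutAtNone, ih]

lemma cutAtNone_map_some {α : Type*} (s : List α) : cutAtNone (s.map some) = [s] := by
  induction s with
  | nil => rfl
  | cons a s ih => simp [cutAtNone, ih]

lemma cutAtNone_spell (a : Alt m) : ∀ l : List (Alt m),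
    cutAtNone (spell (a :: l)) = (a :: l).map fun a => a.first.alt a.extra
  | [] => cutAtNone_map_some _
  | b :: l => by
    rw [spell, cutAtNone_map_some_append, cutAtNone_spell b l]
    rfl

lemma Alt.elt_eq_prod (a : Alt m) : a.elt = ((a.first.alt a.extra).map arrowElt).prod := by
  have h1 := pathElt_eq_prod a.path
  rw [← Alt.elt_eq] at h1
  rw [h1]
  change idem a.first.src * ((a.first.alt a.extra).map arrowElt).prod = _
  have h2 : idem a.first.src * arrowElt a.first = arrowElt a.first :=
    (idem_mul_pathElt _ _).trans (if_pos rfl)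
  rcases a.extra with _ | k
  · simpa [Arrow.alt] using h2
  · rw [Arrow.alt, List.map_cons, List.prod_cons, ← mul_assoc, h2]

lemma algSeq_of_contour {Γ : DecTree m} {a : Alt m} {l : List (Alt m)}
    (h : Γ.contour = spell (a :: l)) : Γ.algSeq = (a :: l).map Alt.elt := by
  rw [DecTree.algSeq, h, cutAtNone_spell, List.map_map]
  exact List.map_congr_left fun a _ => a.elt_eq_prod.symm

/-- The contours of the subtrees at consecutive edges of a vertex form a run along a parsable
word. -/
lemma exists_parses_flatten (n : ℕ) : ∀ (p : Arrow m) (child : Fin n → DecTree m),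
    (∀ j, (child j).edge.atNearEnd.sector = Arrow.rot^[(j : ℕ) + 1] p) →
    (∀ j, (child j).contour = [none] ∨ ∃ w, Parses (2 * m - 3) (2 * m - 3) w ∧
      (child j).contour = run (child j).edge.atFarEnd.sector w) → 3 ≤ m →
    ∃ w, Parses (2 * m - 3) n w ∧ some p :: (List.ofFn fun j => (child j).contour ++
      [some (child j).edge.atNearEnd.sector]).flatten = run p w := by
  induction n with
  | zero => exact fun p child _ _ _ => ⟨[], .nil, by simp [run]⟩
  | succ n ih =>
    intro p child hc hw hm
    obtain ⟨w, h1, h2⟩ := ih p.rot (fun j => child j.succ)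
      (fun j => by rw [hc, Fin.val_succ, Function.iterate_succ_apply]) (fun j => hw _) hm
    have h0 : (child 0).edge.atNearEnd.sector = p.rot := hc 0
    rw [List.ofFn_succ, List.flatten_cons, h0, List.append_assoc, List.singleton_append, h2]
    rcases hw 0 with h | ⟨v, hv, h⟩
    · exact ⟨false :: w, h1.leaf, by rw [h]; rfl⟩
    · refine ⟨_, hv.node h1, ?_⟩
      have h3 : (child 0).edge.atFarEnd.sector = p.cont := by
        rw [EdgeDec.atFarEnd_eq, ← HalfEdge.ofArrow_sector (child 0).edge.atNearEnd, h0,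
          HalfEdge.ofArrow_rot, HalfEdge.flip_next_ofArrow, HalfEdge.sector_ofArrow]
      rw [run, run_append_true, hv.endLetter_eq hm, Arrow.cont_rot_iterate_cont hm, h, h3]

lemma DecTree.exists_parses (hm : 3 ≤ m) : ∀ Γ : DecTree m, Γ.Compatible →
    Γ.contour = [none] ∨ ∃ w, Parses (2 * m - 3) (2 * m - 3) w ∧
      Γ.contour = run Γ.edge.atFarEnd.sector w
  | .leaf _, _ => .inl rfl
  | .node e child, h => by
    refine .inr (exists_parses_flatten _ e.atFarEnd.sector child (fun j => ?_) (fun j => ?_) hm)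
    · rw [(h j).1, HalfEdge.rot_iterate_sector]
    · exact DecTree.exists_parses hm (child j) (h j).2

/-- Every parsable word is the contour of a row of trees at consecutive edges of a vertex. -/
lemma Parses.exists_trees (hm : 3 ≤ m) {k : ℕ} {w : List Bool}
    (h : Parses (2 * m - 3) k w) : ∀ p : Arrow m, ∃ child : Fin k → DecTree m,
      (∀ j, (child j).edge.atNearEnd.sector = Arrow.rot^[(j : ℕ) + 1] p ∧
        (child j).Compatible) ∧
      run p w = some p :: (List.ofFn fun j => (child j).contour ++
        [some (child j).edge.atNearEnd.sector]).flatten := by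
  induction h with
  | nil => exact fun p => ⟨Fin.elim0, fun j => j.elim0, by simp [run]⟩
  | leaf h ih =>
    intro p
    obtain ⟨child, h1, h2⟩ := ih p.rot
    refine ⟨Fin.cons (.leaf (.ofNearEnd (.ofArrow p.rot))) child, fun j => ?_, ?_⟩
    · induction j using Fin.cases with
      | zero => simp [DecTree.edge, DecTree.Compatible]
      | succ j =>
        rw [Fin.cons_succ, (h1 j).1, Fin.val_succ, Function.iterate_succ_apply]
        exact ⟨rfl, (h1 j).2⟩
    · rw [run, h2, List.ofFn_succ]
      simp [DecTree.edge, DecTree.contour]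
  | node hv hw ih1 ih2 =>
    intro p
    obtain ⟨child, h1, h2⟩ := ih2 p.rot
    obtain ⟨child', h1', h2'⟩ := ih1 p.cont
    have hf : (EdgeDec.ofNearEnd (.ofArrow p.rot) : EdgeDec m).atFarEnd = .ofArrow p.cont := by
      rw [EdgeDec.atFarEnd_eq, EdgeDec.atNearEnd_ofNearEnd, HalfEdge.ofArrow_rot,
        HalfEdge.flip_next_ofArrow]
    refine ⟨Fin.cons (.node (.ofNearEnd (.ofArrow p.rot)) child') child, fun j => ?_, ?_⟩
    · induction j using Fin.cases with
      | zero =>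
        refine ⟨by simp [DecTree.edge], fun j => ⟨?_, (h1' j).2⟩⟩
        apply HalfEdge.sector_injective
        rw [(h1' j).1, ← HalfEdge.rot_iterate_sector, hf, HalfEdge.sector_ofArrow]
      | succ j =>
        rw [Fin.cons_succ, (h1 j).1, Fin.val_succ, Function.iterate_succ_apply]
        exact ⟨rfl, (h1 j).2⟩
    · rw [run, run_append_true, hv.endLetter_eq hm, Arrow.cont_rot_iterate_cont hm, h2, h2',
        List.ofFn_succ]
      simp [DecTree.edge, DecTree.contour, hf]

lemma flatten_ofFn_cancel {α : Type*} {n : ℕ} {f g : Fin n → List α} {P : Fin n → Prop}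
    (H : ∀ j x x', f j ++ x = g j ++ x' → P j ∧ x = x') {x x' : List α}
    (h : (List.ofFn f).flatten ++ x = (List.ofFn g).flatten ++ x') : (∀ j, P j) ∧ x = x' := by
  induction n with
  | zero => exact ⟨fun j => j.elim0, by simpa using h⟩
  | succ n ih =>
    simp only [List.ofFn_succ, List.flatten_cons, List.append_assoc] at h
    obtain ⟨h0, h1⟩ := H 0 _ _ h
    obtain ⟨h2, h3⟩ := ih (fun j => H j.succ) h1
    exact ⟨Fin.cases h0 h2, h3⟩

/-- A compatibly decorated tree is determined by its root edge and its contour. -/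
lemma DecTree.contour_cancel : ∀ Γ Γ' : DecTree m, Γ.Compatible → Γ'.Compatible →
    Γ.edge = Γ'.edge → ∀ x x', Γ.contour ++ x = Γ'.contour ++ x' → Γ = Γ' ∧ x = x'
  | .leaf e, .leaf e', _, _, he, x, x', h => by
    simp only [edge, contour, List.singleton_append, List.cons.injEq, true_and] at he h
    exact ⟨by rw [he], h⟩
  | .leaf e, .node e' child', _, _, he, x, x', h => by
    simp [contour] at h
  | .node e child, .leaf e', _, _, he, x, x', h => by
    simp [contour] at h
  | .node e child, .node e' child', hΓ, hΓ', he, x, x', h => by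
    simp only [edge, contour, List.cons_append, List.cons.injEq] at he h
    subst he
    have hee : ∀ j, (child j).edge = (child' j).edge := fun j =>
      EdgeDec.atNearEnd_injective ((hΓ j).1.trans (hΓ' j).1.symm)
    obtain ⟨h1, h2⟩ := flatten_ofFn_cancel (P := fun j => child j = child' j)
      (fun j y y' hy => by
        rw [List.append_assoc, List.append_assoc] at hy
        obtain ⟨h3, h4⟩ := DecTree.contour_cancel (child j) (child' j) (hΓ j).2 (hΓ' j).2
          (hee j) _ _ hy
        rw [List.singleton_append, List.singleton_append] at h4
        exact ⟨h3, (List.cons.inj h4).2⟩) h.2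
    exact ⟨by rw [funext h1], h2⟩

/-- The number of leaves, not counting the root. -/
lemma DecTree.countP_isNone (hm : 3 ≤ m) : ∀ Γ : DecTree m,
    Γ.contour.countP Option.isNone = Γ.numVertices * (2 * m - 4) + 1
  | .leaf _ => by simp [contour, numVertices]
  | .node e child => by
    have h : ∀ (n : ℕ) (f : Fin n → List (Option (Arrow m))),
        (List.ofFn f).flatten.countP Option.isNone = ∑ j, (f j).countP Option.isNone := by
      intro n f
      rw [List.countP_flatten, List.map_ofFn, List.sum_ofFn]
      rfl
    rw [contour, List.countP_cons, h]
    simp only [List.countP_append, DecTree.countP_isNone hm (child _), numVertices]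
    simp [Finset.sum_add_distrib, ← Finset.sum_mul, add_mul]
    omega

lemma countP_isNone_spell (l : List (Alt m)) :
    (spell l).countP Option.isNone = l.length - 1 := by
  have h : ∀ s : List (Arrow m), (s.map some).countP Option.isNone = 0 := by
    intro s
    rw [List.countP_eq_zero]
    simp
  induction l with
  | nil => rfl
  | cons a l ih =>
    rcases l with _ | ⟨b, l⟩
    · exact h _
    · rw [spell, List.countP_append, h, List.countP_cons, ih]
      simp

/-! ### Sums over factorizations and over positions in a sequence -/

/-- The sum over all factorizations of an alternating word into two alternating words. -/
def Alt.splitSum {M : Type*} [AddCommMonoid M] (a : Alt m) (f : Alt m → Alt m → M) : M :=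
  ∑ i ∈ Finset.range a.extra,
    f ⟨a.first, i⟩ ⟨Arrow.cont^[i + 1] a.first, a.extra - 1 - i⟩

/-- The sum over all ways to write a list as `x ++ a :: y`. -/
def sumElt {α M : Type*} [AddCommMonoid M] : (List α → α → List α → M) → List α → M
  | _, [] => 0
  | F, a :: l => F [] a l + sumElt (fun x => F (a :: x)) l

section sums

variable {α M : Type*} [AddCommMonoid M]

namespace Alt

variable {a : Alt m} {f g : Alt m → Alt m → M}

lemma comp_split {i : ℕ} (hi : i < a.extra) :
    Comp ⟨a.first, i⟩ ⟨Arrow.cont^[i + 1] a.first, a.extra - 1 - i⟩ ∧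
    mul ⟨a.first, i⟩ ⟨Arrow.cont^[i + 1] a.first, a.extra - 1 - i⟩ = a := by
  refine ⟨Function.iterate_succ_apply' _ _ _, Alt.ext rfl ?_⟩
  simp only [mul]
  omega

lemma exists_split {b c : Alt m} (h : b.Comp c) (hbc : b.mul c = a) :
    b.extra < a.extra ∧ b = ⟨a.first, b.extra⟩ ∧
      c = ⟨Arrow.cont^[b.extra + 1] a.first, a.extra - 1 - b.extra⟩ := by
  subst hbc
  refine ⟨by simp only [mul]; omega, rfl, Alt.ext ?_ ?_⟩
  · exact h.trans (Function.iterate_succ_apply' _ _ _).symm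
  · simp only [mul]
    omega

lemma splitSum_congr (h : ∀ b c : Alt m, b.Comp c → b.mul c = a → f b c = g b c) :
    a.splitSum f = a.splitSum g :=
  Finset.sum_congr rfl fun _ hi =>
    h _ _ (comp_split (Finset.mem_range.1 hi)).1 (comp_split (Finset.mem_range.1 hi)).2

lemma splitSum_eq_zero (h : ∀ b c : Alt m, b.Comp c → b.mul c = a → f b c = 0) :
    a.splitSum f = 0 :=
  Finset.sum_eq_zero fun _ hi =>
    h _ _ (comp_split (Finset.mem_range.1 hi)).1 (comp_split (Finset.mem_range.1 hi)).2

lemma splitSum_eq_single {b c : Alt m} (hc : b.Comp c) (hbc : b.mul c = a)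
    (h : ∀ b' c' : Alt m, b'.Comp c' → b'.mul c' = a → b' ≠ b → f b' c' = 0) :
    a.splitSum f = f b c := by
  obtain ⟨h1, h2, h3⟩ := exists_split hc hbc
  rw [splitSum, Finset.sum_eq_single b.extra]
  · rw [← h3, ← h2]
  · intro i hi hne
    have := comp_split (Finset.mem_range.1 hi)
    exact h _ _ this.1 this.2 fun e => hne (congrArg Alt.extra e)
  · intro h
    exact absurd (Finset.mem_range.2 h1) h

lemma splitSum_add : a.splitSum (fun b c => f b c + g b c) = a.splitSum f + a.splitSum g :=
  Finset.sum_add_distrib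

lemma splitSum_comm (b : Alt m) (F : Alt m → Alt m → Alt m → Alt m → M) :
    a.splitSum (fun a' a'' => b.splitSum fun b' b'' => F a' a'' b' b'') =
      b.splitSum fun b' b'' => a.splitSum fun a' a'' => F a' a'' b' b'' :=
  Finset.sum_comm

/-- Both sides sum over the factorizations into three words. -/
lemma splitSum_assoc (F : Alt m → Alt m → Alt m → M) :
    a.splitSum (fun u w => u.splitSum fun u' v => F u' v w) =
      a.splitSum fun u w => w.splitSum fun v w' => F u v w' := by
  unfold splitSum
  simp only [Finset.sum_sigma']
  refine Finset.sum_nbij' (fun x => ⟨x.2, x.1 - 1 - x.2⟩) (fun x => ⟨x.1 + 1 + x.2, x.1⟩)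
    ?_ ?_ ?_ ?_ ?_
  · rintro ⟨i, j⟩ h
    simp only [Finset.mem_sigma, Finset.mem_range] at h ⊢
    omega
  · rintro ⟨i, j⟩ h
    simp only [Finset.mem_sigma, Finset.mem_range] at h ⊢
    omega
  · rintro ⟨i, j⟩ h
    simp only [Finset.mem_sigma, Finset.mem_range] at h
    simp only [Sigma.mk.injEq, heq_eq_eq, and_true]
    omega
  · rintro ⟨i, j⟩ h
    simp only [Finset.mem_sigma, Finset.mem_range] at h
    simp only [Sigma.mk.injEq, heq_eq_eq, true_and]
    omega
  · rintro ⟨i, j⟩ h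
    simp only [Finset.mem_sigma, Finset.mem_range] at h
    congr 1
    refine Alt.ext ?_ ?_
    · simp only
      rw [← Function.iterate_add_apply]
      exact congrArg (fun k => Arrow.cont^[k] a.first) (by omega)
    · simp only
      omega

/-- A factorization of a product cuts the first factor, separates the factors, or cuts the second
factor. -/
lemma splitSum_mul {b : Alt m} (h : a.Comp b) :
    (a.mul b).splitSum f = a.splitSum (fun a' a'' => f a' (a''.mul b)) + f a b +
      b.splitSum fun b' b'' => f (a.mul b') b'' := by
  have hb : ∀ j, Arrow.cont^[a.extra + 1 + j] a.first = Arrow.cont^[j] b.first := by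
    intro j
    rw [h, last, ← Function.iterate_succ_apply' Arrow.cont, ← Function.iterate_add_apply]
    exact congrArg (fun k => Arrow.cont^[k] a.first) (by omega)
  unfold splitSum
  rw [show (a.mul b).extra = a.extra + 1 + b.extra by simp only [mul]; omega,
    Finset.sum_range_add, Finset.sum_range_succ]
  congr 1
  · congr 1
    · refine Finset.sum_congr rfl fun i hi => ?_
      have hi := Finset.mem_range.1 hi
      exact congrArg (f _) (Alt.ext rfl (by simp only [mul]; omega))
    · exact congrArg (f _) (Alt.ext (hb 0) (by simp only; omega))
  · refine Finset.sum_congr rfl fun i hi => ?_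
    have hi := Finset.mem_range.1 hi
    refine congrArg₂ f (Alt.ext rfl (by simp only [mul]; omega)) (Alt.ext ?_ (by simp only; omega))
    exact hb (i + 1)

lemma mul_splitSum {S : Type*} [NonUnitalNonAssocSemiring S] (r : S) (f : Alt m → Alt m → S) :
    r * a.splitSum f = a.splitSum fun b c => r * f b c :=
  Finset.mul_sum _ _ _

lemma splitSum_mul_right {S : Type*} [NonUnitalNonAssocSemiring S] (r : S)
    (f : Alt m → Alt m → S) : a.splitSum f * r = a.splitSum fun b c => f b c * r :=
  Finset.sum_mul _ _ _

end Alt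

variable {F G : List α → α → List α → M} {l : List α}

lemma sumElt_congr (h : ∀ x a y, l = x ++ a :: y → F x a y = G x a y) :
    sumElt F l = sumElt G l := by
  induction l generalizing F G with
  | nil => rfl
  | cons a l ih =>
    rw [sumElt, sumElt, h [] a l rfl, ih fun x b y e => h (a :: x) b y (by rw [e]; rfl)]

lemma sumElt_add : sumElt (fun x a y => F x a y + G x a y) l = sumElt F l + sumElt G l := by
  induction l generalizing F G with
  | nil => exact (add_zero _).symm
  | cons a l ih =>
    rw [sumElt, sumElt, sumElt, ih, add_add_add_comm]

lemma sumElt_eq_zero (h : ∀ x a y, l = x ++ a :: y → F x a y = 0) : sumElt F l = 0 := by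
  induction l generalizing F with
  | nil => rfl
  | cons a l ih =>
    rw [sumElt, h [] a l rfl, ih fun x b y e => h (a :: x) b y (by rw [e]; rfl), add_zero]

lemma sumElt_append (u v : List α) : sumElt F (u ++ v) =
    sumElt (fun x a y => F x a (y ++ v)) u + sumElt (fun x a y => F (u ++ x) a y) v := by
  induction u generalizing F with
  | nil => simp [sumElt]
  | cons a u ih => simp only [List.cons_append, sumElt, ih, add_assoc]

lemma sumElt_concat (a : α) : sumElt F (l ++ [a]) =
    sumElt (fun x b y => F x b (y ++ [a])) l + F l a [] := by
  rw [sumElt_append]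
  simp [sumElt]

lemma sumElt_splitSum (h : Alt m) (F : Alt m → Alt m → List α → α → List α → M) :
    sumElt (fun x a y => h.splitSum fun b c => F b c x a y) l =
      h.splitSum fun b c => sumElt (F b c) l := by
  induction l generalizing F with
  | nil => exact (Alt.splitSum_eq_zero fun _ _ _ _ => rfl).symm
  | cons a l ih =>
    rw [sumElt, ih, ← Alt.splitSum_add]
    rfl

lemma mul_sumElt {S : Type*} [NonUnitalNonAssocSemiring S] (r : S)
    (F : List α → α → List α → S) : r * sumElt F l = sumElt (fun x a y => r * F x a y) l := by
  induction l generalizing F with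
  | nil => exact mul_zero _
  | cons a l ih => rw [sumElt, sumElt, mul_add, ih]

lemma sumElt_mul {S : Type*} [NonUnitalNonAssocSemiring S] (r : S)
    (F : List α → α → List α → S) : sumElt F l * r = sumElt (fun x a y => F x a y * r) l := by
  induction l generalizing F with
  | nil => exact zero_mul _
  | cons a l ih => rw [sumElt, sumElt, add_mul, ih]

/-- The sum over all ways to write a list as `x ++ a :: b :: z`. -/
def sumPair (F : List α → α → α → List α → M) : List α → M :=
  sumElt fun x a w => match w with
    | [] => 0
    | b :: z => F x a b z

lemma sumPair_cons_cons (F : List α → α → α → List α → M) (a b : α) (l : List α) :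
    sumPair F (a :: b :: l) = F [] a b l + sumPair (fun x => F (a :: x)) (b :: l) := rfl

lemma sumPair_concat_concat (F : List α → α → α → List α → M) (a b : α) :
    sumPair F (l ++ [a, b]) = sumPair (fun x c d y => F x c d (y ++ [b])) (l ++ [a]) +
      F l a b [] := by
  induction l generalizing F with
  | nil => simp [sumPair, sumElt]
  | cons c l ih =>
    have := ih fun x => F (c :: x)
    rcases l with _ | ⟨d, l⟩
    · simp [sumPair, sumElt]
    · simp only [List.cons_append, sumPair_cons_cons] at this ⊢
      rw [this, add_assoc, List.append_assoc]
      rfl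

lemma sumPair_congr {F G : List α → α → α → List α → M}
    (h : ∀ x a b z, l = x ++ a :: b :: z → F x a b z = G x a b z) :
    sumPair F l = sumPair G l := by
  refine sumElt_congr fun x a y e => ?_
  rcases y with _ | ⟨b, z⟩
  · rfl
  · exact h x a b z e

lemma sumPair_add {F G : List α → α → α → List α → M} :
    sumPair (fun x a b z => F x a b z + G x a b z) l = sumPair F l + sumPair G l := by
  unfold sumPair
  rw [← sumElt_add]
  refine sumElt_congr fun x a y _ => ?_
  rcases y with _ | ⟨b, z⟩
  · exact (add_zero 0).symm
  · rfl

lemma sumPair_tail {H : List α → α → List α → M} (h : ∀ x a, H x a [] = 0) :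
    sumPair (fun x a b z => H x a (b :: z)) l = sumElt H l := by
  refine sumElt_congr fun x a y _ => ?_
  rcases y with _ | ⟨b, z⟩
  · exact (h x a).symm
  · rfl

lemma sumPair_init {H : List α → α → List α → M} (h : ∀ b z, H [] b z = 0) :
    sumPair (fun x a b z => H (x ++ [a]) b z) l = sumElt H l := by
  rcases l with _ | ⟨a, l⟩
  · rfl
  induction l generalizing H a with
  | nil => simp [sumPair, sumElt, h]
  | cons b l ih =>
    rw [sumPair_cons_cons, sumElt, h, zero_add]
    -- the first pair is peeled off by hand, since the induction hypothesis needs `H [] = 0`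
    have := ih (H := fun x c y => match x with
      | [] => 0
      | d :: x => H (a :: d :: x) c y) (fun _ _ => rfl) b
    rw [sumElt, zero_add] at this
    rw [sumElt]
    refine congrArg₂ _ rfl (Eq.trans ?_ (this.trans rfl))
    refine sumPair_congr fun x c d z _ => ?_
    rcases x with _ | ⟨e, x⟩ <;> rfl

lemma sumPair_splitSum (h : Alt m) (F : Alt m → Alt m → List α → α → α → List α → M) :
    sumPair (fun x a b z => h.splitSum fun u v => F u v x a b z) l =
      h.splitSum fun u v => sumPair (F u v) l := by
  unfold sumPair
  rw [← sumElt_splitSum]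
  refine sumElt_congr fun x a y _ => ?_
  rcases y with _ | ⟨b, z⟩
  · exact (Alt.splitSum_eq_zero fun _ _ _ _ => rfl).symm
  · rfl

lemma mul_sumPair {S : Type*} [NonUnitalNonAssocSemiring S] (r : S)
    (F : List α → α → α → List α → S) :
    r * sumPair F l = sumPair (fun x a b z => r * F x a b z) l := by
  unfold sumPair
  rw [mul_sumElt]
  refine sumElt_congr fun x a y _ => ?_
  rcases y with _ | ⟨b, z⟩
  · exact mul_zero r
  · rfl

lemma sumPair_mul {S : Type*} [NonUnitalNonAssocSemiring S] (r : S)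
    (F : List α → α → α → List α → S) :
    sumPair F l * r = sumPair (fun x a b z => F x a b z * r) l := by
  unfold sumPair
  rw [sumElt_mul]
  refine sumElt_congr fun x a y _ => ?_
  rcases y with _ | ⟨b, z⟩
  · exact zero_mul r
  · rfl

/-- The sum over all ways to cut a sequence inside one of its entries. -/
def sumSplit (F : List (Alt m) → List (Alt m) → M) : List (Alt m) → M :=
  sumElt fun x u y => u.splitSum fun u' u'' => F (x ++ [u']) (u'' :: y)

/-- A cut of a sequence inside one of its entries. -/
def IsSplit (l x y : List (Alt m)) : Prop :=
  ∃ x' u' u'' y', u'.Comp u'' ∧ l = x' ++ u'.mul u'' :: y' ∧ x = x' ++ [u'] ∧ y = u'' :: y'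

lemma sumSplit_eq_zero {F : List (Alt m) → List (Alt m) → M} {l : List (Alt m)}
    (h : ∀ x y, IsSplit l x y → F x y = 0) : sumSplit F l = 0 :=
  sumElt_eq_zero fun x _ y e => Alt.splitSum_eq_zero fun u' u'' hc hu =>
    h _ _ ⟨x, u', u'', y, hc, by rw [hu, e], rfl, rfl⟩

lemma sumSplit_eq_single {F : List (Alt m) → List (Alt m) → M} {l x₀ y₀ : List (Alt m)}
    (h₀ : IsSplit l x₀ y₀) (h : ∀ x y, IsSplit l x y → x ≠ x₀ → F x y = 0) :
    sumSplit F l = F x₀ y₀ := by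
  obtain ⟨x', u', u'', y', hc, rfl, rfl, rfl⟩ := h₀
  unfold sumSplit
  rw [sumElt_append, sumElt, sumElt_eq_zero, sumElt_eq_zero, zero_add, add_zero]
  · rw [Alt.splitSum_eq_single hc rfl]
    · simp
    · intro b' c' hc' hb hne
      refine h _ _ ⟨x', b', c', y', hc', by rw [hb], by simp, rfl⟩ ?_
      simpa using hne
  · rintro x a y rfl
    refine Alt.splitSum_eq_zero fun b c hc' hb => h _ _ ⟨x' ++ u'.mul u'' :: x, b, c, y, hc',
      by simp [hb], by simp, rfl⟩ fun e => ?_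
    have := congrArg List.length e
    simp at this
  · rintro x a y rfl
    refine Alt.splitSum_eq_zero fun b c hc' hb => h _ _ ⟨x, b, c, y ++ u'.mul u'' :: y', hc',
      by simp [hb], by simp, rfl⟩ fun e => ?_
    have := congrArg List.length e
    simp at this

end sums

/-! ### Cutting a tiling tree along an edge -/

/-- The centered contribution without the idempotent of the root.  The exponent is the number of
internal vertices of a tiling tree with algebra sequence `l`. -/
def cbar (l : List (Alt m)) : (BordAlg m)[X] :=
  open Classical in if Cent l then X ^ ((l.length - 2) / (2 * m - 4)) else 0

lemma cbar_of_not {l : List (Alt m)} (h : ¬ Cent l) : cbar l = 0 := by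
  rw [cbar, if_neg h]

lemma cbar_of_length (hm : 3 ≤ m) {l : List (Alt m)} (h : l.length < 4) : cbar l = 0 :=
  cbar_of_not fun hl => by
    have := hl.four_le_length hm
    omega

lemma cbar_comm (l : List (Alt m)) (f : (BordAlg m)[X]) : cbar l * f = f * cbar l := by
  unfold cbar
  split_ifs
  · exact X_pow_mul
  · rw [zero_mul, mul_zero]

lemma cbar_append_comm (hm : 3 ≤ m) (x y : List (Alt m)) : cbar (x ++ y) = cbar (y ++ x) := by
  unfold cbar
  classical
  refine if_congr (cent_append_comm hm) ?_ rfl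
  rw [List.length_append, List.length_append, add_comm]

lemma word_split {l : List (Alt m)} {w₁ w₂ : List Bool} (h : word l = w₁ ++ true :: w₂) :
    ∃ x u' u'' y, u'.Comp u'' ∧ l = x ++ u'.mul u'' :: y ∧ w₁ = word (x ++ [u']) ∧
      w₂ = word (u'' :: y) := by
  -- a word with at least two letters is cut behind its letter number `i`
  have key : ∀ (a : Alt m) (z : List (Alt m)) (t : List Bool) (i : ℕ), i < a.extra →
      word (a :: z) = List.replicate i true ++ true :: t →
      ∃ u' u'' : Alt m, u'.Comp u'' ∧ a = u'.mul u'' ∧ List.replicate i true = word [u'] ∧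
        t = word (u'' :: z) := by
    intro a z t i hi ht
    have h1 := Alt.comp_split (a := a) hi
    refine ⟨_, _, h1.1, h1.2.symm, rfl, ?_⟩
    rw [← h1.2, word_mul_cons] at ht
    simpa using ht.symm
  induction l generalizing w₁ with
  | nil => simp [word] at h
  | cons a l ih =>
    rcases Nat.lt_or_ge w₁.length a.extra with hlt | hge
    · have hw : w₁ = List.replicate w₁.length true := by
        have h1 : w₁ = (word (a :: l)).take w₁.length := by rw [h]; simp
        have h2 : ∃ s, word (a :: l) = List.replicate a.extra true ++ s := by
          rcases l with _ | ⟨b, l⟩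
          · exact ⟨[], by simp [word]⟩
          · exact ⟨_, rfl⟩
        obtain ⟨s, hs⟩ := h2
        rw [hs, List.take_append_of_le_length (by simp; omega), List.take_replicate,
          min_eq_left hlt.le] at h1
        exact h1
      rw [hw] at h
      obtain ⟨u', u'', hc, rfl, h2, h3⟩ := key a l w₂ _ hlt h
      exact ⟨[], u', u'', l, hc, rfl, by rw [List.nil_append, ← h2, ← hw], h3⟩
    · rcases l with _ | ⟨b, l⟩
      · have := congrArg List.length h
        simp [word] at this
        omega
      · rw [word, List.append_eq_append_iff] at h
        rcases h with ⟨t, rfl, ht⟩ | ⟨t, ht, ht'⟩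
        · rcases t with _ | ⟨c, t⟩
          · simp at ht
          · simp only [List.cons_append, List.cons.injEq] at ht
            obtain ⟨rfl, ht⟩ := ht
            obtain ⟨x, u', u'', y, hc, hl, h1, h2⟩ := ih ht
            refine ⟨a :: x, u', u'', y, hc, by rw [hl]; rfl, ?_, h2⟩
            rw [List.cons_append, h1]
            rcases x with _ | ⟨d, x⟩ <;> rfl
        · have := congrArg List.length ht
          simp only [List.length_replicate, List.length_append] at this
          obtain rfl : t = [] := List.eq_nil_of_length_eq_zero (by omega)
          simp at ht'

lemma eq_of_word_eq {a b : Alt m} {l l' : List (Alt m)} (h : (a :: l).IsChain Alt.Follows)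
    (h' : (b :: l').IsChain Alt.Follows) (hab : a.first = b.first)
    (hw : word (a :: l) = word (b :: l')) : a :: l = b :: l' := by
  have h1 := run_word h
  rw [hab, hw, run_word h'] at h1
  have h2 := congrArg cutAtNone h1
  rw [cutAtNone_spell, cutAtNone_spell] at h2
  refine (List.map_injective_iff.2 ?_ h2).symm
  intro c d hcd
  have h3 := congrArg List.head? hcd
  have h4 := congrArg List.length hcd
  simp only [Arrow.head_alt, Arrow.length_alt, Option.some.injEq] at h3 h4
  exact Alt.ext h3 (by omega)

lemma not_parses_replicate (hm : 3 ≤ m) (k : ℕ) :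
    ¬ Parses (2 * m - 3) (2 * m - 3) (List.replicate k true) := by
  intro h
  obtain ⟨d, hd⟩ := h.exists_count (by omega)
  rw [List.count_replicate] at hd
  simp at hd
  omega

lemma isChain_mul_cons {a b : Alt m} (h : a.Comp b) (z : List (Alt m)) :
    (a.mul b :: z).IsChain Alt.Follows ↔ (b :: z).IsChain Alt.Follows := by
  rw [List.isChain_cons, List.isChain_cons]
  unfold Alt.Follows
  rw [Alt.last_mul h]

lemma isChain_concat_iff {a b : Alt m} (h : a.first = b.first) (z : List (Alt m)) :
    (z ++ [a]).IsChain Alt.Follows ↔ (z ++ [b]).IsChain Alt.Follows := by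
  rw [List.isChain_append, List.isChain_append]
  simp [Alt.Follows, h]

lemma isChain_append_mul {a b : Alt m} (h : a.Comp b) (x z : List (Alt m)) :
    (x ++ a.mul b :: z).IsChain Alt.Follows ↔
      (x ++ [a]).IsChain Alt.Follows ∧ (b :: z).IsChain Alt.Follows := by
  rw [← isChain_mul_cons h, List.isChain_split]
  rw [isChain_concat_iff (show (a.mul b).first = a.first from rfl)]

/-- Gluing two tiling trees along an edge. -/
lemma Cent.glue (hm : 3 ≤ m) {a b u v : Alt m} {z₁ z₂ : List (Alt m)} (huv : u.Comp v)
    (h₁ : Cent (a :: v :: z₂)) (h₂ : Cent (b :: z₁ ++ [u])) :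
    a.Comp b ∧ Cent (a.mul b :: (z₁ ++ u.mul v :: z₂)) := by
  have hab : a.Comp b := by
    have h3 : b.first = u.last.rot := h₂.closed_concat hm
    have h4 : v.first = a.last.rot := (List.isChain_cons_cons.1 h₁.1).1
    have h5 : b.first.cont.rot = a.last.rot := by
      rw [h3, Arrow.rot_cont_rot, ← h4, huv]
    have h6 := Arrow.rot_injective h5
    rw [Alt.Comp, ← h6, Arrow.cont_cont]
  refine ⟨hab, ?_, ?_⟩
  · rw [isChain_mul_cons hab, ← List.cons_append, isChain_append_mul huv]
    exact ⟨h₂.1, (List.isChain_cons_cons.1 h₁.1).2⟩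
  · rw [word_mul_cons, ← List.cons_append, word_mul]
    exact Parses.graft h₂.2 h₁.2 rfl

/-- Cutting a tiling tree along the edge between two neighbouring sectors of a region. -/
lemma Cent.exists_cut (hm : 3 ≤ m) {a b : Alt m} {z : List (Alt m)} (hab : a.Comp b)
    (h : Cent (a.mul b :: z)) : ∃ x y, IsSplit z x y ∧ Cent (a :: y) ∧ Cent (b :: x) := by
  have h1 := h.2
  rw [word_mul_cons] at h1
  rcases h1.cut rfl with ⟨w₁, w₂, hw, h2, h3⟩ | ⟨u₁, u₂, hu, h2, -⟩
  · obtain ⟨x, u', u'', y, hc, hl, rfl, rfl⟩ := word_split hw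
    rcases x with _ | ⟨c, x⟩
    · exact absurd h2 (not_parses_replicate hm _)
    · simp only [List.cons_append, List.cons.injEq] at hl
      obtain ⟨rfl, rfl⟩ := hl
      have hch := h.1
      rw [isChain_mul_cons hab, ← List.cons_append, isChain_append_mul hc] at hch
      have hx : Cent (b :: (x ++ [u'])) := ⟨hch.1, h2⟩
      refine ⟨x ++ [u'], u'' :: y, ⟨x, u', u'', y, hc, rfl, rfl, rfl⟩, ⟨?_, h3⟩, hx⟩
      refine List.isChain_cons_cons.2 ⟨?_, hch.2⟩
      have h4 : b.first = u'.last.rot := hx.closed_concat hm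
      have h5 : a.last = b.first.cont := by rw [hab, Arrow.cont_cont]
      rw [Alt.Follows, h5, h4, Arrow.rot_cont_rot, hc]
  · have h4 : u₂ = List.replicate u₂.length true := by
      rw [List.eq_replicate_iff]
      refine ⟨rfl, fun c hc => ?_⟩
      have : c ∈ List.replicate a.extra true := by rw [hu]; simp [hc]
      exact List.eq_of_mem_replicate this
    rw [h4] at h2
    exact absurd h2 (not_parses_replicate hm _)

lemma cbar_mul_cbar (hm : 3 ≤ m) {l l₁ l₂ : List (Alt m)} (h : Cent l) (h₁ : Cent l₁)
    (h₂ : Cent l₂) (hl : l₁.length + l₂.length = l.length + 2) :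
    cbar l = cbar l₁ * cbar l₂ := by
  obtain ⟨d, hd⟩ := h₁.exists_length hm
  obtain ⟨e, he⟩ := h₂.exists_length hm
  have hn : l.length - 2 = (d + 1 + (e + 1)) * (2 * m - 4) := by rw [add_mul]; omega
  rw [cbar, cbar, cbar, if_pos h, if_pos h₁, if_pos h₂, ← pow_add, hn, hd, he,
    Nat.add_sub_cancel, Nat.add_sub_cancel, Nat.mul_div_cancel _ (by omega),
    Nat.mul_div_cancel _ (by omega), Nat.mul_div_cancel _ (by omega)]

/-- An edge of a tiling tree separates it into two tiling trees, and trees can be glued; the other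
end of the cut is inside some other entry of the algebra sequence. -/
lemma cbar_cut (hm : 3 ≤ m) (a b : Alt m) (z : List (Alt m)) :
    (if a.Comp b then cbar (a.mul b :: z) else 0) =
      sumSplit (fun x y => cbar (a :: y) * cbar (b :: x)) z := by
  by_cases h : a.Comp b ∧ Cent (a.mul b :: z)
  · obtain ⟨x, y, hs, h1, h2⟩ := h.2.exists_cut hm h.1
    rw [if_pos h.1, sumSplit_eq_single hs]
    · refine cbar_mul_cbar hm h.2 h1 h2 ?_
      obtain ⟨x', u', u'', y', -, rfl, rfl, rfl⟩ := hs
      simp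
      omega
    · intro x' y' hs' hne
      by_cases hx : Cent (b :: x')
      · exfalso
        apply hne
        have hpre : ∀ x y, IsSplit z x y → word (b :: z) = word (b :: x) ++ true :: word y := by
          rintro _ _ ⟨x', u', u'', y', -, rfl, rfl, rfl⟩
          rw [← List.cons_append, word_mul]
          rfl
        have hw := hx.2.prefix_unique h2.2 ((hpre _ _ hs').symm.trans (hpre _ _ hs))
        exact (List.cons.inj (eq_of_word_eq hx.1 h2.1 rfl hw)).2
      · rw [cbar_of_not hx, mul_zero]
  · have h0 : (if a.Comp b then cbar (a.mul b :: z) else 0) = 0 := by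
      split_ifs with hc
      · exact cbar_of_not fun hz => h ⟨hc, hz⟩
      · rfl
    rw [h0, sumSplit_eq_zero]
    rintro _ _ ⟨x', u', u'', y', hc, rfl, rfl, rfl⟩
    by_cases h1 : Cent (a :: u'' :: y')
    · by_cases h2 : Cent (b :: (x' ++ [u']))
      · exact absurd (h1.glue hm hc h2) h
      · rw [cbar_of_not h2, mul_zero]
    · rw [cbar_of_not h1, zero_mul]

section sums

variable {M : Type*} [AddCommMonoid M] {F G : List (Alt m) → List (Alt m) → M}
  {l : List (Alt m)}

lemma sumSplit_nil : sumSplit F [] = 0 := rfl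

lemma sumSplit_cons (h : Alt m) : sumSplit F (h :: l) =
    (h.splitSum fun u v => F [u] (v :: l)) + sumSplit (fun x y => F (h :: x) y) l := rfl

lemma sumSplit_append (u v : List (Alt m)) : sumSplit F (u ++ v) =
    sumSplit (fun x y => F x (y ++ v)) u + sumSplit (fun x y => F (u ++ x) y) v := by
  unfold sumSplit
  rw [sumElt_append]
  simp only [List.cons_append, List.append_assoc]

lemma sumSplit_concat (h : Alt m) : sumSplit F (l ++ [h]) =
    sumSplit (fun x y => F x (y ++ [h])) l + h.splitSum fun u v => F (l ++ [u]) [v] := by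
  rw [sumSplit_append, sumSplit_cons, sumSplit_nil, add_zero]

lemma sumSplit_congr (h : ∀ x y, IsSplit l x y → F x y = G x y) :
    sumSplit F l = sumSplit G l :=
  sumElt_congr fun x _ y e => Alt.splitSum_congr fun u' u'' hc hu =>
    h _ _ ⟨x, u', u'', y, hc, by rw [hu, e], rfl, rfl⟩

lemma sumSplit_add : sumSplit (fun x y => F x y + G x y) l = sumSplit F l + sumSplit G l := by
  unfold sumSplit
  simp only [Alt.splitSum_add, sumElt_add]

lemma sumSplit_splitSum (h : Alt m) (F : Alt m → Alt m → List (Alt m) → List (Alt m) → M) :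
    sumSplit (fun x y => h.splitSum fun b c => F b c x y) l =
      h.splitSum fun b c => sumSplit (F b c) l := by
  unfold sumSplit
  rw [← sumElt_splitSum]
  exact sumElt_congr fun x a y _ => Alt.splitSum_comm _ _

lemma mul_sumSplit {S : Type*} [NonUnitalNonAssocSemiring S] (r : S)
    (F : List (Alt m) → List (Alt m) → S) :
    r * sumSplit F l = sumSplit (fun x y => r * F x y) l := by
  unfold sumSplit
  simp only [mul_sumElt, Alt.mul_splitSum]

lemma sumSplit_mul {S : Type*} [NonUnitalNonAssocSemiring S] (r : S)
    (F : List (Alt m) → List (Alt m) → S) :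
    sumSplit F l * r = sumSplit (fun x y => F x y * r) l := by
  unfold sumSplit
  simp only [sumElt_mul, Alt.splitSum_mul_right]

end sums

/-! ### Centered and extended contributions -/

/-- The element of `C(m,1)[t]` of an alternating word. -/
def Alt.poly (a : Alt m) : (BordAlg m)[X] := C a.elt

/-- The vertex at which the first entry starts, which is the label of the root edge of a tiling
tree.  The value at the empty sequence is not used, since it comes from no tree. -/
def headSrc : List (Alt m) → Vertex m
  | [] => 0
  | a :: _ => a.first.src

/-- The centered contribution. -/
def cent (l : List (Alt m)) : (BordAlg m)[X] := C (idem (headSrc l)) * cbar l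

/-- Left extension of operations: `∑_{a = b c} b f (c, …)`. -/
def extL (f : List (Alt m) → (BordAlg m)[X]) : List (Alt m) → (BordAlg m)[X]
  | [] => 0
  | a :: l => a.splitSum fun b c => b.poly * f (c :: l)

/-- Right extension of operations: `∑_{a = b c} f (…, b) c`. -/
def extR (f : List (Alt m) → (BordAlg m)[X]) (l : List (Alt m)) : (BordAlg m)[X] :=
  match l.getLast? with
  | none => 0
  | some a => a.splitSum fun b c => f (l.dropLast ++ [b]) * c.poly

lemma extL_cons (f : List (Alt m) → (BordAlg m)[X]) (a : Alt m) (l : List (Alt m)) :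
    extL f (a :: l) = a.splitSum fun b c => b.poly * f (c :: l) := rfl

lemma extR_concat (f : List (Alt m) → (BordAlg m)[X]) (a : Alt m) (l : List (Alt m)) :
    extR f (l ++ [a]) = a.splitSum fun b c => f (l ++ [b]) * c.poly := by
  unfold extR
  rw [List.getLast?_concat]
  simp

lemma Alt.poly_mul_poly (hm : 3 ≤ m) (a b : Alt m) :
    a.poly * b.poly = if a.Comp b then (a.mul b).poly else 0 := by
  unfold poly
  rw [← C_mul]
  split_ifs with h
  · rw [elt_mul_elt_of_comp h]
  · rw [elt_mul_elt_of_not_comp hm h, C_0]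

lemma Alt.idem_mul_poly (x : Vertex m) (a : Alt m) :
    C (idem x) * a.poly = if x = a.first.src then a.poly else 0 := by
  unfold poly
  rw [← C_mul, idem_mul_elt]
  split_ifs
  · rfl
  · exact C_0

lemma Alt.poly_mul_idem (x : Vertex m) (a : Alt m) :
    a.poly * C (idem x) = if a.last.tgt = x then a.poly else 0 := by
  unfold poly
  rw [← C_mul, elt_mul_idem]
  split_ifs
  · rfl
  · exact C_0

lemma Alt.Comp.tgt_eq {a b : Alt m} (h : a.Comp b) : a.last.tgt = b.first.src := by
  rw [h, Arrow.src_cont]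

lemma Alt.comp_iff_of_mul {a b c d : Alt m} (h : a.Comp b) (hc : a.mul b = c) :
    c.Comp d ↔ b.Comp d := by
  rw [← hc, Comp, last_mul h, Comp]

lemma headSrc_append_cons (x z : List (Alt m)) {a b : Alt m} (w : List (Alt m))
    (h : a.first = b.first) : headSrc (x ++ a :: z) = headSrc (x ++ b :: w) := by
  rcases x with _ | ⟨c, x⟩
  · exact congrArg Arrow.src h
  · rfl

lemma cent_of_length (hm : 3 ≤ m) {l : List (Alt m)} (h : l.length < 4) : cent l = 0 := by
  rw [cent, cbar_of_length hm h, mul_zero]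

/-- A tiling tree closes up: its root edge starts where its last region ends. -/
lemma cbar_congr_of_last (hm : 3 ≤ m) {f g : (BordAlg m)[X]} {x : List (Alt m)} {a : Alt m}
    (h : headSrc (x ++ [a]) = a.last.tgt → f = g) : cbar (x ++ [a]) * f = cbar (x ++ [a]) * g := by
  by_cases hc : Cent (x ++ [a])
  · rw [h]
    rcases x with _ | ⟨b, x⟩
    · have := hc.four_le_length hm
      simp at this
    · rw [← Arrow.src_rot]
      exact congrArg Arrow.src (hc.closed_concat hm)
  · rw [cbar_of_not hc, zero_mul, zero_mul]

/-- The idempotent of a tiling tree is absorbed by an element that starts where its last region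
ends. -/
lemma cent_mul_poly (hm : 3 ≤ m) {x : List (Alt m)} {u a : Alt m} (h : u.last.tgt = a.first.src) :
    cent (x ++ [u]) * a.poly = cbar (x ++ [u]) * a.poly := by
  rw [cent, ← cbar_comm, mul_assoc]
  refine cbar_congr_of_last hm fun e => ?_
  rw [Alt.idem_mul_poly, if_pos (e.trans h)]

lemma poly_mul_cent {a b : Alt m} {l : List (Alt m)} (h : a.last.tgt = b.first.src) :
    a.poly * cent (b :: l) = cbar (b :: l) * a.poly := by
  rw [cent, ← mul_assoc, Alt.poly_mul_idem, cbar_comm]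
  exact congrArg (· * cbar (b :: l)) (if_pos h)

/-! ### The terms of the `A∞`-relation -/

/-- Terms in which two neighbouring entries are multiplied first. -/
def mulTerms (f : List (Alt m) → (BordAlg m)[X]) : List (Alt m) → (BordAlg m)[X] :=
  sumPair fun x a b z => if a.Comp b then f (x ++ a.mul b :: z) else 0

/-- Terms whose inner operation is left-extended and does not reach the end of the sequence.  The
inner operation cuts an entry of `w`, its tree has the algebra sequence `y`, and the first factor of
the cut entry, which absorbs the idempotent of that tree, remains as the last entry of `x`. -/
def leftTerms (f : List (Alt m) → (BordAlg m)[X]) : List (Alt m) → (BordAlg m)[X] :=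
  sumElt fun w b z => sumSplit (fun x y => f (x ++ b :: z) * cbar y) w

/-- Terms whose inner operation is left-extended and reaches the end of the sequence. -/
def leftEndTerms (f : List (Alt m) → (BordAlg m)[X]) : List (Alt m) → (BordAlg m)[X] :=
  sumSplit fun x y => f x * cbar y

/-- Terms whose inner operation is right-extended and does not begin with the first entry.  Here the
second factor of the cut entry remains, as the first entry of `z`. -/
def rightTerms (f : List (Alt m) → (BordAlg m)[X]) : List (Alt m) → (BordAlg m)[X] :=
  sumElt fun x a w => sumSplit (fun y z => f (x ++ a :: z) * cbar y) w

/-- Terms whose inner operation is right-extended and begins with the first entry. -/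
def rightEndTerms (f : List (Alt m) → (BordAlg m)[X]) : List (Alt m) → (BordAlg m)[X] :=
  sumSplit fun y z => f z * cbar y

lemma poly_mul_cbar_comm (r : (BordAlg m)[X]) (a : Alt m) (l : List (Alt m)) :
    r * a.poly * cbar l = r * cbar l * a.poly := by
  rw [mul_assoc, mul_assoc, cbar_comm]

/-- Products inside a region of a centered tree cancel against the extended inner operations,
by cutting the tree along the edge at which the region is divided. -/
lemma mulTerms_cent (hm : 3 ≤ m) (l : List (Alt m)) :
    mulTerms cent l = rightTerms cent l + leftTerms cent l := by
  unfold mulTerms rightTerms leftTerms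
  rw [← sumPair_tail (fun _ _ => rfl), ← sumPair_init (fun _ _ => rfl), ← sumPair_add]
  refine sumPair_congr fun x a b z _ => ?_
  have h1 : (if a.Comp b then cent (x ++ a.mul b :: z) else 0) = C (idem (headSrc (x ++ [a]))) *
      if a.Comp b then cbar (a.mul b :: (z ++ x)) else 0 := by
    split_ifs
    · rw [cent, headSrc_append_cons x z [] (show (a.mul b).first = a.first from rfl),
        cbar_append_comm hm]
      rfl
    · rw [mul_zero]
  rw [h1, cbar_cut hm, sumSplit_append, sumSplit_cons, sumSplit_concat, mul_add]
  rw [Alt.splitSum_eq_zero (a := b), Alt.splitSum_eq_zero (a := a), zero_add, add_zero,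
    mul_sumSplit, mul_sumSplit]
  · congr 1
    · refine sumSplit_congr fun y w _ => ?_
      rw [cent, headSrc_append_cons x w [] (show a.first = a.first from rfl), mul_assoc,
        cbar_append_comm hm x]
      rfl
    · refine sumSplit_congr fun y w hs => ?_
      obtain ⟨x', u', u'', y', hc, rfl, rfl, rfl⟩ := hs
      rw [cent, cbar_comm (a :: _), mul_assoc,
        cbar_append_comm hm (x' ++ [u']) (b :: z), cbar_append_comm hm (u'' :: y') [a]]
      simp only [List.append_assoc, List.cons_append, List.nil_append]
      rw [headSrc_append_cons x' _ _ (show (u'.mul u'').first = u'.first from rfl)]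
  · intro u v _ _
    rw [cbar_of_length hm (l := [v]) (by simp), mul_zero]
  · intro u v _ _
    rw [cbar_of_length hm (l := [u]) (by simp), mul_zero]

lemma leftEndTerms_cent (hm : 3 ≤ m) (l : List (Alt m)) :
    leftEndTerms cent l = rightEndTerms cent l := by
  refine sumSplit_congr fun x y hs => ?_
  obtain ⟨x', u', u'', y', hc, rfl, rfl, rfl⟩ := hs
  rw [cent, ← cbar_comm (x' ++ [u']), mul_assoc, ← cbar_comm (x' ++ [u']) (cent _)]
  refine cbar_congr_of_last hm fun e => ?_
  rw [e, hc.tgt_eq]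
  rfl

/-- The inner operation does not involve the first entry, so that left extension commutes with
it. -/
lemma rightTerms_extL (f : List (Alt m) → (BordAlg m)[X]) (h : Alt m) (l : List (Alt m)) :
    rightTerms (extL f) (h :: l) = extL (rightTerms f) (h :: l) := by
  rw [extL_cons]
  simp only [rightTerms, sumElt, List.nil_append, List.cons_append, extL_cons,
    Alt.splitSum_mul_right, sumSplit_splitSum, sumElt_splitSum, mul_add, Alt.splitSum_add,
    mul_sumElt, mul_sumSplit, mul_assoc]

lemma leftTerms_extL (f : List (Alt m) → (BordAlg m)[X]) (h : Alt m) (l : List (Alt m)) :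
    leftTerms (extL f) (h :: l) = extL (leftTerms f) (h :: l) := by
  rw [extL_cons]
  simp only [leftTerms, sumElt, sumSplit_nil, zero_add, sumSplit_cons, List.nil_append,
    List.cons_append, extL_cons, Alt.splitSum_mul_right, sumSplit_splitSum, sumElt_splitSum,
    mul_add, Alt.splitSum_add, mul_sumElt, mul_sumSplit, mul_assoc, sumElt_add,
    Alt.splitSum_assoc, Alt.mul_splitSum]

lemma leftEndTerms_extL (f : List (Alt m) → (BordAlg m)[X]) (h : Alt m) (l : List (Alt m)) :
    leftEndTerms (extL f) (h :: l) = extL (leftEndTerms f) (h :: l) := by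
  rw [extL_cons]
  simp only [leftEndTerms, sumSplit_cons, extL_cons, Alt.splitSum_mul_right, sumSplit_splitSum,
    mul_add, Alt.splitSum_add, mul_sumSplit, mul_assoc,
    Alt.splitSum_assoc, Alt.mul_splitSum]

lemma leftTerms_extR (f : List (Alt m) → (BordAlg m)[X]) (h : Alt m) (l : List (Alt m)) :
    leftTerms (extR f) (l ++ [h]) = extR (leftTerms f) (l ++ [h]) := by
  have e1 : ∀ (x z : List (Alt m)) (b : Alt m), x ++ b :: (z ++ [h]) = x ++ b :: z ++ [h] := by
    simp
  rw [extR_concat]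
  simp only [leftTerms, sumElt_concat, e1, extR_concat,
    Alt.splitSum_mul_right, sumSplit_splitSum, sumElt_splitSum, add_mul, Alt.splitSum_add,
    sumElt_mul, sumSplit_mul, poly_mul_cbar_comm]
  simp only [List.append_assoc, List.cons_append]

lemma rightTerms_extR (f : List (Alt m) → (BordAlg m)[X]) (h : Alt m) (l : List (Alt m)) :
    rightTerms (extR f) (l ++ [h]) = extR (rightTerms f) (l ++ [h]) := by
  have e1 : ∀ (x z : List (Alt m)) (b : Alt m), x ++ b :: (z ++ [h]) = x ++ b :: z ++ [h] := by
    simp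
  have e2 : ∀ (x : List (Alt m)) (b c : Alt m), x ++ [b, c] = (x ++ [b]) ++ [c] := by
    simp
  rw [extR_concat]
  simp only [rightTerms, sumElt_concat, sumSplit_nil, add_zero, sumSplit_concat, e1, e2,
    extR_concat, Alt.splitSum_mul_right, sumSplit_splitSum, sumElt_splitSum,
    add_mul, Alt.splitSum_add, sumElt_mul, sumSplit_mul, poly_mul_cbar_comm, sumElt_add,
    ← Alt.splitSum_assoc]
  simp only [List.append_assoc, List.cons_append]

lemma rightEndTerms_extR (f : List (Alt m) → (BordAlg m)[X]) (h : Alt m) (l : List (Alt m)) :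
    rightEndTerms (extR f) (l ++ [h]) = extR (rightEndTerms f) (l ++ [h]) := by
  have e1 : ∀ b : Alt m, [b] = [] ++ [b] := fun _ => rfl
  rw [extR_concat]
  simp only [rightEndTerms, sumSplit_concat, extR_concat, Alt.splitSum_mul_right,
    sumSplit_splitSum, add_mul, Alt.splitSum_add, sumSplit_mul, poly_mul_cbar_comm]
  congr 1
  rw [Alt.splitSum_assoc]
  refine Alt.splitSum_congr fun u v _ _ => ?_
  rw [e1 v, extR_concat, Alt.splitSum_mul_right]
  simp only [poly_mul_cbar_comm, List.nil_append]

/-- An inner operation that is right-extended and begins with the first entry, inside a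
left-extended operation, cancels against its mirror image. -/
lemma rightEndTerms_extL_cent (hm : 3 ≤ m) (l : List (Alt m)) :
    rightEndTerms (extL cent) l = leftEndTerms (extR cent) l := by
  refine sumElt_congr fun x u y _ => ?_
  simp only [extL_cons, extR_concat, Alt.splitSum_mul_right]
  rw [← Alt.splitSum_assoc]
  refine Alt.splitSum_congr fun u₁ u₃ h₁ _ => Alt.splitSum_congr fun u₁ u₂ h₂ e => ?_
  rw [Alt.comp_iff_of_mul h₂ e] at h₁
  rw [poly_mul_cent h₁.tgt_eq, cent_mul_poly hm h₂.tgt_eq, ← cbar_comm (x ++ [u₁]),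
    ← cbar_comm (u₃ :: y), ← mul_assoc, ← mul_assoc, cbar_comm (u₃ :: y)]

/-- Left extension commutes with products, up to the products with the first entry: if the product
is factored between its two factors, or inside the second one, then the first entry is split off
as a whole. -/
lemma mulTerms_extL (hm : 3 ≤ m) (f : List (Alt m) → (BordAlg m)[X]) (h b : Alt m)
    (z : List (Alt m)) : mulTerms (extL f) (h :: b :: z) =
      extL (mulTerms f) (h :: b :: z) + h.poly * extL f (b :: z) +
        if h.Comp b then h.poly * f (b :: z) else 0 := by
  have h1 : ∀ g : List (Alt m) → (BordAlg m)[X], mulTerms g (h :: b :: z) =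
      (if h.Comp b then g (h.mul b :: z) else 0) +
        sumPair (fun x c d y => if c.Comp d then g (h :: (x ++ c.mul d :: y)) else 0) (b :: z) :=
    fun _ => rfl
  have h2 : ∀ u v : Alt m, ∀ g : List (Alt m) → (BordAlg m)[X], mulTerms g (v :: b :: z) =
      (if v.Comp b then g (v.mul b :: z) else 0) +
        sumPair (fun x c d y => if c.Comp d then g (v :: (x ++ c.mul d :: y)) else 0) (b :: z) :=
    fun _ _ _ => rfl
  have h3 : sumPair (fun x c d y => if c.Comp d then extL f (h :: (x ++ c.mul d :: y)) else 0)
      (b :: z) = h.splitSum fun u v => u.poly * sumPair (fun x c d y =>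
        if c.Comp d then f (v :: (x ++ c.mul d :: y)) else 0) (b :: z) := by
    simp only [mul_sumPair]
    rw [← sumPair_splitSum]
    refine sumPair_congr fun x c d y _ => ?_
    split_ifs
    · rfl
    · exact (Alt.splitSum_eq_zero fun _ _ _ _ => mul_zero _).symm
  have h4 : extL (mulTerms f) (h :: b :: z) =
      (h.splitSum fun u v => u.poly * if h.Comp b then f (v.mul b :: z) else 0) +
      h.splitSum fun u v => u.poly * sumPair (fun x c d y =>
        if c.Comp d then f (v :: (x ++ c.mul d :: y)) else 0) (b :: z) := by
    rw [← Alt.splitSum_add, extL_cons]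
    refine Alt.splitSum_congr fun u v hc e => ?_
    rw [h2 u v, mul_add]
    congr 2
    exact if_congr (Alt.comp_iff_of_mul hc e).symm rfl rfl
  have core : (if h.Comp b then extL f (h.mul b :: z) else 0) =
      (h.splitSum fun u v => u.poly * if h.Comp b then f (v.mul b :: z) else 0) +
        h.poly * extL f (b :: z) + if h.Comp b then h.poly * f (b :: z) else 0 := by
    by_cases hc : h.Comp b
    · simp only [if_pos hc]
      rw [extL_cons, extL_cons, Alt.mul_splitSum, add_right_comm]
      refine (Alt.splitSum_mul hc).trans ?_
      congr 1
      refine Alt.splitSum_congr fun u v _ e => ?_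
      have : h.Comp u := by rw [← e] at hc; exact hc
      rw [← mul_assoc, Alt.poly_mul_poly hm, if_pos this]
    · simp only [if_neg hc, mul_zero, add_zero]
      rw [Alt.splitSum_eq_zero fun _ _ _ _ => rfl, zero_add, extL_cons, Alt.mul_splitSum,
        Alt.splitSum_eq_zero]
      intro u v _ e
      have : ¬ h.Comp u := by rw [← e] at hc; exact hc
      rw [← mul_assoc, Alt.poly_mul_poly hm, if_neg this, zero_mul]
  rw [h1, h3, h4, core]
  abel

lemma mulTerms_extR (hm : 3 ≤ m) (f : List (Alt m) → (BordAlg m)[X]) (b h : Alt m)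
    (z : List (Alt m)) : mulTerms (extR f) (z ++ [b, h]) =
      extR (mulTerms f) (z ++ [b, h]) + extR f (z ++ [b]) * h.poly +
        if b.Comp h then f (z ++ [b]) * h.poly else 0 := by
  have h1 : ∀ (v : Alt m) (g : List (Alt m) → (BordAlg m)[X]), mulTerms g (z ++ [b, v]) =
      sumPair (fun x c d y => if c.Comp d then g (x ++ c.mul d :: y ++ [v]) else 0) (z ++ [b]) +
      (if b.Comp v then g (z ++ [b.mul v]) else 0) := by
    intro v g
    rw [mulTerms, sumPair_concat_concat]
    simp only [List.append_assoc, List.cons_append]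
  have h3 : sumPair (fun x c d y => if c.Comp d then extR f (x ++ c.mul d :: y ++ [h]) else 0)
      (z ++ [b]) = h.splitSum fun u v => sumPair (fun x c d y =>
        if c.Comp d then f (x ++ c.mul d :: y ++ [u]) else 0) (z ++ [b]) * v.poly := by
    simp only [sumPair_mul]
    rw [← sumPair_splitSum]
    refine sumPair_congr fun x c d y _ => ?_
    split_ifs
    · exact extR_concat _ _ _
    · exact (Alt.splitSum_eq_zero fun _ _ _ _ => zero_mul _).symm
  have e2 : ∀ c : Alt m, z ++ [b, c] = (z ++ [b]) ++ [c] := by simp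
  have h4 : extR (mulTerms f) (z ++ [b, h]) =
      (h.splitSum fun u v => sumPair (fun x c d y =>
        if c.Comp d then f (x ++ c.mul d :: y ++ [u]) else 0) (z ++ [b]) * v.poly) +
      h.splitSum fun u v => (if b.Comp h then f (z ++ [b.mul u]) else 0) * v.poly := by
    rw [← Alt.splitSum_add, e2, extR_concat]
    refine Alt.splitSum_congr fun u v hc e => ?_
    rw [← e2, h1, add_mul]
    congr 2
    rw [← e]
    exact if_congr Iff.rfl rfl rfl
  have core : (if b.Comp h then extR f (z ++ [b.mul h]) else 0) =
      (h.splitSum fun u v => (if b.Comp h then f (z ++ [b.mul u]) else 0) * v.poly) +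
        extR f (z ++ [b]) * h.poly + if b.Comp h then f (z ++ [b]) * h.poly else 0 := by
    by_cases hc : b.Comp h
    · simp only [if_pos hc]
      rw [extR_concat, Alt.splitSum_mul hc, extR_concat, Alt.splitSum_mul_right, add_comm,
        ← add_assoc]
      congr 2
      refine Alt.splitSum_congr fun u v hc' e => ?_
      have : v.Comp h := by rwa [Alt.comp_iff_of_mul hc' e] at hc
      rw [mul_assoc, Alt.poly_mul_poly hm, if_pos this]
    · simp only [if_neg hc, zero_mul, add_zero]
      rw [Alt.splitSum_eq_zero fun _ _ _ _ => rfl, zero_add, extR_concat,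
        Alt.splitSum_mul_right, Alt.splitSum_eq_zero]
      intro u v hc' e
      have : ¬ v.Comp h := by rwa [Alt.comp_iff_of_mul hc' e] at hc
      rw [mul_assoc, Alt.poly_mul_poly hm, if_neg this, mul_zero]
  rw [h1, h3, h4, core]
  abel

instance : DecidableEq (Arrow m) := Classical.decEq _

/-! ### The exchange identity for two pure elements -/

lemma Arrow.cont_injective : Function.Injective (Arrow.cont : Arrow m → Arrow m) :=
  Function.LeftInverse.injective Arrow.cont_cont

lemma Arrow.cont_iterate_eq_iff {p q : Arrow m} {i j k l : ℕ} (h : i + l = j + k) :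
    cont^[i] p = cont^[j] q ↔ cont^[k] p = cont^[l] q := by
  have key : ∀ n : ℕ, cont^[n] p = cont^[n] q ↔ p = q := fun n =>
    (cont_injective.iterate n).eq_iff
  have hpar : ∀ (n : ℕ) (r : Arrow m), cont^[2 * n] r = r := by
    intro n r
    rw [Function.iterate_mul, show cont^[2] = (id : Arrow m → Arrow m) from funext cont_cont,
      Function.iterate_id]
    rfl
  have hshift : ∀ i j : ℕ, cont^[i] p = cont^[j] q ↔ cont^[i + j] p = q := by
    intro i j
    rw [← (cont_injective.iterate j).eq_iff, ← Function.iterate_add_apply,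
      ← Function.iterate_add_apply, ← two_mul, hpar, add_comm]
  rw [hshift, hshift]
  obtain ⟨n, hn⟩ : ∃ n : ℕ, i + j + 2 * n = k + l ∨ k + l + 2 * n = i + j := by
    rcases le_total i k with hik | hik
    · exact ⟨k - i, by omega⟩
    · exact ⟨i - k, by omega⟩
  rcases hn with hn | hn
  · rw [← hn, Function.iterate_add_apply _ (i + j), hpar]
  · rw [← hn, Function.iterate_add_apply _ (k + l), hpar]

/-- Both sides are the sum of `g x * y` over the pairs of alternating words `x` and `y` that have
together as many letters as `a` and `b`, such that `x` begins like `b` and ends like `a`, and `y`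
begins like `a`.  On the left the pairs are sorted by whether `x` is shorter than, as long as, or
longer than `b`; on the right `x` is compared with `a`. -/
lemma exchange (hm : 3 ≤ m) (g : Alt m → (BordAlg m)[X]) (a b : Alt m) :
    (b.splitSum fun u v => g u * (a.poly * v.poly)) +
        (if a.last = b.last then g b * a.poly else 0) +
        (a.splitSum fun u v => if b.Comp v then g (b.mul v) * u.poly else 0) =
      (a.splitSum fun u v => g v * (u.poly * b.poly)) +
        (if a.first = b.first then g a * b.poly else 0) +
        b.splitSum fun u v => if u.Comp a then g (u.mul a) * v.poly else 0 := by
  obtain ⟨p, k⟩ := a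
  obtain ⟨q, l⟩ := b
  -- the term of the pair in which `x` has `i + 1` letters
  let T : ℕ → (BordAlg m)[X] := fun i =>
    if Arrow.cont^[k + 1] p = Arrow.cont^[i + 1] q then
      g ⟨q, i⟩ * Alt.poly ⟨p, k + l - i⟩ else 0
  have hL : ∑ i ∈ Finset.range (l + 1 + k), T i =
      ∑ i ∈ Finset.range (k + 1 + l), T i := by
    rw [show l + 1 + k = k + 1 + l by omega]
  rw [Finset.sum_range_add, Finset.sum_range_succ, Finset.sum_range_add,
    Finset.sum_range_succ] at hL
  rw [← Finset.sum_range_reflect _ k] at hL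
  rw [← Finset.sum_range_reflect (fun i => T i) k] at hL
  refine Eq.trans ?_ (hL.trans ?_)
  · refine congrArg₂ _ (congrArg₂ _ ?_ ?_) ?_
    · refine Finset.sum_congr rfl fun i hi => ?_
      have hi : i < l := Finset.mem_range.1 hi
      beta_reduce
      rw [Alt.poly_mul_poly hm, mul_ite, mul_zero]
      refine if_congr ?_ ?_ rfl
      · simp only [Alt.Comp, Alt.last]
        rw [eq_comm, ← Function.iterate_succ_apply' Arrow.cont]
      · exact congrArg (fun n => g ⟨q, i⟩ * Alt.poly ⟨p, n⟩) (by simp only; omega)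
    · refine if_congr (Arrow.cont_iterate_eq_iff (by simp only; omega)) ?_ rfl
      exact congrArg (fun n => g ⟨q, l⟩ * Alt.poly ⟨p, n⟩) (by omega)
    · refine Finset.sum_congr rfl fun i hi => ?_
      have hi : i < k := Finset.mem_range.1 hi
      refine if_congr (Q := Arrow.cont^[k + 1] p = Arrow.cont^[l + 1 + (k - 1 - i) + 1] q)
        ?_ ?_ rfl
      · simp only [Alt.Comp, Alt.last]
        rw [← Function.iterate_succ_apply' Arrow.cont]
        exact Arrow.cont_iterate_eq_iff (by omega)
      · exact congrArg₂ (fun n n' => g ⟨q, n⟩ * Alt.poly ⟨p, n'⟩) (by simp only; omega)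
          (by omega)
  · symm
    refine congrArg₂ _ (congrArg₂ _ ?_ ?_) ?_
    · refine Finset.sum_congr rfl fun i hi => ?_
      have hi : i < k := Finset.mem_range.1 hi
      beta_reduce
      rw [Alt.poly_mul_poly hm, mul_ite, mul_zero]
      have hc : Alt.Comp ⟨p, i⟩ ⟨q, l⟩ ↔ q = Arrow.cont^[i + 1] p := by
        rw [Function.iterate_succ_apply']
        rfl
      by_cases h : q = Arrow.cont^[i + 1] p
      · have h' : Arrow.cont^[k + 1] p = Arrow.cont^[k - 1 - i + 1] q :=
          (Arrow.cont_iterate_eq_iff (i := 0) (j := i + 1) (by omega)).1 h |>.symm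
        refine (if_pos (hc.2 h)).trans ?_
        refine Eq.trans ?_ (if_pos h').symm
        simp only [Alt.mul]
        rw [← h]
        exact congrArg (fun n => g ⟨q, k - 1 - i⟩ * Alt.poly ⟨p, n⟩) (by omega)
      · refine (if_neg fun h' => h (hc.1 h')).trans ?_
        refine (if_neg fun h' => h ?_).symm
        exact (Arrow.cont_iterate_eq_iff (i := 0) (j := i + 1) (by omega)).2 h'.symm
    · refine Eq.trans ?_ (if_congr (P := p = q)
        (Arrow.cont_iterate_eq_iff (i := 0) (j := 0) (by omega)) rfl rfl)
      by_cases h : p = q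
      · subst h
        rw [if_pos rfl, if_pos rfl, Nat.add_sub_cancel_left]
      · rw [if_neg h, if_neg h]
    · refine Finset.sum_congr rfl fun i hi => ?_
      have hi : i < l := Finset.mem_range.1 hi
      have hc : Alt.Comp ⟨q, i⟩ ⟨p, k⟩ ↔ p = Arrow.cont^[i + 1] q := by
        rw [Function.iterate_succ_apply']
        rfl
      by_cases h : p = Arrow.cont^[i + 1] q
      · have h' : Arrow.cont^[k + 1] p = Arrow.cont^[k + 1 + i + 1] q :=
          (Arrow.cont_iterate_eq_iff (i := 0) (j := i + 1) (by omega)).1 h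
        refine (if_pos (hc.2 h)).trans ?_
        refine Eq.trans ?_ (if_pos h').symm
        simp only [Alt.mul]
        rw [← h, show i + k + 1 = k + 1 + i by omega,
          show l - 1 - i = k + l - (k + 1 + i) by omega]
      · refine (if_neg fun h' => h (hc.1 h')).trans ?_
        refine (if_neg fun h' => h ?_).symm
        exact (Arrow.cont_iterate_eq_iff (i := 0) (j := i + 1) (by omega)).2 h'

/-! ### The relation on pure elements -/

/-- The tree-counting operation: centered, left-extended and right-extended contributions. -/
def treeOp (l : List (Alt m)) : (BordAlg m)[X] := cent l + extL cent l + extR cent l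

lemma mulTerms_treeOp (l : List (Alt m)) : mulTerms treeOp l =
    mulTerms cent l + mulTerms (extL cent) l + mulTerms (extR cent) l := by
  unfold mulTerms
  rw [← sumPair_add, ← sumPair_add]
  refine sumPair_congr fun x a b z _ => ?_
  split_ifs
  · rfl
  · rw [add_zero, add_zero]

lemma leftTerms_treeOp (l : List (Alt m)) : leftTerms treeOp l =
    leftTerms cent l + leftTerms (extL cent) l + leftTerms (extR cent) l := by
  simp only [leftTerms, treeOp, add_mul, sumSplit_add, sumElt_add]

lemma rightTerms_treeOp (l : List (Alt m)) : rightTerms treeOp l =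
    rightTerms cent l + rightTerms (extL cent) l + rightTerms (extR cent) l := by
  simp only [rightTerms, treeOp, add_mul, sumSplit_add, sumElt_add]

lemma leftEndTerms_treeOp (l : List (Alt m)) : leftEndTerms treeOp l =
    leftEndTerms cent l + leftEndTerms (extL cent) l + leftEndTerms (extR cent) l := by
  simp only [leftEndTerms, treeOp, add_mul, sumSplit_add]

lemma rightEndTerms_treeOp (l : List (Alt m)) : rightEndTerms treeOp l =
    rightEndTerms cent l + rightEndTerms (extL cent) l + rightEndTerms (extR cent) l := by
  simp only [rightEndTerms, treeOp, add_mul, sumSplit_add]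

/-- Two trees glued along an edge of the first region, left-extended there, form one tree. -/
lemma extL_leftEndTerms_cent (hm : 3 ≤ m) (a b : Alt m) (l : List (Alt m)) :
    extL (leftEndTerms cent) (a :: l ++ [b]) =
      a.splitSum fun u v => if b.Comp v then cbar (b.mul v :: l) * u.poly else 0 := by
  rw [List.cons_append, extL_cons]
  refine Alt.splitSum_congr fun u v hc _ => ?_
  rw [leftEndTerms, sumSplit_cons, sumSplit_concat, Alt.splitSum_eq_zero (a := v),
    Alt.splitSum_eq_zero (a := b), zero_add, add_zero]
  · have h := congrArg (· * u.poly) (cbar_cut hm b v l)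
    simp only [ite_mul, zero_mul] at h
    rw [h, mul_sumSplit, sumSplit_mul]
    refine sumSplit_congr fun x y _ => ?_
    rw [← mul_assoc, poly_mul_cent hc.tgt_eq, cbar_append_comm hm y [b], mul_assoc,
      ← cbar_comm ([b] ++ y), ← mul_assoc, ← cbar_comm (v :: x)]
    rfl
  · intro _ w _ _
    rw [cbar_of_length hm (l := [w]) (by simp), mul_zero]
  · intro w _ _ _
    rw [cent_of_length hm (l := [w]) (by simp), zero_mul]

lemma extR_rightEndTerms_cent (hm : 3 ≤ m) (a b : Alt m) (l : List (Alt m)) :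
    extR (rightEndTerms cent) (a :: l ++ [b]) =
      b.splitSum fun u v => if u.Comp a then cbar (u.mul a :: l) * v.poly else 0 := by
  rw [extR_concat]
  refine Alt.splitSum_congr fun u v hc _ => ?_
  rw [List.cons_append, rightEndTerms, sumSplit_cons, sumSplit_concat,
    Alt.splitSum_eq_zero (a := a), Alt.splitSum_eq_zero (a := u), zero_add, add_zero]
  · have h := congrArg (· * v.poly) (cbar_cut hm u a l)
    simp only [ite_mul, zero_mul] at h
    rw [h, sumSplit_mul, sumSplit_mul]
    refine sumSplit_congr fun x y _ => ?_
    rw [← poly_mul_cbar_comm, cent_mul_poly hm hc.tgt_eq, cbar_append_comm hm y [u],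
      poly_mul_cbar_comm]
    rfl
  · intro _ w _ _
    rw [cent_of_length hm (l := [w]) (by simp), zero_mul]
  · intro w _ _ _
    rw [cbar_of_length hm (l := [w]) (by simp), mul_zero]

/-- A pure element `a` that ends at the root of a tree either continues into the first region, and
then the two terms cancel, or ends with the same letter as the last region. -/
lemma poly_mul_cent_add (hm : 3 ≤ m) (a b c : Alt m) (l : List (Alt m)) :
    (a.poly * cent (c :: l ++ [b]) + if a.Comp c then a.poly * cent (c :: l ++ [b]) else 0) =
      if a.last = b.last then cbar (b :: c :: l) * a.poly else 0 := by
  by_cases h : Cent (c :: l ++ [b])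
  · have h1 : c.first = b.last.rot := h.closed_concat hm
    have h3 := cbar_append_comm hm [b] (c :: l)
    rw [List.singleton_append] at h3
    by_cases hab : a.last = b.last
    · have h2 : ¬ a.Comp c := by
        rw [Alt.Comp, h1, ← hab]
        exact (Arrow.cont_ne_rot hm _).symm
      rw [if_neg h2, if_pos hab, add_zero, List.cons_append,
        poly_mul_cent (by rw [h1, Arrow.src_rot, hab]), ← List.cons_append, h3]
    · rw [if_neg hab]
      by_cases h2 : a.Comp c
      · rw [if_pos h2, poly_add_self]
      · rw [if_neg h2, add_zero, cent, ← mul_assoc, Alt.poly_mul_idem, if_neg, zero_mul]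
        intro h4
        rcases Arrow.eq_cont_or_rot (a := a.last) (b := c.first) h4 with h5 | h5
        · exact h2 h5
        · exact hab (Arrow.rot_injective (h5.symm.trans h1))
  · have h0 : cbar (b :: c :: l) = 0 := by
      refine cbar_of_not fun h' => h ?_
      exact Cent.rotate hm (x := [b]) h'
    rw [cent, cbar_of_not h, mul_zero, mul_zero, h0, zero_mul]
    simp

lemma cent_mul_poly_add (hm : 3 ≤ m) (a b c : Alt m) (l : List (Alt m)) :
    (cent (a :: l ++ [c]) * b.poly + if c.Comp b then cent (a :: l ++ [c]) * b.poly else 0) =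
      if a.first = b.first then cbar (a :: l ++ [c]) * b.poly else 0 := by
  by_cases h : Cent (a :: l ++ [c])
  · have h1 : a.first = c.last.rot := h.closed_concat hm
    by_cases hab : a.first = b.first
    · have h2 : ¬ c.Comp b := by
        rw [Alt.Comp, ← hab, h1]
        exact (Arrow.cont_ne_rot hm _).symm
      rw [if_neg h2, if_pos hab, add_zero,
        cent_mul_poly hm (by rw [← hab, h1, Arrow.src_rot])]
    · rw [if_neg hab]
      by_cases h2 : c.Comp b
      · rw [if_pos h2, poly_add_self]
      · rw [if_neg h2, add_zero, cent, ← cbar_comm, mul_assoc, Alt.idem_mul_poly, if_neg,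
          mul_zero]
        intro h4
        have h4 : c.last.tgt = b.first.src := by rw [← Arrow.src_rot, ← h1]; exact h4
        rcases Arrow.eq_cont_or_rot h4 with h5 | h5
        · exact h2 h5
        · exact hab (h1.trans h5.symm)
  · rw [cent, cbar_of_not h, mul_zero, zero_mul]
    simp

/-- The `A∞`-relation on sequences of at least two pure elements.  The compositions of two
tree-counting operations are written as in `leftTerms`, `leftEndTerms`, `rightTerms` and
`rightEndTerms`. -/
theorem treeOp_relation (hm : 3 ≤ m) (a b : Alt m) (l : List (Alt m)) :
    mulTerms treeOp (a :: l ++ [b]) + leftTerms treeOp (a :: l ++ [b]) +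
      leftEndTerms treeOp (a :: l ++ [b]) + rightTerms treeOp (a :: l ++ [b]) +
      rightEndTerms treeOp (a :: l ++ [b]) + a.poly * treeOp (l ++ [b]) +
      treeOp (a :: l) * b.poly = 0 := by
  obtain ⟨c, w, hcw⟩ : ∃ c w, l ++ [b] = c :: w :=
    List.exists_cons_of_ne_nil (by simp)
  obtain ⟨v, d, hvd⟩ : ∃ v d, a :: l = v ++ [d] := by
    rcases List.eq_nil_or_concat (a :: l) with h | ⟨v, d, h⟩
    · simp at h
    · exact ⟨v, d, by rw [h, List.concat_eq_append]⟩
  have eL : a :: l ++ [b] = a :: c :: w := by rw [List.cons_append, hcw]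
  have eR : a :: l ++ [b] = v ++ [d, b] := by rw [hvd]; simp
  -- centered operations followed by a product with an end of the sequence
  have hA : (a.poly * cent (l ++ [b]) + if a.Comp c then a.poly * cent (l ++ [b]) else 0) =
      if a.last = b.last then cbar (b :: l) * a.poly else 0 := by
    rcases l with _ | ⟨c', l⟩
    · rw [cent_of_length hm (by simp), cbar_of_length hm (by simp)]
      simp
    · obtain rfl : c' = c := (List.cons.inj hcw).1
      exact poly_mul_cent_add hm a b c' l
  have hB : (cent (a :: l) * b.poly + if d.Comp b then cent (a :: l) * b.poly else 0) =
      if a.first = b.first then cbar (a :: l) * b.poly else 0 := by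
    rcases List.eq_nil_or_concat l with rfl | ⟨l', d', rfl⟩
    · rw [cent_of_length hm (by simp), cbar_of_length hm (by simp)]
      simp
    · rw [List.concat_eq_append] at hvd ⊢
      obtain rfl : d' = d := by
        have := congrArg List.getLast? hvd
        rw [← List.cons_append, List.getLast?_concat, List.getLast?_concat] at this
        exact Option.some.inj this
      exact cent_mul_poly_add hm a b d' l'
  have hC : a.poly * extR cent (l ++ [b]) =
      b.splitSum fun u v => cbar (u :: l) * (a.poly * v.poly) := by
    rw [extR_concat, Alt.mul_splitSum]
    refine Alt.splitSum_congr fun u v hc _ => ?_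
    rw [cent_mul_poly hm hc.tgt_eq, ← mul_assoc, ← cbar_comm, mul_assoc, cbar_append_comm hm]
    rfl
  have hD : extL cent (a :: l) * b.poly =
      a.splitSum fun u v => cbar (v :: l) * (u.poly * b.poly) := by
    rw [extL_cons, Alt.splitSum_mul_right]
    refine Alt.splitSum_congr fun u v hc _ => ?_
    rw [poly_mul_cent hc.tgt_eq, mul_assoc]
  -- products taken first, inside extended operations
  have hL : mulTerms (extL cent) (a :: l ++ [b]) =
      rightTerms (extL cent) (a :: l ++ [b]) + leftTerms (extL cent) (a :: l ++ [b]) +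
        a.poly * extL cent (l ++ [b]) + if a.Comp c then a.poly * cent (l ++ [b]) else 0 := by
    rw [eL, mulTerms_extL hm, hcw, rightTerms_extL, leftTerms_extL]
    congr 2
    rw [extL_cons, extL_cons, extL_cons, ← Alt.splitSum_add]
    simp only [mulTerms_cent hm, mul_add]
  have hR : mulTerms (extR cent) (a :: l ++ [b]) =
      rightTerms (extR cent) (a :: l ++ [b]) + leftTerms (extR cent) (a :: l ++ [b]) +
        extR cent (a :: l) * b.poly + if d.Comp b then cent (a :: l) * b.poly else 0 := by
    rw [rightTerms_extR, leftTerms_extR, eR, mulTerms_extR hm, hvd]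
    congr 2
    rw [show v ++ [d, b] = v ++ [d] ++ [b] by simp, extR_concat, extR_concat, extR_concat,
      ← Alt.splitSum_add]
    simp only [mulTerms_cent hm, add_mul]
  have hE := exchange hm (fun x => cbar (x :: l)) a b
  rw [← hC, ← hD, ← hA, ← hB, ← extL_leftEndTerms_cent hm, ← extR_rightEndTerms_cent hm,
    List.cons_append, ← leftEndTerms_extL, ← List.cons_append, ← rightEndTerms_extR] at hE
  rw [mulTerms_treeOp, leftTerms_treeOp, rightTerms_treeOp, leftEndTerms_treeOp,
    rightEndTerms_treeOp, hL, hR, mulTerms_cent hm, leftEndTerms_cent hm,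
    rightEndTerms_extL_cent hm, treeOp, treeOp]
  simp only [mul_add, add_mul]
  -- up to the exchange identity `hE`, every term now occurs twice
  generalize extL cent (a :: l) * b.poly = x₁ at *
  generalize a.poly * extR cent (l ++ [b]) = x₂ at *
  generalize (if a.Comp c then a.poly * cent (l ++ [b]) else 0) = x₃ at *
  generalize (if d.Comp b then cent (a :: l) * b.poly else 0) = x₄ at *
  generalize a.poly * cent (l ++ [b]) = x₅ at *
  generalize cent (a :: l) * b.poly = x₆ at *
  generalize a.poly * extL cent (l ++ [b]) = x₇ at *
  generalize extR cent (a :: l) * b.poly = x₈ at *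
  generalize a :: l ++ [b] = s at *
  have h2 : (2 : ℤ) • (rightTerms cent s + leftTerms cent s + rightTerms (extL cent) s +
      leftTerms (extL cent) s + rightTerms (extR cent) s + leftTerms (extR cent) s +
      rightEndTerms cent s + leftEndTerms (extR cent) s + x₇ + x₈) = 0 := by
    rw [two_smul, poly_add_self]
  have h3 : (x₂ + (x₅ + x₃) + leftEndTerms (extL cent) s) +
      (x₁ + (x₆ + x₄) + rightEndTerms (extR cent) s) = 0 := by
    rw [hE, poly_add_self]
  rw [← add_zero (0 : (BordAlg m)[X])]
  nth_rewrite 1 [← h2]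
  rw [← h3]
  abel

/-! ### Counting tiling trees -/

lemma DecTree.cent_of_algSeq (hm : 3 ≤ m) {Γ : DecTree m} (hΓ : Γ.Compatible)
    {l : List (Alt m)} (h : Γ.algSeq = l.map Alt.elt) :
    Cent l ∧ Γ.contour = spell l ∧ Γ.edge.label = headSrc l := by
  rcases Γ.exists_parses hm hΓ with hc | ⟨w, hw, hc⟩
  · exfalso
    rw [DecTree.algSeq, hc] at h
    rcases l with _ | ⟨a, l⟩
    · simp [cutAtNone] at h
    · exact a.elt_ne_one (List.cons.inj h).1.symm
  · obtain ⟨a, l', ha, hl, rfl⟩ := exists_word_eq w Γ.edge.atFarEnd.sector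
    have hs : Γ.contour = spell (a :: l') := by rw [hc, ← ha, run_word hl]
    rw [algSeq_of_contour hs] at h
    obtain rfl := List.map_injective_iff.2 Alt.elt_injective h
    refine ⟨⟨hl, hw⟩, hs, ?_⟩
    rw [headSrc, ha, HalfEdge.src_sector, EdgeDec.label_atFarEnd]

lemma DecTree.eq_of_algSeq (hm : 3 ≤ m) {Γ Γ' : DecTree m} (hΓ : Γ.Compatible)
    (hΓ' : Γ'.Compatible) {l : List (Alt m)} (h : Γ.algSeq = l.map Alt.elt)
    (h' : Γ'.algSeq = l.map Alt.elt) : Γ = Γ' := by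
  have h1 := (cent_of_algSeq hm hΓ h).2.1
  have h1' := (cent_of_algSeq hm hΓ' h').2.1
  have hn : ∀ Γ : DecTree m, Γ.Compatible → Γ.algSeq = l.map Alt.elt →
      Γ.contour.head? = some (some Γ.edge.atFarEnd.sector) := by
    intro Γ hΓ h
    rcases Γ with e | ⟨e, child⟩
    · exfalso
      rcases l with _ | ⟨a, l⟩
      · simp [algSeq, contour, cutAtNone] at h
      · exact a.elt_ne_one (List.cons.inj h).1.symm
    · rfl
  have h2 := hn Γ hΓ h
  rw [h1, ← h1', hn Γ' hΓ' h'] at h2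
  have h3 := HalfEdge.sector_injective (Option.some.inj (Option.some.inj h2))
  have h4 : Γ.edge = Γ'.edge := by
    apply EdgeDec.atNearEnd_injective
    rw [← HalfEdge.flip_flip Γ.edge.atNearEnd, ← EdgeDec.atFarEnd_eq, ← h3, EdgeDec.atFarEnd_eq,
      HalfEdge.flip_flip]
  exact (contour_cancel Γ Γ' hΓ hΓ' h4 [] [] (by rw [h1, h1'])).1

lemma Cent.exists_tree (hm : 3 ≤ m) {l : List (Alt m)} (h : Cent l) :
    ∃ Γ : DecTree m, Γ.Compatible ∧ Γ.algSeq = l.map Alt.elt := by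
  rcases l with _ | ⟨a, l⟩
  · have := h.four_le_length hm
    simp at this
  · obtain ⟨child, h1, h2⟩ := h.2.exists_trees hm a.first
    have hf : (EdgeDec.ofNearEnd (HalfEdge.ofArrow a.first).flip).atFarEnd =
        .ofArrow a.first := by
      rw [EdgeDec.atFarEnd_eq, EdgeDec.atNearEnd_ofNearEnd, HalfEdge.flip_flip]
    refine ⟨.node (.ofNearEnd (HalfEdge.ofArrow a.first).flip) child, fun j => ⟨?_, (h1 j).2⟩,
      algSeq_of_contour ?_⟩
    · apply HalfEdge.sector_injective
      rw [(h1 j).1, ← HalfEdge.rot_iterate_sector, hf, HalfEdge.sector_ofArrow]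
    · rw [← run_word h.1, h2, DecTree.contour, hf, HalfEdge.sector_ofArrow]

/-- A tiling tree is determined by its algebra sequence, so that the centered contribution has at
most one summand. -/
lemma centered_map_elt (hm : 3 ≤ m) (l : List (Alt m)) :
    centered (l.map Alt.elt) = cent l := by
  by_cases h : Cent l
  · obtain ⟨Γ, hΓ, hs⟩ := h.exists_tree hm
    rw [centered, finsum_eq_single _ ⟨Γ, hΓ, hs⟩]
    · obtain ⟨-, h1, h2⟩ := DecTree.cent_of_algSeq hm hΓ hs
      have h3 := Γ.countP_isNone hm
      rw [h1, countP_isNone_spell] at h3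
      rw [cent, h2, cbar, if_pos h]
      congr 2
      rw [show l.length - 2 = Γ.numVertices * (2 * m - 4) by omega,
        Nat.mul_div_cancel _ (by omega)]
    · rintro ⟨Γ', hΓ', hs'⟩ hne
      exact absurd (Subtype.ext (DecTree.eq_of_algSeq hm hΓ' hΓ hs' hs)) hne
  · rw [cent, cbar_of_not h, mul_zero]
    have : IsEmpty {Γ : DecTree m // Γ.Compatible ∧ Γ.algSeq = l.map Alt.elt} :=
      ⟨fun Γ => h (DecTree.cent_of_algSeq hm Γ.2.1 Γ.2.2).1⟩
    exact finsum_of_isEmpty _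

/-- The factorizations of a pure element into pure elements. -/
lemma finsum_factorization (hm : 3 ≤ m) (a : Alt m)
    (F : PurePath m → PurePath m → (BordAlg m)[X]) :
    ∑ᶠ q : {q : PurePath m × PurePath m // q.1.elt * q.2.elt = a.toPure.elt}, F q.1.1 q.1.2 =
      a.splitSum fun b c => F b.toPure c.toPure := by
  let e : Fin a.extra → {q : PurePath m × PurePath m // q.1.elt * q.2.elt = a.toPure.elt} :=
    fun i => ⟨(Alt.toPure ⟨a.first, i⟩,
      Alt.toPure ⟨Arrow.cont^[i + 1] a.first, a.extra - 1 - i⟩), by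
      have := Alt.comp_split i.2
      exact (Alt.elt_mul_elt_of_comp this.1).trans (congrArg Alt.elt this.2)⟩
  have he : Function.Bijective e := by
    constructor
    · intro i j h
      have h1 := Alt.toPure_injective (congrArg (fun q => q.1.1) h)
      exact Fin.ext (congrArg Alt.extra h1)
    · rintro ⟨⟨p, q⟩, h⟩
      obtain ⟨b, rfl⟩ := Alt.toPure_surjective hm p
      obtain ⟨c, rfl⟩ := Alt.toPure_surjective hm q
      have hc : b.Comp c := by
        by_contra hc
        have h0 : (0 : BordAlg m) = a.elt := (Alt.elt_mul_elt_of_not_comp hm hc).symm.trans h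
        have := congrArg pureCoord h0
        rw [pureCoord_zero, Alt.elt, pureCoord_elt] at this
        exact one_ne_zero (Finsupp.single_eq_zero.1 this.symm)
      have h1 : (b.mul c).elt = a.elt := (Alt.elt_mul_elt_of_comp hc).symm.trans h
      obtain ⟨h2, h3, h4⟩ := Alt.exists_split hc (Alt.elt_injective h1)
      refine ⟨⟨b.extra, h2⟩, Subtype.ext (Prod.ext ?_ ?_)⟩
      · exact congrArg Alt.toPure h3.symm
      · exact congrArg Alt.toPure h4.symm
  rw [← finsum_eq_of_bijective (f := fun i => F (e i).1.1 (e i).1.2) e he fun _ => rfl,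
    finsum_eq_sum_of_fintype, Alt.splitSum, Finset.sum_range]

/-- The operations on pure elements in terms of alternating words. -/
lemma pureOp_map_toPure (hm : 3 ≤ m) (l : List (Alt m)) :
    pureOp (l.map Alt.toPure) = treeOp l := by
  have hmap : ∀ l : List (Alt m), (l.map Alt.toPure).map PurePath.elt = l.map Alt.elt := by
    intro l
    rw [List.map_map]
    rfl
  have hc : ∀ l : List (Alt m), centered (l.map fun a => a.toPure.elt) = cent l :=
    centered_map_elt hm
  rw [pureOp, treeOp, hmap, centered_map_elt hm]
  congr 2
  · rcases l with _ | ⟨a, l⟩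
    · rfl
    · rw [List.map_cons, leftExtended, hmap]
      refine (finsum_factorization hm a
        (fun p q => C p.elt * centered (q.elt :: l.map Alt.elt))).trans ?_
      exact Alt.splitSum_congr fun b c _ _ => congrArg (_ * ·) (hc (c :: l))
  · rcases List.eq_nil_or_concat l with rfl | ⟨l, a, rfl⟩
    · rfl
    · rw [List.concat_eq_append, List.map_append, List.map_cons, List.map_nil, rightExtended,
        List.getLast?_concat]
      simp only [List.dropLast_concat, hmap]
      refine (finsum_factorization hm a
        (fun p q => centered (l.map Alt.elt ++ [p.elt]) * C q.elt)).trans ?_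
      rw [extR_concat]
      refine Alt.splitSum_congr fun b c _ _ => congrArg (· * c.poly) ?_
      rw [← hc, List.map_append]
      rfl

lemma exists_map_toPure (hm : 3 ≤ m) (ps : List (PurePath m)) :
    ∃ l : List (Alt m), l.map Alt.toPure = ps :=
  List.map_surjective_iff.2 (Alt.toPure_surjective hm) ps

/-! ### Source and target of the operations -/

lemma treeOp_of_length (hm : 3 ≤ m) {l : List (Alt m)} (h : l.length < 4) : treeOp l = 0 := by
  have h1 : extL cent l = 0 := by
    rcases l with _ | ⟨a, l⟩
    · rfl
    · rw [extL_cons]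
      exact Alt.splitSum_eq_zero fun b c _ _ => by
        rw [cent_of_length hm (l := c :: l) h, mul_zero]
  have h2 : extR cent l = 0 := by
    rcases List.eq_nil_or_concat l with rfl | ⟨l, a, rfl⟩
    · rfl
    · rw [List.concat_eq_append, extR_concat]
      exact Alt.splitSum_eq_zero fun b c _ _ => by
        rw [cent_of_length hm (by simpa using h), zero_mul]
  rw [treeOp, cent_of_length hm h, h1, h2, add_zero, add_zero]

lemma idem_mul_cent (l : List (Alt m)) : C (idem (headSrc l)) * cent l = cent l := by
  rw [cent, ← mul_assoc, ← C_mul, idem_mul_idem, if_pos rfl]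

lemma cent_mul_idem (hm : 3 ≤ m) (l : List (Alt m)) (a : Alt m) :
    cent (l ++ [a]) * C (idem a.last.tgt) = cent (l ++ [a]) := by
  rw [cent, ← cbar_comm, mul_assoc]
  refine cbar_congr_of_last hm fun e => ?_
  rw [e, ← C_mul, idem_mul_idem, if_pos rfl]

lemma idem_mul_treeOp (hm : 3 ≤ m) (a : Alt m) (l : List (Alt m)) :
    C (idem a.first.src) * treeOp (a :: l) = treeOp (a :: l) := by
  rw [treeOp, mul_add, mul_add]
  congr 2
  · exact idem_mul_cent (a :: l)
  · rw [extL_cons, Alt.mul_splitSum]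
    refine Alt.splitSum_congr fun b c _ h => ?_
    rw [← mul_assoc, Alt.idem_mul_poly, if_pos (by rw [← h]; rfl)]
  · rcases List.eq_nil_or_concat l with rfl | ⟨l, b, rfl⟩
    · rw [← List.nil_append [a], extR_concat, Alt.splitSum_eq_zero, mul_zero]
      intro b c _ _
      rw [cent_of_length hm (by simp), zero_mul]
    · rw [List.concat_eq_append, ← List.cons_append, extR_concat, Alt.mul_splitSum]
      refine Alt.splitSum_congr fun b c _ h => ?_
      rw [← mul_assoc]
      exact congrArg (· * c.poly) (idem_mul_cent (a :: l ++ [b]))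

lemma treeOp_mul_idem (hm : 3 ≤ m) (a : Alt m) (l : List (Alt m)) :
    treeOp (l ++ [a]) * C (idem a.last.tgt) = treeOp (l ++ [a]) := by
  rw [treeOp, add_mul, add_mul]
  congr 2
  · exact cent_mul_idem hm l a
  · rcases l with _ | ⟨b, l⟩
    · rw [List.nil_append, extL_cons, Alt.splitSum_eq_zero, zero_mul]
      intro b c _ _
      rw [cent_of_length hm (by simp), mul_zero]
    · rw [List.cons_append, extL_cons, Alt.splitSum_mul_right]
      refine Alt.splitSum_congr fun b c _ h => ?_
      rw [mul_assoc]
      exact congrArg (b.poly * ·) (cent_mul_idem hm (c :: l) a)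
  · rw [extR_concat, Alt.splitSum_mul_right]
    refine Alt.splitSum_congr fun b c hc h => ?_
    rw [mul_assoc, Alt.poly_mul_idem, if_pos (by rw [← h, Alt.last_mul hc])]

lemma cent_of_tgt_ne {a b : Alt m} (h : a.last.tgt ≠ b.first.src) (x z : List (Alt m)) :
    cent (x ++ a :: b :: z) = 0 := by
  rw [cent, cbar_of_not, mul_zero]
  intro hc
  have h1 : a.Follows b := (List.isChain_cons_cons.1 (List.isChain_append.1 hc.1).2.1).1
  rw [h1, Arrow.src_rot] at h
  exact h rfl

/-- The operations vanish unless neighbouring entries are composable. -/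
lemma treeOp_of_tgt_ne {a b : Alt m} (h : a.last.tgt ≠ b.first.src)
    (x z : List (Alt m)) : treeOp (x ++ a :: b :: z) = 0 := by
  rw [treeOp, cent_of_tgt_ne h, zero_add]
  have h1 : extL cent (x ++ a :: b :: z) = 0 := by
    rcases x with _ | ⟨c, x⟩
    · rw [List.nil_append, extL_cons]
      refine Alt.splitSum_eq_zero fun u v hc e => ?_
      rw [← e, Alt.last_mul hc] at h
      have := cent_of_tgt_ne h [] z
      rw [List.nil_append] at this
      rw [this, mul_zero]
    · rw [List.cons_append, extL_cons]
      refine Alt.splitSum_eq_zero fun u v hc e => ?_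
      have := cent_of_tgt_ne h (v :: x) z
      rw [List.cons_append] at this
      rw [this, mul_zero]
  have h2 : extR cent (x ++ a :: b :: z) = 0 := by
    rcases List.eq_nil_or_concat z with rfl | ⟨z, c, rfl⟩
    · rw [show x ++ [a, b] = (x ++ [a]) ++ [b] by simp, extR_concat]
      refine Alt.splitSum_eq_zero fun u v hc e => ?_
      rw [show x ++ [a] ++ [u] = x ++ a :: u :: [] by simp, cent_of_tgt_ne, zero_mul]
      rw [← e] at h
      exact h
    · rw [List.concat_eq_append, show x ++ a :: b :: (z ++ [c]) = (x ++ a :: b :: z) ++ [c] by simp,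
        extR_concat]
      refine Alt.splitSum_eq_zero fun u v hc e => ?_
      rw [show x ++ a :: b :: z ++ [u] = x ++ a :: b :: (z ++ [u]) by simp, cent_of_tgt_ne h,
        zero_mul]
  rw [h1, h2, add_zero]

/-! ### Multilinear extension -/

/-- The additive maps that commute with multiplication by powers of `t`. -/
def tLinear (m : ℕ) : AddSubmonoid ((BordAlg m)[X] → (BordAlg m)[X]) where
  carrier := {φ | (∀ f g, φ (f + g) = φ f + φ g) ∧ ∀ f e, φ (f * X ^ e) = φ f * X ^ e}
  zero_mem' := ⟨fun _ _ => (add_zero _).symm, fun _ _ => (zero_mul _).symm⟩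
  add_mem' {φ ψ} hφ hψ := ⟨fun f g => by
      simp only [Pi.add_apply, hφ.1, hψ.1]
      abel, fun f e => by simp only [Pi.add_apply, hφ.2, hψ.2, add_mul]⟩

namespace tLinear

variable {φ ψ : (BordAlg m)[X] → (BordAlg m)[X]}

lemma map_zero (h : φ ∈ tLinear m) : φ 0 = 0 := by
  have := h.1 0 0
  rw [add_zero] at this
  exact left_eq_add.1 this

lemma map_mul_cbar (h : φ ∈ tLinear m) (f : (BordAlg m)[X]) (l : List (Alt m)) :
    φ (f * cbar l) = φ f * cbar l := by
  unfold cbar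
  split_ifs
  · exact h.2 _ _
  · rw [mul_zero, mul_zero, map_zero h]

lemma map_finset_sum (h : φ ∈ tLinear m) {ι : Type*} (s : Finset ι) (f : ι → (BordAlg m)[X]) :
    φ (∑ i ∈ s, f i) = ∑ i ∈ s, φ (f i) :=
  _root_.map_sum (⟨⟨φ, map_zero h⟩, h.1⟩ : (BordAlg m)[X] →+ (BordAlg m)[X]) f s

lemma comp (h : φ ∈ tLinear m) (h' : ψ ∈ tLinear m) : (fun a => φ (ψ a)) ∈ tLinear m :=
  ⟨fun f g => by beta_reduce; rw [h'.1, h.1], fun f e => by beta_reduce; rw [h'.2, h.2]⟩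

lemma const_mul (h : φ ∈ tLinear m) (r : (BordAlg m)[X]) : (fun a => r * φ a) ∈ tLinear m :=
  ⟨fun f g => by beta_reduce; rw [h.1, mul_add],
    fun f e => by beta_reduce; rw [h.2, mul_assoc]⟩

lemma mul_const (h : φ ∈ tLinear m) (r : (BordAlg m)[X]) : (fun a => φ a * r) ∈ tLinear m :=
  ⟨fun f g => by beta_reduce; rw [h.1, add_mul],
    fun f e => by beta_reduce; rw [h.2, mul_assoc, X_pow_mul, mul_assoc]⟩

lemma id : (fun a => a) ∈ tLinear m := ⟨fun _ _ => rfl, fun _ _ => rfl⟩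

lemma sum {ι : Type*} {s : Finset ι} {F : ι → (BordAlg m)[X] → (BordAlg m)[X]}
    (h : ∀ i ∈ s, F i ∈ tLinear m) : (fun a => ∑ i ∈ s, F i a) ∈ tLinear m := by
  have := sum_mem h
  rwa [show ∑ i ∈ s, F i = fun a => ∑ i ∈ s, F i a from funext fun a => Finset.sum_apply a s F]
    at this

/-- A map which is linear over the polynomials in `t` is determined by its values on idempotents
and alternating words. -/
lemma ext (hm : 3 ≤ m) (h : φ ∈ tLinear m) (h' : ψ ∈ tLinear m)
    (hidem : ∀ x, φ (C (idem x)) = ψ (C (idem x))) (hpoly : ∀ a : Alt m, φ a.poly = ψ a.poly)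
    (f : (BordAlg m)[X]) : φ f = ψ f := by
  induction f using Polynomial.induction_on' with
  | add f g hf hg => rw [h.1, h'.1, hf, hg]
  | monomial n c =>
    rw [← C_mul_X_pow_eq_monomial, h.2, h'.2]
    congr 1
    induction c using BordAlg.induction hm with
    | h0 => rw [C_0, map_zero h, map_zero h']
    | hadd x y hx hy => rw [C_add, h.1, h'.1, hx, hy]
    | hidem x => exact hidem x
    | helt a => exact hpoly a

end tLinear

lemma zmod_val_add_nsmul (s t : ZMod 2) (r : (BordAlg m)[X]) :
    (s + t).val • r = s.val • r + t.val • r := by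
  have h2 : ∀ s : ZMod 2, s = 0 ∨ s = 1 := by decide
  rcases h2 s with rfl | rfl <;> rcases h2 t with rfl | rfl
  · simp
  · simp
  · simp
  · rw [show (1 + 1 : ZMod 2) = 0 from rfl]
    simp [ZMod.val_one, poly_add_self]

section extend

variable (f : List (PurePath m) → (BordAlg m)[X])

lemma extend_cons_mem_tLinear (l : List (BordAlg m)[X]) :
    (fun a => extend f (a :: l)) ∈ tLinear m := by
  have h0 : ∀ e, ((pureCoord (0 : BordAlg m)).sum fun p s =>
      s.val • (extend (fun ps => f (p :: ps)) l * X ^ e)) = 0 := by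
    intro e
    rw [pureCoord_zero, Finsupp.sum_zero_index]
  have hadd : ∀ a b, extend f ((a + b) :: l) = extend f (a :: l) + extend f (b :: l) := by
    intro a b
    simp only [extend]
    refine Polynomial.sum_add_index _ _ _ h0 fun e c d => ?_
    rw [pureCoord_add]
    refine Finsupp.sum_add_index' (fun p => ?_) fun p s t => zmod_val_add_nsmul _ _ _
    rw [ZMod.val_zero, zero_smul]
  refine ⟨hadd, fun a e => ?_⟩
  induction a using Polynomial.induction_on' with
  | add a b ha hb =>
    beta_reduce at ha hb ⊢
    rw [add_mul, hadd, hadd, ha, hb, add_mul]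
  | monomial n c =>
    rw [monomial_mul_X_pow]
    simp only [extend]
    rw [Polynomial.sum_monomial_index _ _ (h0 _), Polynomial.sum_monomial_index _ _ (h0 _),
      Finsupp.sum, Finsupp.sum, Finset.sum_mul]
    refine Finset.sum_congr rfl fun p _ => ?_
    rw [pow_add, ← mul_assoc, smul_mul_assoc]

lemma extend_mem_tLinear (x z : List (BordAlg m)[X]) :
    (fun a => extend f (x ++ a :: z)) ∈ tLinear m := by
  induction x generalizing f with
  | nil => exact extend_cons_mem_tLinear f z
  | cons h x ih =>
    simp only [List.cons_append, extend, Polynomial.sum_def, Finsupp.sum]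
    exact tLinear.sum fun e _ => tLinear.sum fun p _ =>
      AddSubmonoid.nsmul_mem _ (tLinear.mul_const (ih _) _) _

lemma extend_C_elt_cons (p : PurePath m) (l : List (BordAlg m)[X]) :
    extend f (C p.elt :: l) = extend (fun ps => f (p :: ps)) l := by
  simp only [extend]
  rw [Polynomial.sum_C_index, pureCoord_elt, Finsupp.sum_single_index]
  · rw [ZMod.val_one, one_smul, pow_zero, mul_one]
  · rw [ZMod.val_zero, zero_smul]
  · rw [pureCoord_zero, Finsupp.sum_zero_index]

lemma extend_map (ps : List (PurePath m)) :
    extend f (ps.map fun p => C p.elt) = f ps := by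
  induction ps generalizing f with
  | nil => rfl
  | cons p ps ih => rw [List.map_cons, extend_C_elt_cons, ih]

lemma extend_of_pureCoord_eq_zero {c : BordAlg m} (hc : pureCoord c = 0)
    (x z : List (BordAlg m)[X]) : extend f (x ++ C c :: z) = 0 := by
  induction x generalizing f with
  | nil =>
    simp only [List.nil_append, extend]
    rw [Polynomial.sum_C_index, hc, Finsupp.sum_zero_index]
    rw [pureCoord_zero, Finsupp.sum_zero_index]
  | cons h x ih =>
    simp only [List.cons_append, extend, ih, zero_mul, smul_zero, Finsupp.sum,
      Finset.sum_const_zero, Polynomial.sum_def]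

lemma extend_congr {f g : List (PurePath m) → (BordAlg m)[X]} {l : List (BordAlg m)[X]}
    (h : ∀ ps, ps.length = l.length → f ps = g ps) : extend f l = extend g l := by
  induction l generalizing f g with
  | nil => exact h [] rfl
  | cons a l ih =>
    simp only [extend]
    have : ∀ p, extend (fun ps => f (p :: ps)) l = extend (fun ps => g (p :: ps)) l :=
      fun p => ih fun ps hps => h _ (by rw [List.length_cons, hps, List.length_cons])
    simp only [this]

lemma extend_zero (l : List (BordAlg m)[X]) :
    extend (fun _ => (0 : (BordAlg m)[X])) l = 0 := by
  induction l with
  | nil => rfl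
  | cons a l ih =>
    simp only [extend, ih, zero_mul, smul_zero, Finsupp.sum, Finset.sum_const_zero,
      Polynomial.sum_def]

lemma extend_const_mul (r : (BordAlg m)[X]) (l : List (BordAlg m)[X]) :
    extend (fun ps => r * f ps) l = r * extend f l := by
  induction l generalizing f with
  | nil => rfl
  | cons a l ih =>
    simp only [extend, ih, Finsupp.sum, Polynomial.sum_def, Finset.mul_sum, mul_smul_comm,
      mul_assoc]

/-- If `f` has a vanishing property that only concerns two neighbouring entries, so has its
multilinear extension. -/
lemma extend_append_of_eq_zero {p q : PurePath m}
    (h : ∀ xs zs, f (xs ++ p :: q :: zs) = 0) (x z : List (BordAlg m)[X]) :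
    extend f (x ++ C p.elt :: C q.elt :: z) = 0 := by
  induction x generalizing f with
  | nil =>
    rw [List.nil_append, extend_C_elt_cons, extend_C_elt_cons, ← extend_zero z]
    exact extend_congr fun ps _ => h [] ps
  | cons a x ih =>
    have hz : ∀ r, extend (fun ps => f (r :: ps)) (x ++ C p.elt :: C q.elt :: z) = 0 :=
      fun r => ih _ fun xs zs => h (r :: xs) zs
    simp only [List.cons_append, extend, hz, zero_mul, smul_zero, Finsupp.sum,
      Finset.sum_const_zero, Polynomial.sum_def]

lemma extend_concat_mul {p : PurePath m} {r : (BordAlg m)[X]}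
    (h : ∀ xs, f (xs ++ [p]) * r = f (xs ++ [p])) (x : List (BordAlg m)[X]) :
    extend f (x ++ [C p.elt]) * r = extend f (x ++ [C p.elt]) := by
  induction x generalizing f with
  | nil =>
    rw [List.nil_append, extend_C_elt_cons]
    exact h []
  | cons a x ih =>
    simp only [List.cons_append, extend, Finsupp.sum, Polynomial.sum_def, Finset.sum_mul]
    refine Finset.sum_congr rfl fun e _ => Finset.sum_congr rfl fun q _ => ?_
    have := ih (fun ps => f (q :: ps)) fun xs => h (q :: xs)
    rw [smul_mul_assoc, mul_assoc, X_pow_mul, ← mul_assoc, this]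

end extend

/-! ### The operations on the whole algebra -/

/-- The multilinear extension of the tree-counting operations. -/
def muTree (l : List (BordAlg m)[X]) : (BordAlg m)[X] := extend pureOp l

/-- The product of two elements, as an operation on sequences. -/
def prodTwo : List (BordAlg m)[X] → (BordAlg m)[X]
  | [a, b] => a * b
  | _ => 0

lemma muTree_map (hm : 3 ≤ m) (l : List (Alt m)) : muTree (l.map Alt.poly) = treeOp l := by
  rw [← pureOp_map_toPure hm, ← extend_map pureOp, List.map_map]
  rfl

lemma muTree_of_length (hm : 3 ≤ m) {l : List (BordAlg m)[X]} (h : l.length < 4) :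
    muTree l = 0 := by
  rw [← extend_zero l]
  refine extend_congr fun ps hps => ?_
  obtain ⟨l', rfl⟩ := exists_map_toPure hm ps
  rw [pureOp_map_toPure hm, treeOp_of_length hm]
  rw [← hps, List.length_map] at h
  exact h

lemma mu_eq (hm : 3 ≤ m) : ∀ l : List (BordAlg m)[X], mu l = muTree l + prodTwo l
  | [] => (add_zero _).symm
  | [_] => (add_zero _).symm
  | [a, b] => by
    rw [muTree_of_length hm (by simp), zero_add]
    rfl
  | _ :: _ :: _ :: _ => (add_zero _).symm

lemma muTree_mem_tLinear (x z : List (BordAlg m)[X]) :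
    (fun a => muTree (x ++ a :: z)) ∈ tLinear m := extend_mem_tLinear _ x z

lemma prodTwo_mem_tLinear (x z : List (BordAlg m)[X]) :
    (fun a => prodTwo (x ++ a :: z)) ∈ tLinear m := by
  rcases x with _ | ⟨b, _ | ⟨c, x⟩⟩
  · rcases z with _ | ⟨b, _ | ⟨c, z⟩⟩
    · exact zero_mem _
    · exact tLinear.mul_const tLinear.id b
    · exact zero_mem _
  · rcases z with _ | ⟨c, z⟩
    · exact tLinear.const_mul tLinear.id b
    · exact zero_mem _
  · rcases x with _ | ⟨d, x⟩ <;> exact zero_mem _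

lemma mu_mem_tLinear (hm : 3 ≤ m) (x z : List (BordAlg m)[X]) :
    (fun a => mu (x ++ a :: z)) ∈ tLinear m := by
  simp only [mu_eq hm]
  exact add_mem (muTree_mem_tLinear x z) (prodTwo_mem_tLinear x z)

lemma muTree_of_pureCoord_eq_zero {c : BordAlg m} (hc : pureCoord c = 0)
    {l : List (BordAlg m)[X]} (h : C c ∈ l) : muTree l = 0 := by
  obtain ⟨x, z, rfl⟩ := List.append_of_mem h
  exact extend_of_pureCoord_eq_zero _ hc x z

lemma muTree_idem_mul (hm : 3 ≤ m) (x : Vertex m) (a : (BordAlg m)[X])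
    (z : List (BordAlg m)[X]) : muTree (C (idem x) * a :: z) = C (idem x) * muTree (a :: z) := by
  have h := muTree_mem_tLinear [] z
  refine tLinear.ext hm (φ := fun a => muTree (C (idem x) * a :: z))
    (tLinear.comp h (tLinear.const_mul tLinear.id _)) (tLinear.const_mul h _) (fun y => ?_)
    (fun b => ?_) a
  · have h1 : ∀ y, muTree (C (idem y) :: z) = 0 := fun y =>
      muTree_of_pureCoord_eq_zero (pureCoord_idem y) (by simp)
    rw [List.nil_append, h1, mul_zero, ← C_mul, idem_mul_idem]
    split_ifs
    · exact h1 x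
    · rw [C_0]
      exact tLinear.map_zero h
  · have h2 : C (idem b.first.src) * muTree (b.poly :: z) = muTree (b.poly :: z) := by
      have h3 : muTree (b.poly :: z) = extend (fun ps => pureOp (b.toPure :: ps)) z :=
        extend_C_elt_cons _ _ _
      rw [h3, ← extend_const_mul]
      refine extend_congr fun ps _ => ?_
      obtain ⟨l, rfl⟩ := exists_map_toPure hm ps
      rw [← List.map_cons, pureOp_map_toPure hm, idem_mul_treeOp hm]
    rw [Alt.idem_mul_poly, List.nil_append, ← h2, ← mul_assoc, ← C_mul, idem_mul_idem]
    split_ifs with hx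
    · rw [hx, h2]
    · rw [C_0, zero_mul]
      exact tLinear.map_zero h

lemma muTree_mul_idem (hm : 3 ≤ m) (x : Vertex m) (a : (BordAlg m)[X])
    (z : List (BordAlg m)[X]) :
    muTree (z ++ [a * C (idem x)]) = muTree (z ++ [a]) * C (idem x) := by
  have h := muTree_mem_tLinear z []
  refine tLinear.ext hm (φ := fun a => muTree (z ++ [a * C (idem x)]))
    (tLinear.comp h (tLinear.mul_const tLinear.id _)) (tLinear.mul_const h _) (fun y => ?_)
    (fun b => ?_) a
  · have h1 : ∀ y, muTree (z ++ [C (idem y)]) = 0 := fun y =>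
      muTree_of_pureCoord_eq_zero (pureCoord_idem y) (by simp)
    rw [h1, zero_mul, ← C_mul, idem_mul_idem]
    split_ifs
    · exact h1 y
    · rw [C_0]
      exact tLinear.map_zero h
  · have h2 : muTree (z ++ [b.poly]) * C (idem b.last.tgt) = muTree (z ++ [b.poly]) := by
      refine extend_concat_mul _ (p := b.toPure) (fun xs => ?_) z
      obtain ⟨l, rfl⟩ := exists_map_toPure hm xs
      have h3 := pureOp_map_toPure hm (l ++ [b])
      rw [List.map_append, List.map_cons, List.map_nil] at h3
      rw [h3, treeOp_mul_idem hm]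
    rw [Alt.poly_mul_idem, ← h2, mul_assoc, ← C_mul, idem_mul_idem]
    split_ifs with hx
    · rw [h2]
    · rw [C_0, mul_zero]
      exact tLinear.map_zero h

lemma muTree_balanced (hm : 3 ≤ m) (v : Vertex m) (a b : (BordAlg m)[X])
    (x z : List (BordAlg m)[X]) :
    muTree (x ++ a * C (idem v) :: b :: z) = muTree (x ++ a :: C (idem v) * b :: z) := by
  have e : ∀ c d, muTree (x ++ c :: d :: z) = muTree ((x ++ [c]) ++ d :: z) := by simp
  have hl := fun d => muTree_mem_tLinear x (d :: z)
  have hr := fun c => muTree_mem_tLinear (x ++ [c]) z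
  have hi : ∀ y d, muTree (x ++ C (idem y) :: d :: z) = 0 := fun y d =>
    muTree_of_pureCoord_eq_zero (pureCoord_idem y) (by simp)
  have hi' : ∀ y c, muTree (x ++ c :: C (idem y) :: z) = 0 := fun y d =>
    muTree_of_pureCoord_eq_zero (pureCoord_idem y) (by simp)
  have h0 : ∀ d, muTree (x ++ 0 :: d :: z) = 0 := fun d => tLinear.map_zero (hl d)
  have h0' : ∀ c, muTree (x ++ c :: 0 :: z) = 0 := fun c => by
    rw [e]
    exact tLinear.map_zero (hr c)
  refine tLinear.ext hm (φ := fun a => muTree (x ++ a * C (idem v) :: b :: z))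
    (ψ := fun a => muTree (x ++ a :: C (idem v) * b :: z))
    (tLinear.comp (hl b) (tLinear.mul_const tLinear.id _)) (hl _) (fun y => ?_) (fun a => ?_) a
  · rw [hi, ← C_mul, idem_mul_idem]
    split_ifs
    · exact hi _ _
    · rw [C_0]
      exact h0 b
  · refine tLinear.ext hm (φ := fun b => muTree (x ++ a.poly * C (idem v) :: b :: z))
      (ψ := fun b => muTree (x ++ a.poly :: C (idem v) * b :: z)) ?_ ?_ (fun y => ?_)
      (fun b => ?_) b
    · simp only [e]
      exact hr _
    · simp only [e]
      exact tLinear.comp (hr _) (tLinear.const_mul tLinear.id _)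
    · rw [hi', ← C_mul, idem_mul_idem]
      split_ifs
      · exact (hi' _ _).symm
      · rw [C_0]
        exact (h0' _).symm
    · rw [Alt.poly_mul_idem, Alt.idem_mul_poly]
      have hne : a.last.tgt ≠ b.first.src → muTree (x ++ a.poly :: b.poly :: z) = 0 := by
        intro hne
        refine extend_append_of_eq_zero _ (p := a.toPure) (q := b.toPure) (fun xs zs => ?_) x z
        obtain ⟨l, rfl⟩ := exists_map_toPure hm xs
        obtain ⟨l', rfl⟩ := exists_map_toPure hm zs
        have h3 := pureOp_map_toPure hm (l ++ a :: b :: l')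
        rw [List.map_append, List.map_cons, List.map_cons] at h3
        rw [h3, treeOp_of_tgt_ne hne]
      split_ifs with h1 h2 h2
      · rfl
      · rw [h0']
        exact hne fun h => h2 (h1.symm.trans h)
      · rw [h0]
        exact (hne fun h => h1 (h.trans h2.symm)).symm
      · rw [h0, h0']

/-! ### Sums over the cuts of a sequence -/

/-- The sum over all ways to write a list as `x ++ y`. -/
def sumCut {α M : Type*} [AddCommMonoid M] : (List α → List α → M) → List α → M
  | F, [] => F [] []
  | F, a :: l => F [] (a :: l) + sumCut (fun x y => F (a :: x) y) l

section sums

variable {α M : Type*} [AddCommMonoid M] {F G : List α → List α → M} {l : List α}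

lemma sumCut_congr (h : ∀ x y, l = x ++ y → F x y = G x y) : sumCut F l = sumCut G l := by
  induction l generalizing F G with
  | nil => exact h [] [] rfl
  | cons a l ih =>
    rw [sumCut, sumCut, h [] (a :: l) rfl, ih fun x y e => h (a :: x) y (by rw [e]; rfl)]

lemma sumCut_eq_zero (h : ∀ x y, l = x ++ y → F x y = 0) : sumCut F l = 0 := by
  induction l generalizing F with
  | nil => exact h [] [] rfl
  | cons a l ih =>
    rw [sumCut, h [] (a :: l) rfl, ih fun x y e => h (a :: x) y (by rw [e]; rfl), add_zero]

lemma sumCut_add : sumCut (fun x y => F x y + G x y) l = sumCut F l + sumCut G l := by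
  induction l generalizing F G with
  | nil => rfl
  | cons a l ih => rw [sumCut, sumCut, sumCut, ih, add_add_add_comm]

lemma sumCut_map {β : Type*} (g : β → α) (l : List β) :
    sumCut F (l.map g) = sumCut (fun x y => F (x.map g) (y.map g)) l := by
  induction l generalizing F with
  | nil => rfl
  | cons a l ih => rw [List.map_cons, sumCut, sumCut, ih]; rfl

lemma sumCut_concat (a : α) : sumCut F (l ++ [a]) =
    sumCut (fun x y => F x (y ++ [a])) l + F (l ++ [a]) [] := by
  induction l generalizing F with
  | nil => rfl
  | cons b l ih => rw [List.cons_append, sumCut, sumCut, ih, add_assoc]; rfl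

lemma sumCut_eq_last (h : ∀ x a w, F x (a :: w) = 0) : sumCut F l = F l [] := by
  induction l generalizing F with
  | nil => rfl
  | cons a l ih => rw [sumCut, h, zero_add, ih fun x => h (a :: x)]

lemma sumCut_eq_first (h : ∀ a x w, F (a :: x) w = 0) : sumCut F l = F [] l := by
  rcases l with _ | ⟨a, l⟩
  · rfl
  · rw [sumCut, sumCut_eq_zero fun x y _ => h a x y, add_zero]

lemma sumCut_eq_add_sumElt : sumCut F l = F l [] + sumElt (fun x a y => F x (a :: y)) l := by
  induction l generalizing F with
  | nil => exact (add_zero _).symm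
  | cons a l ih => rw [sumCut, sumElt, ih, add_left_comm]

lemma sumCut_eq_add_sumElt' : sumCut F l = F [] l + sumElt (fun x a y => F (x ++ [a]) y) l := by
  induction l generalizing F with
  | nil => exact (add_zero _).symm
  | cons a l ih => rw [sumCut, sumElt, ih]; rfl

/-- Both sides sum over the ways to write a list as `x ++ y ++ z`. -/
lemma sumCut_assoc (F : List α → List α → List α → M) :
    sumCut (fun x w => sumCut (fun y z => F x y z) w) l =
      sumCut (fun w z => sumCut (fun x y => F x y z) w) l := by
  induction l generalizing F with
  | nil => rfl
  | cons a l ih =>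
    rw [sumCut, sumCut, sumCut, ih fun x => F (a :: x), add_assoc]
    simp only [sumCut, ← sumCut_add]

lemma sum_take_drop : ∑ i ∈ Finset.range (l.length + 1), F (l.take i) (l.drop i) =
    sumCut F l := by
  induction l generalizing F with
  | nil => simp [sumCut]
  | cons a l ih =>
    rw [List.length_cons, Finset.sum_range_succ', sumCut, ← ih, add_comm]
    rfl

lemma sumPair_eq_zero {F : List α → α → α → List α → M}
    (h : ∀ x a b z, l = x ++ a :: b :: z → F x a b z = 0) : sumPair F l = 0 := by
  refine sumElt_eq_zero fun x a y e => ?_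
  rcases y with _ | ⟨b, z⟩
  · rfl
  · exact h x a b z e

lemma sumPair_map {β : Type*} (F : List α → α → α → List α → M) (g : β → α) (l : List β) :
    sumPair F (l.map g) = sumPair (fun x a b z => F (x.map g) (g a) (g b) (z.map g)) l := by
  induction l generalizing F with
  | nil => rfl
  | cons a l ih =>
    rcases l with _ | ⟨b, l⟩
    · simp [sumPair, sumElt]
    · rw [List.map_cons, List.map_cons, sumPair_cons_cons, sumPair_cons_cons, ← List.map_cons, ih]
      rfl

section mem

variable {F : List α → α → α → List α → M} {k : α}

lemma sumPair_cons_of_mem (h : ∀ x a b z, k ∈ x → F x a b z = 0) (b : α) (w : List α) :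
    sumPair F (k :: b :: w) = F [] k b w := by
  rw [sumPair_cons_cons, sumPair_eq_zero fun _ _ _ _ _ => h _ _ _ _ (by simp), add_zero]

lemma sumPair_concat_of_mem (h : ∀ x a b z, k ∈ z → F x a b z = 0) (a : α) (u : List α) :
    sumPair F (u ++ [a, k]) = F u a k [] := by
  rw [sumPair_concat_concat, sumPair_eq_zero fun _ _ _ _ _ => h _ _ _ _ (by simp), zero_add]

lemma sumPair_append_of_mem (h : ∀ x a b z, k ∈ x ∨ k ∈ z → F x a b z = 0) (a b : α)
    (u w : List α) : sumPair F (u ++ a :: k :: b :: w) =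
      F u a k (b :: w) + F (u ++ [a]) k b w := by
  induction u generalizing F with
  | nil =>
    rw [List.nil_append, sumPair_cons_cons, sumPair_cons_of_mem]
    · rfl
    · exact fun x c d z hk => h _ c d z (Or.inl (List.mem_cons_of_mem _ hk))
  | cons c u ih =>
    have h1 := ih (F := fun x => F (c :: x))
      fun x d e z hk => h _ d e z (hk.imp_left (List.mem_cons_of_mem _))
    rcases u with _ | ⟨d, u⟩
    · rw [List.singleton_append, sumPair_cons_cons, h _ _ _ _ (by simp), zero_add]
      exact h1
    · rw [List.cons_append, List.cons_append, sumPair_cons_cons, h _ _ _ _ (by simp), zero_add]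
      exact h1

end mem

end sums

/-! ### The `A∞`-relation as a sum over cuts -/

/-- The sum over all ways to apply `ψ` to consecutive entries of a sequence and `φ` to the
result. -/
def insertSum (φ ψ : List (BordAlg m)[X] → (BordAlg m)[X]) (l : List (BordAlg m)[X]) :
    (BordAlg m)[X] :=
  sumCut (fun x w => sumCut (fun y z => φ (x ++ ψ y :: z)) w) l

lemma sum_mu_eq_insertSum (l : List (BordAlg m)[X]) :
    ∑ i ∈ Finset.range (l.length + 1), ∑ j ∈ Finset.Icc i l.length,
      mu (l.take i ++ mu ((l.take j).drop i) :: l.drop j) = insertSum mu mu l := by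
  rw [insertSum, ← sum_take_drop]
  refine Finset.sum_congr rfl fun i hi => ?_
  rw [← sum_take_drop, ← Finset.Ico_add_one_right_eq_Icc, Finset.sum_Ico_eq_sum_range,
    List.length_drop]
  have hi := Finset.mem_range.1 hi
  refine Finset.sum_congr (by rw [show l.length + 1 - i = l.length - i + 1 by omega])
    fun k _ => ?_
  rw [List.drop_take, List.drop_drop, Nat.add_sub_cancel_left]

/-- Functions of sequences which are multilinear over the polynomials in `t`. -/
def Multi (φ : List (BordAlg m)[X] → (BordAlg m)[X]) : Prop :=
  ∀ x z, (fun a => φ (x ++ a :: z)) ∈ tLinear m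

lemma multi_muTree : Multi (muTree (m := m)) := muTree_mem_tLinear

lemma multi_prodTwo : Multi (prodTwo (m := m)) := prodTwo_mem_tLinear

lemma sumCut_mem_tLinear {K : (BordAlg m)[X] → List (BordAlg m)[X] → List (BordAlg m)[X] →
    (BordAlg m)[X]} (h : ∀ x y, (fun a => K a x y) ∈ tLinear m) (l : List (BordAlg m)[X]) :
    (fun a => sumCut (K a) l) ∈ tLinear m := by
  induction l generalizing K with
  | nil => exact h [] []
  | cons b l ih => exact add_mem (h [] (b :: l)) (ih fun x y => h (b :: x) y)

lemma multi_sumCut {G : List (BordAlg m)[X] → List (BordAlg m)[X] → (BordAlg m)[X]}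
    (h₁ : ∀ w, Multi fun l => G l w) (h₂ : ∀ w, Multi (G w)) : Multi (sumCut G) := by
  intro x z
  induction x generalizing G with
  | nil => exact add_mem (h₂ [] [] z) (sumCut_mem_tLinear (fun x y => h₁ y [] x) z)
  | cons b x ih =>
    exact add_mem (h₂ [] (b :: x) z) (ih (fun w x z => h₁ w (b :: x) z) fun w => h₂ (b :: w))

lemma Multi.insertSum {φ ψ : List (BordAlg m)[X] → (BordAlg m)[X]} (hφ : Multi φ)
    (hψ : Multi ψ) : Multi (insertSum φ ψ) := by
  refine multi_sumCut (fun w x z => ?_) fun w => multi_sumCut (fun z x y => ?_) fun y x z => ?_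
  · refine sumCut_mem_tLinear (fun y z' => ?_) w
    simp only [List.append_assoc]
    exact hφ x _
  · exact tLinear.comp (hφ w z) (hψ x y)
  · have := hφ (w ++ ψ y :: x) z
    simp only [List.append_assoc] at this
    exact this

lemma Multi.zero_entry {φ : List (BordAlg m)[X] → (BordAlg m)[X]} (hφ : Multi φ)
    (x z : List (BordAlg m)[X]) : φ (x ++ 0 :: z) = 0 := tLinear.map_zero (hφ x z)

lemma Multi.add_entry {φ : List (BordAlg m)[X] → (BordAlg m)[X]} (hφ : Multi φ)
    (x z : List (BordAlg m)[X]) (a b : (BordAlg m)[X]) :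
    φ (x ++ (a + b) :: z) = φ (x ++ a :: z) + φ (x ++ b :: z) := (hφ x z).1 a b

/-- A multilinear function vanishes if it vanishes on sequences of idempotents and alternating
words. -/
lemma Multi.eq_zero (hm : 3 ≤ m) {φ : List (BordAlg m)[X] → (BordAlg m)[X]} (hφ : Multi φ)
    (h : ∀ l : List (BordAlg m)[X],
      (∀ a ∈ l, (∃ v, a = C (idem v)) ∨ ∃ b : Alt m, a = b.poly) → φ l = 0)
    (l : List (BordAlg m)[X]) : φ l = 0 := by
  suffices H : ∀ l x : List (BordAlg m)[X],
      (∀ a ∈ x, (∃ v, a = C (idem v)) ∨ ∃ b : Alt m, a = b.poly) → φ (x ++ l) = 0 from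
    H l [] (by simp)
  intro l
  induction l with
  | nil =>
    intro x hx
    rw [List.append_nil]
    exact h x hx
  | cons c l ih =>
    intro x hx
    have key : ∀ c, ((∃ v, c = C (idem v)) ∨ ∃ b : Alt m, c = b.poly) → φ (x ++ c :: l) = 0 := by
      intro c hc
      rw [List.append_cons]
      refine ih _ fun a ha => ?_
      rcases List.mem_append.1 ha with ha | ha
      · exact hx a ha
      · rwa [List.mem_singleton.1 ha]
    exact tLinear.ext hm (hφ x l) (zero_mem _) (fun v => key _ (Or.inl ⟨v, rfl⟩))
      (fun b => key _ (Or.inr ⟨b, rfl⟩)) c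

lemma insertSum_mu (hm : 3 ≤ m) (l : List (BordAlg m)[X]) : insertSum mu mu l =
    insertSum muTree muTree l + insertSum muTree prodTwo l + insertSum prodTwo muTree l +
      insertSum prodTwo prodTwo l := by
  have h : ∀ x y z : List (BordAlg m)[X], mu (x ++ mu y :: z) =
      muTree (x ++ muTree y :: z) + muTree (x ++ prodTwo y :: z) +
        prodTwo (x ++ muTree y :: z) + prodTwo (x ++ prodTwo y :: z) := by
    intro x y z
    rw [mu_eq hm y, mu_eq hm, multi_muTree.add_entry, multi_prodTwo.add_entry, ← add_assoc]
  simp only [insertSum, h, sumCut_add]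

/-! ### Terms with a product -/

lemma prodTwo_of_length {l : List (BordAlg m)[X]} (h : l.length ≠ 2) : prodTwo l = 0 := by
  rcases l with _ | ⟨a, _ | ⟨b, _ | ⟨c, l⟩⟩⟩
  · rfl
  · rfl
  · simp at h
  · rfl

/-- Composition with the product as inner operation. -/
lemma insertSum_prodTwo {φ : List (BordAlg m)[X] → (BordAlg m)[X]} (hφ : Multi φ)
    (l : List (BordAlg m)[X]) : insertSum φ prodTwo l =
      sumPair (fun x a b z => φ (x ++ (a * b) :: z)) l := by
  rw [insertSum, sumCut_eq_add_sumElt]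
  have h0 : φ (l ++ [prodTwo []]) = 0 := hφ.zero_entry l []
  refine (congrArg (· + _) h0).trans ((zero_add _).trans (sumElt_congr fun x a w _ => ?_))
  have h1 : ∀ w, φ (x ++ prodTwo [] :: w) = 0 := hφ.zero_entry x
  have h2 : ∀ w, φ (x ++ prodTwo [a] :: w) = 0 := hφ.zero_entry x
  rw [sumCut, h1, zero_add]
  rcases w with _ | ⟨b, z⟩
  · exact h2 []
  · rw [sumCut, h2, zero_add]
    exact sumCut_eq_first fun c y z' => hφ.zero_entry x z'

lemma insertSum_prodTwo_prodTwo (l : List (BordAlg m)[X]) :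
    insertSum prodTwo prodTwo l = 0 := by
  rw [insertSum_prodTwo multi_prodTwo]
  by_cases h : l.length = 3
  · obtain ⟨a, b, c, rfl⟩ := List.length_eq_three.1 h
    rw [sumPair_cons_cons, sumPair_cons_cons]
    simp only [List.nil_append, List.cons_append, prodTwo, mul_assoc, sumPair, sumElt, add_zero]
    exact poly_add_self _
  · refine sumPair_eq_zero fun x a b z e => prodTwo_of_length fun h' => h ?_
    rw [e]
    simp only [List.length_append, List.length_cons] at h' ⊢
    omega

/-- Composition with the product as outer operation. -/
lemma prodTwo_insertSum (ψ : List (BordAlg m)[X] → (BordAlg m)[X])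
    (a b : (BordAlg m)[X]) (l : List (BordAlg m)[X]) :
    insertSum prodTwo ψ (a :: l ++ [b]) = ψ (a :: l) * b + a * ψ (l ++ [b]) := by
  have h1 : ∀ w, sumCut (fun y z => prodTwo (ψ y :: z)) (w ++ [b]) = ψ w * b := by
    intro w
    rw [sumCut_concat, sumCut_eq_last]
    · exact add_zero _
    · exact fun x c w => prodTwo_of_length (by simp)
  have h2 : ∀ w, sumCut (fun y z => prodTwo (a :: ψ y :: z)) w = a * ψ w := fun w =>
    sumCut_eq_last fun x c w => rfl
  rw [insertSum, List.cons_append, sumCut]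
  refine congrArg₂ _ (h1 (a :: l)) ?_
  rw [sumCut_eq_first]
  · exact h2 _
  · intro c x w
    exact sumCut_eq_zero fun y z _ => prodTwo_of_length (by simp)

/-! ### Terms with two tree-counting operations -/

lemma insertSum_muTree_of_length (hm : 3 ≤ m) {φ : List (BordAlg m)[X] → (BordAlg m)[X]}
    (hφ : Multi φ) {l : List (BordAlg m)[X]} (h : l.length < 4) : insertSum φ muTree l = 0 := by
  refine sumCut_eq_zero fun x w e => sumCut_eq_zero fun y z e' => ?_
  rw [muTree_of_length hm (l := y), hφ.zero_entry]
  rw [e, e'] at h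
  simp only [List.length_append] at h
  omega

section pure

variable {φ : (BordAlg m)[X] → (BordAlg m)[X]}

lemma tLinear.map_cent (h : φ ∈ tLinear m) (hid : ∀ v, φ (C (idem v)) = 0) (l : List (Alt m)) :
    φ (cent l) = 0 := by
  rw [cent, tLinear.map_mul_cbar h, hid, zero_mul]

lemma tLinear.map_splitSum (h : φ ∈ tLinear m) (a : Alt m) (f : Alt m → Alt m → (BordAlg m)[X]) :
    φ (a.splitSum f) = a.splitSum fun b c => φ (f b c) := tLinear.map_finset_sum h _ _

lemma tLinear.map_extL (h : φ ∈ tLinear m) (a : Alt m) (l : List (Alt m)) :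
    φ (extL cent (a :: l)) = a.splitSum fun b c => φ b.poly * cbar (c :: l) := by
  rw [extL_cons, tLinear.map_splitSum h]
  refine Alt.splitSum_congr fun b c hc _ => ?_
  rw [poly_mul_cent hc.tgt_eq, cbar_comm, tLinear.map_mul_cbar h]

lemma tLinear.map_extR (hm : 3 ≤ m) (h : φ ∈ tLinear m) (a : Alt m) (l : List (Alt m)) :
    φ (extR cent (l ++ [a])) = a.splitSum fun b c => φ c.poly * cbar (l ++ [b]) := by
  rw [extR_concat, tLinear.map_splitSum h]
  refine Alt.splitSum_congr fun b c hc _ => ?_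
  rw [cent_mul_poly hm hc.tgt_eq, cbar_comm, tLinear.map_mul_cbar h]

end pure

/-- Only extended inner operations contribute to compositions, since the value of a centered inner
operation is a multiple of an idempotent. -/
lemma insertSum_muTree_muTree (hm : 3 ≤ m) (l : List (Alt m)) :
    insertSum muTree muTree (l.map Alt.poly) =
      (leftTerms treeOp l + leftEndTerms treeOp l) +
        (rightTerms treeOp l + rightEndTerms treeOp l) := by
  have key : ∀ x y z : List (Alt m), muTree (x.map Alt.poly ++ treeOp y :: z.map Alt.poly) =
      muTree (x.map Alt.poly ++ extL cent y :: z.map Alt.poly) +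
        muTree (x.map Alt.poly ++ extR cent y :: z.map Alt.poly) := by
    intro x y z
    have h := multi_muTree (x.map Alt.poly) (z.map (Alt.poly (m := m)))
    rw [treeOp, multi_muTree.add_entry, multi_muTree.add_entry]
    have h1 := tLinear.map_cent h (fun v =>
      muTree_of_pureCoord_eq_zero (pureCoord_idem v) (by simp)) y
    beta_reduce at h1
    rw [h1, zero_add]
  have hp : ∀ (x z : List (Alt m)) (b : Alt m),
      muTree (x.map Alt.poly ++ b.poly :: z.map Alt.poly) = treeOp (x ++ b :: z) := by
    intro x z b
    rw [← muTree_map hm, List.map_append, List.map_cons]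
  have hL : sumCut (fun x w => sumCut (fun y z =>
      muTree (x.map Alt.poly ++ extL cent y :: z.map Alt.poly)) w) l =
      leftTerms treeOp l + leftEndTerms treeOp l := by
    have h1 : leftTerms treeOp l + leftEndTerms treeOp l =
        sumCut (fun w z => sumSplit (fun x y => treeOp (x ++ z) * cbar y) w) l := by
      rw [sumCut_eq_add_sumElt, add_comm]
      simp only [List.append_nil]
      rfl
    rw [h1, sumCut_assoc]
    refine sumCut_congr fun w z _ => ?_
    rw [sumCut_eq_add_sumElt]
    have h0 : muTree (w.map Alt.poly ++ extL cent [] :: z.map Alt.poly) = 0 :=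
      multi_muTree.zero_entry _ _
    rw [h0, zero_add]
    refine sumElt_congr fun x u y _ => ?_
    rw [tLinear.map_extL (multi_muTree (x.map Alt.poly) (z.map Alt.poly))]
    simp only [hp, List.append_assoc, List.singleton_append]
  have hR : sumCut (fun x w => sumCut (fun y z =>
      muTree (x.map Alt.poly ++ extR cent y :: z.map Alt.poly)) w) l =
      rightTerms treeOp l + rightEndTerms treeOp l := by
    have h1 : rightTerms treeOp l + rightEndTerms treeOp l =
        sumCut (fun x w => sumSplit (fun y z => treeOp (x ++ z) * cbar y) w) l := by
      rw [sumCut_eq_add_sumElt', add_comm]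
      simp only [List.append_assoc, List.singleton_append]
      rfl
    rw [h1]
    refine sumCut_congr fun x w _ => ?_
    rw [sumCut_eq_add_sumElt']
    have h0 : muTree (x.map Alt.poly ++ extR cent [] :: w.map Alt.poly) = 0 :=
      multi_muTree.zero_entry _ _
    rw [h0, zero_add]
    refine sumElt_congr fun y u z _ => ?_
    rw [tLinear.map_extR hm (multi_muTree (x.map Alt.poly) (z.map Alt.poly))]
    simp only [hp]
  rw [← hL, ← hR, insertSum, sumCut_map, ← sumCut_add]
  refine sumCut_congr fun x w _ => ?_
  rw [sumCut_map, ← sumCut_add]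
  refine sumCut_congr fun y z _ => ?_
  rw [muTree_map hm, key]

/-! ### The `A∞`-relation -/

lemma insertSum_mu_map (hm : 3 ≤ m) (a b : Alt m) (l : List (Alt m)) :
    insertSum mu mu ((a :: l ++ [b]).map Alt.poly) = 0 := by
  have h2 : insertSum muTree prodTwo ((a :: l ++ [b]).map Alt.poly) =
      mulTerms treeOp (a :: l ++ [b]) := by
    rw [insertSum_prodTwo multi_muTree, sumPair_map]
    refine sumPair_congr fun x c d z _ => ?_
    rw [Alt.poly_mul_poly hm]
    split_ifs
    · rw [← muTree_map hm, List.map_append, List.map_cons]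
    · exact multi_muTree.zero_entry _ _
  have h3 : insertSum prodTwo muTree ((a :: l ++ [b]).map Alt.poly) =
      treeOp (a :: l) * b.poly + a.poly * treeOp (l ++ [b]) := by
    rw [← muTree_map hm, ← muTree_map hm, List.map_append, List.map_cons, List.map_singleton,
      prodTwo_insertSum, List.map_append, List.map_singleton]
  rw [insertSum_mu hm, insertSum_muTree_muTree hm, h2, h3, insertSum_prodTwo_prodTwo]
  refine Eq.trans ?_ (treeOp_relation hm a b l)
  abel

/-- If an entry is an idempotent, only the two products with its neighbours survive, and they cancel
since the operations are balanced, or against the outer products at the ends of the sequence. -/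
lemma insertSum_mu_of_idem_mem (hm : 3 ≤ m) (v : Vertex m) (u w : List (BordAlg m)[X])
    (h2 : 2 ≤ (u ++ C (idem v) :: w).length) :
    insertSum mu mu (u ++ C (idem v) :: w) = 0 := by
  have hv : ∀ l : List (BordAlg m)[X], C (idem v) ∈ l → muTree l = 0 := fun l =>
    muTree_of_pureCoord_eq_zero (pureCoord_idem v)
  have hs : insertSum muTree muTree (u ++ C (idem v) :: w) = 0 := by
    refine sumCut_eq_zero fun x y e => sumCut_eq_zero fun y z e' => ?_
    have hmem : C (idem v) ∈ x ++ (y ++ z) := by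
      rw [← e', ← e]
      simp
    simp only [List.mem_append] at hmem
    rcases hmem with h | h | h
    · exact hv _ (by simp [h])
    · rw [hv y h]
      exact multi_muTree.zero_entry _ _
    · exact hv _ (by simp [h])
  rw [insertSum_mu hm, hs, insertSum_prodTwo_prodTwo, insertSum_prodTwo multi_muTree, zero_add,
    add_zero]
  have hx : ∀ (x : List (BordAlg m)[X]) (a b : (BordAlg m)[X]) (z : List (BordAlg m)[X]),
      C (idem v) ∈ x ∨ C (idem v) ∈ z → muTree (x ++ (a * b) :: z) = 0 :=
    fun x a b z h => hv _ (by rcases h with h | h <;> simp [h])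
  rcases List.eq_nil_or_concat u with rfl | ⟨u, a, rfl⟩
  · rcases List.eq_nil_or_concat w with rfl | ⟨w, c, rfl⟩
    · simp at h2
    · rw [List.concat_eq_append]
      obtain ⟨b, z, hb⟩ : ∃ b z, w ++ [c] = b :: z := List.exists_cons_of_ne_nil (by simp)
      have h3 := prodTwo_insertSum muTree (C (idem v)) c w
      rw [hv (C (idem v) :: w) (by simp), zero_mul, zero_add, List.cons_append] at h3
      rw [List.nil_append, h3, hb, sumPair_cons_of_mem fun x a b z h => hx x a b z (Or.inl h),
        List.nil_append, muTree_idem_mul hm]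
      exact poly_add_self _
  · rw [List.concat_eq_append]
    rcases List.eq_nil_or_concat w with rfl | ⟨w, c, rfl⟩
    · obtain ⟨b, z, hb⟩ : ∃ b z, u ++ [a] = b :: z := List.exists_cons_of_ne_nil (by simp)
      have h3 := prodTwo_insertSum muTree b (C (idem v)) z
      rw [hv (z ++ [C (idem v)]) (by simp), mul_zero, add_zero, ← hb] at h3
      rw [h3, List.append_assoc, List.singleton_append,
        sumPair_concat_of_mem fun x a b z h => hx x a b z (Or.inr h), muTree_mul_idem hm]
      exact poly_add_self _
    · rw [List.concat_eq_append]
      obtain ⟨d, y, hd⟩ : ∃ d y, u ++ [a] = d :: y := List.exists_cons_of_ne_nil (by simp)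
      obtain ⟨b, z, hb⟩ : ∃ b z, w ++ [c] = b :: z := List.exists_cons_of_ne_nil (by simp)
      have h3 := prodTwo_insertSum muTree d c (y ++ C (idem v) :: w)
      rw [hv _ (by simp), hv _ (by simp), zero_mul, mul_zero, add_zero] at h3
      have h4 : u ++ [a] ++ C (idem v) :: (w ++ [c]) = d :: (y ++ C (idem v) :: w) ++ [c] := by
        rw [hd]
        simp
      rw [show insertSum prodTwo muTree (u ++ [a] ++ C (idem v) :: (w ++ [c])) = 0 by
        rw [h4, h3], hb, List.append_assoc, List.singleton_append, sumPair_append_of_mem hx,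
        muTree_balanced hm, add_zero, List.append_assoc, List.singleton_append]
      exact poly_add_self _

theorem insertSum_mu_mu (hm : 3 ≤ m) (l : List (BordAlg m)[X]) : insertSum mu mu l = 0 := by
  have hmu : Multi (mu (m := m)) := mu_mem_tLinear hm
  refine (hmu.insertSum hmu).eq_zero hm (fun l hl => ?_) l
  by_cases h2 : 2 ≤ l.length
  · by_cases hid : ∃ v, C (idem v) ∈ l
    · obtain ⟨v, hv⟩ := hid
      obtain ⟨u, w, rfl⟩ := List.append_of_mem hv
      exact insertSum_mu_of_idem_mem hm v u w h2
    · have hpoly : ∀ a ∈ l, ∃ b : Alt m, b.poly = a := fun a ha => by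
        rcases hl a ha with ⟨v, rfl⟩ | ⟨b, rfl⟩
        · exact absurd ⟨v, ha⟩ hid
        · exact ⟨b, rfl⟩
      obtain ⟨L, rfl⟩ : ∃ L : List (Alt m), L.map Alt.poly = l := by
        clear hl h2 hid
        induction l with
        | nil => exact ⟨[], rfl⟩
        | cons a l ih =>
          obtain ⟨b, rfl⟩ := hpoly a (by simp)
          obtain ⟨L, rfl⟩ := ih fun c hc => hpoly c (by simp [hc])
          exact ⟨b :: L, rfl⟩
      rw [List.length_map] at h2
      rcases L with _ | ⟨a, L⟩
      · simp at h2
      · rcases List.eq_nil_or_concat L with rfl | ⟨L, b, rfl⟩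
        · simp at h2
        · rw [List.concat_eq_append]
          exact insertSum_mu_map hm a b L
  · rw [insertSum_mu hm, insertSum_muTree_of_length hm multi_muTree (by omega),
      insertSum_muTree_of_length hm multi_prodTwo (by omega), insertSum_prodTwo_prodTwo,
      insertSum_prodTwo multi_muTree, sumPair_eq_zero, add_zero, add_zero, add_zero]
    intro x a b z e
    rw [e] at h2
    simp at h2
    omega

/-! ### The grading -/

lemma mul_mem_gr {d d' : ℤ} {f g : (BordAlg m)[X]} (hf : f ∈ gr m d) (hg : g ∈ gr m d') :
    f * g ∈ gr m (d + d') := by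
  intro e he
  rw [coeff_mul] at he
  obtain ⟨⟨i, j⟩, hij, h⟩ := Finset.exists_ne_zero_of_sum_ne_zero he
  have hi := hf i (left_ne_zero_of_mul h)
  have hj := hg j (right_ne_zero_of_mul h)
  rw [Finset.HasAntidiagonal.mem_antidiagonal] at hij
  rw [← hij, ← hi, ← hj]
  push_cast
  ring

lemma monomial_mem_gr (e : ℕ) (c : BordAlg m) : monomial e c ∈ gr m (e * (2 * m - 4)) := by
  intro i hi
  rw [coeff_monomial] at hi
  split_ifs at hi with h
  · rw [h]
  · exact absurd rfl hi

lemma C_mem_gr (c : BordAlg m) : C c ∈ gr m 0 := by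
  have := monomial_mem_gr 0 c
  rwa [Nat.cast_zero, zero_mul, monomial_zero_left] at this

lemma X_pow_mem_gr (e : ℕ) : (X ^ e : (BordAlg m)[X]) ∈ gr m (e * (2 * m - 4)) := by
  rw [X_pow_eq_monomial]
  exact monomial_mem_gr e 1

lemma isInternal_gr (hm : 3 ≤ m) : DirectSum.IsInternal (gr m) := by
  have hinj : ∀ e e' : ℕ, (e : ℤ) * (2 * m - 4) = e' * (2 * m - 4) → e = e' := by
    intro e e' h
    have h0 : (2 * m - 4 : ℤ) ≠ 0 := by omega
    exact_mod_cast mul_right_cancel₀ h0 h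
  have hcoeff : ∀ (x : DirectSum ℤ fun d => gr m d) (e : ℕ),
      (DirectSum.coeAddMonoidHom (gr m) x).coeff e =
        (x (e * (2 * m - 4)) : (BordAlg m)[X]).coeff e := by
    intro x e
    induction x using DirectSum.induction_on with
    | zero => simp
    | of d y =>
      rw [DirectSum.coeAddMonoidHom_of]
      by_cases hd : d = e * (2 * m - 4)
      · subst hd
        rw [DirectSum.of_eq_same]
      · rw [DirectSum.of_eq_of_ne _ _ _ (Ne.symm hd)]
        by_contra hne
        exact hd (y.2 e (by simpa using hne)).symm
    | add x y hx hy => rw [map_add, coeff_add, hx, hy, DirectSum.add_apply]; rfl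
  constructor
  · rw [injective_iff_map_eq_zero]
    intro x hx
    refine DFinsupp.ext fun d => Subtype.ext (Polynomial.ext fun e => ?_)
    by_contra hne
    have hd := (x d).2 e (by simpa using hne)
    have h1 := hcoeff x e
    rw [hx, hd, coeff_zero] at h1
    exact hne h1.symm
  · intro f
    induction f using Polynomial.induction_on' with
    | add f g hf hg =>
      obtain ⟨x, rfl⟩ := hf
      obtain ⟨y, rfl⟩ := hg
      exact ⟨x + y, map_add _ _ _⟩
    | monomial e c =>
      exact ⟨DirectSum.of (fun d => gr m d) _ ⟨_, monomial_mem_gr e c⟩,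
        DirectSum.coeAddMonoidHom_of _ _ _⟩

lemma cbar_mem_gr (hm : 3 ≤ m) (l : List (Alt m)) : cbar l ∈ gr m (l.length - 2) := by
  unfold cbar
  split_ifs with h
  · obtain ⟨d, hd⟩ := h.exists_length hm
    have h1 := X_pow_mem_gr (m := m) (d + 1)
    have h2 : (l.length - 2) / (2 * m - 4) = d + 1 := by
      rw [hd, Nat.add_sub_cancel, Nat.mul_div_cancel _ (by omega)]
    have h3 : ((l.length : ℤ) - 2) = (d + 1 : ℕ) * (2 * m - 4) := by
      rw [hd]
      push_cast [Nat.cast_sub (show 4 ≤ 2 * m by omega)]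
      ring
    rw [h2, h3]
    exact h1
  · exact zero_mem _

lemma cent_mem_gr (hm : 3 ≤ m) (l : List (Alt m)) : cent l ∈ gr m (l.length - 2) := by
  have := mul_mem_gr (C_mem_gr (idem (headSrc l))) (cbar_mem_gr hm l)
  rwa [zero_add] at this

lemma treeOp_mem_gr (hm : 3 ≤ m) (l : List (Alt m)) : treeOp l ∈ gr m (l.length - 2) := by
  refine add_mem (add_mem (cent_mem_gr hm l) ?_) ?_
  · rcases l with _ | ⟨a, l⟩
    · exact zero_mem _
    · rw [extL_cons]
      refine sum_mem fun i _ => ?_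
      have := mul_mem_gr (C_mem_gr (Alt.elt ⟨a.first, i⟩))
        (cent_mem_gr hm (⟨Arrow.cont^[i + 1] a.first, a.extra - 1 - i⟩ :: l))
      rwa [zero_add] at this
  · rcases List.eq_nil_or_concat l with rfl | ⟨l, a, rfl⟩
    · exact zero_mem _
    · rw [List.concat_eq_append, extR_concat]
      refine sum_mem fun i _ => ?_
      have := mul_mem_gr (cent_mem_gr hm (l ++ [⟨a.first, i⟩]))
        (C_mem_gr (Alt.elt ⟨Arrow.cont^[i + 1] a.first, a.extra - 1 - i⟩))
      rw [add_zero] at this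
      rwa [List.length_append, List.length_singleton] at this ⊢

lemma extend_mem_gr {f : List (PurePath m) → (BordAlg m)[X]} {N : ℤ} {l : List (BordAlg m)[X]}
    {ds : List ℤ} (hl : List.Forall₂ (fun a d => a ∈ gr m d) l ds)
    (hf : ∀ ps, ps.length = l.length → f ps ∈ gr m N) : extend f l ∈ gr m (ds.sum + N) := by
  induction hl generalizing f with
  | nil =>
    rw [List.sum_nil, zero_add]
    exact hf [] rfl
  | @cons a d l ds ha _ ih =>
    refine sum_mem fun e he => sum_mem fun p _ => AddSubmonoid.nsmul_mem _ ?_ _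
    have h1 := ih (f := fun ps => f (p :: ps)) fun ps hps => hf _ (congrArg (· + 1) hps)
    have h2 := mul_mem_gr h1 (X_pow_mem_gr e)
    rw [ha e (mem_support_iff.1 he)] at h2
    rwa [List.sum_cons, add_assoc, add_comm]

lemma mu_mem_gr (hm : 3 ≤ m) (l : List (BordAlg m)[X]) (ds : List ℤ)
    (hl : List.Forall₂ (fun a d => a ∈ gr m d) l ds) :
    mu l ∈ gr m (ds.sum + (l.length : ℤ) - 2) := by
  rw [mu_eq hm]
  refine add_mem ?_ ?_
  · rw [add_sub_assoc]
    refine extend_mem_gr hl fun ps hps => ?_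
    obtain ⟨L, rfl⟩ := exists_map_toPure hm ps
    rw [pureOp_map_toPure hm, ← hps, List.length_map]
    exact treeOp_mem_gr hm L
  · by_cases h : l.length = 2
    · obtain ⟨a, b, rfl⟩ := List.length_eq_two.1 h
      obtain _ | ⟨ha, _ | ⟨hb, _ | _⟩⟩ := hl
      have := mul_mem_gr ha hb
      refine (congrArg (a * b ∈ gr m ·) ?_).mpr this
      simp
    · rw [prodTwo_of_length h]
      exact zero_mem _

/-! ### The bimodule structure -/

lemma charP_idempRing (m : ℕ) : CharP (idempRing m) 2 := by
  refine CharTwo.of_one_ne_zero_of_two_eq_zero (fun h => ?_) (Subtype.ext ?_)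
  · have h1 : (1 : BordAlg m) = 0 := congrArg Subtype.val h
    exact idem_ne_zero (m := m) 0 (by rw [← mul_one (idem 0), h1, mul_zero])
  · exact one_add_one_eq_two.symm.trans (BordAlg.add_self 1)

/-- The ground ring consists of the sums of idempotents. -/
lemma idempRing_induction {P : BordAlg m → Prop} (zero : P 0)
    (add : ∀ x y, P x → P y → P (x + y)) (mem : ∀ v, P (idem v)) (κ : idempRing m) : P κ := by
  obtain ⟨κ, hκ⟩ := κ
  suffices h : κ ∈ AddSubmonoid.closure (Set.range (idem (m := m))) by
    change P κ
    clear hκ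
    induction h using AddSubmonoid.closure_induction with
    | mem x hx =>
      obtain ⟨v, rfl⟩ := hx
      exact mem v
    | zero => exact zero
    | add x y _ _ hx hy => exact add x y hx hy
  have hmem : ∀ v, idem v ∈ AddSubmonoid.closure (Set.range (idem (m := m))) := fun v =>
    AddSubmonoid.subset_closure ⟨v, rfl⟩
  induction hκ using Subring.closure_induction with
  | mem x hx => exact AddSubmonoid.subset_closure hx
  | zero => exact zero_mem _
  | one =>
    rw [one_eq_sum_idem]
    exact sum_mem fun v _ => hmem v
  | add x y _ _ hx hy => exact add_mem hx hy
  | neg x _ hx => rwa [neg_eq_of_add_eq_zero_left (BordAlg.add_self x)]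
  | mul x y hx' hy' hx hy =>
    clear hx' hy'
    induction hx using AddSubmonoid.closure_induction with
    | zero => rw [zero_mul]; exact zero_mem _
    | add x x' _ _ hx hx' => rw [add_mul]; exact add_mem hx hx'
    | mem x hx =>
      obtain ⟨v, rfl⟩ := hx
      induction hy using AddSubmonoid.closure_induction with
      | zero => rw [mul_zero]; exact zero_mem _
      | add x x' _ _ hx hx' => rw [mul_add]; exact add_mem hx hx'
      | mem y hy =>
        obtain ⟨w, rfl⟩ := hy
        rw [idem_mul_idem]
        split_ifs
        · exact hmem v
        · exact zero_mem _

lemma multi_mu (hm : 3 ≤ m) : Multi (mu (m := m)) := mu_mem_tLinear hm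

lemma mu_smul (hm : 3 ≤ m) (z : List (BordAlg m)[X]) (a : (BordAlg m)[X]) (κ : idempRing m) :
    mu ((κ • a) :: z) = κ • mu (a :: z) := by
  have h0 := (multi_mu hm).zero_entry [] z
  have hadd := (multi_mu hm).add_entry [] z
  rw [smul_def, smul_def]
  refine idempRing_induction (P := fun c => mu (C c * a :: z) = C c * mu (a :: z))
    ?_ (fun k l hk hl => ?_) (fun v => ?_) κ
  · rwa [C_0, zero_mul, zero_mul]
  · rw [C_add, add_mul, add_mul, ← hk, ← hl]
    exact hadd _ _
  · rw [mu_eq hm, mu_eq hm, muTree_idem_mul hm, mul_add]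
    congr 1
    rcases z with _ | ⟨b, _ | ⟨c, z⟩⟩
    · exact (mul_zero _).symm
    · exact mul_assoc _ _ _
    · exact (mul_zero _).symm

lemma mu_op_smul (hm : 3 ≤ m) (x : List (BordAlg m)[X]) (a : (BordAlg m)[X])
    (κ : idempRing m) :
    mu (x ++ [MulOpposite.op κ • a]) = MulOpposite.op κ • mu (x ++ [a]) := by
  have h0 := (multi_mu hm).zero_entry x []
  have hadd := (multi_mu hm).add_entry x []
  rw [op_smul_def, op_smul_def]
  refine idempRing_induction (P := fun c => mu (x ++ [a * C c]) = mu (x ++ [a]) * C c)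
    ?_ (fun k l hk hl => ?_) (fun v => ?_) κ
  · rwa [C_0, mul_zero, mul_zero]
  · rw [C_add, mul_add, mul_add, ← hk, ← hl, hadd]
  · rw [mu_eq hm, mu_eq hm, muTree_mul_idem hm, add_mul]
    congr 1
    rcases x with _ | ⟨b, _ | ⟨c, x⟩⟩
    · exact (zero_mul _).symm
    · exact (mul_assoc _ _ _).symm
    · rw [prodTwo_of_length (by simp), prodTwo_of_length (by simp), zero_mul]

lemma mu_balanced (hm : 3 ≤ m) (x z : List (BordAlg m)[X]) (a b : (BordAlg m)[X])
    (κ : idempRing m) :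
    mu (x ++ (MulOpposite.op κ • a) :: b :: z) = mu (x ++ a :: (κ • b) :: z) := by
  have e : ∀ c, mu (x ++ a :: c :: z) = mu ((x ++ [a]) ++ c :: z) := by simp
  have h0 := (multi_mu hm).zero_entry x (b :: z)
  have hadd := (multi_mu hm).add_entry x (b :: z)
  have h0' := (multi_mu hm).zero_entry (x ++ [a]) z
  have hadd' := (multi_mu hm).add_entry (x ++ [a]) z
  rw [op_smul_def, smul_def]
  refine idempRing_induction (P := fun c => mu (x ++ a * C c :: b :: z) = mu (x ++ a :: C c * b :: z))
    ?_ (fun k l hk hl => ?_) (fun v => ?_) κ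
  · rw [C_0, mul_zero, zero_mul, h0, e, h0']
  · rw [C_add, mul_add, add_mul, hadd, e, hadd', ← e, ← e, hk, hl]
  · rw [mu_eq hm, mu_eq hm, muTree_balanced hm]
    congr 1
    rcases x with _ | ⟨c, x⟩
    · rcases z with _ | ⟨c, z⟩
      · exact mul_assoc _ _ _
      · rfl
    · rw [prodTwo_of_length (by simp; omega), prodTwo_of_length (by simp; omega)]

end BorderedKnot

end

theorem mainTheorem3 (m : ℕ) (hm : 3 ≤ m) :
    BorderedKnot.IsUnitalAInfinityAlgebra (BorderedKnot.idempRing m)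
      (A := Polynomial (BorderedKnot.BordAlg m))
      (BorderedKnot.gr m) BorderedKnot.mu 1 where
  char_two := BorderedKnot.charP_idempRing m
  internal := BorderedKnot.isInternal_gr hm
  smul_mem_gr d κ a ha := by
    have := BorderedKnot.mul_mem_gr (BorderedKnot.C_mem_gr (κ : BorderedKnot.BordAlg m)) ha
    rwa [zero_add, ← BorderedKnot.smul_def] at this
  op_smul_mem_gr d κ a ha := by
    have := BorderedKnot.mul_mem_gr ha (BorderedKnot.C_mem_gr (κ : BorderedKnot.BordAlg m))
    rwa [add_zero, ← BorderedKnot.op_smul_def] at this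
  map_add := (BorderedKnot.multi_mu hm).add_entry
  balanced := BorderedKnot.mu_balanced hm
  map_smul := BorderedKnot.mu_smul hm
  map_op_smul := BorderedKnot.mu_op_smul hm
  degree := BorderedKnot.mu_mem_gr hm
  map_nil := by
    rw [BorderedKnot.mu_eq hm, BorderedKnot.muTree_of_length hm (by simp),
      BorderedKnot.prodTwo_of_length (by simp), add_zero]
  relation l := by
    rw [BorderedKnot.sum_mu_eq_insertSum, BorderedKnot.insertSum_mu_mu hm]
  mul_unit := mul_one
  unit_mul := one_mul
  unit_vanish l hl h2 := by
    rw [BorderedKnot.mu_eq hm, BorderedKnot.prodTwo_of_length h2, add_zero]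
    exact BorderedKnot.muTree_of_pureCoord_eq_zero BorderedKnot.pureCoord_one hl
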